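/- Let $V$ be a finite set with $|V|=n$. A $k$-graph on $V$ is a family $\mathcal H\subseteq\binom{V}{k}$, and its complement is $\overline{\mathcal H}=\binom Vk\setminus\mathcal H$. For $S\in\binom V\ell$ let $\deg_{\mathcal H}(S)$ be the number of sets $T\subseteq V\setminus S$ with $S\cup T\in\mathcal H$, and let $\delta_\ell(\mathcal H)=\min_{S\in\binom V\ell}\deg_{\mathcal H}(S)$. For a partition $V=A\cup B$ (parts may be empty) let $\mathcal B_{n,k}(A,B)$ be the $k$-graph on $V$ whose edges are the $k$-subsets of $V$ that meet $A$ in an odd number of vertices; the edges of $\overline{\mathcal B}_{n,k}(A,B)$ are those that meet $A$ in an even number of vertices. For $k\mid n$ let $\mathcal H_{ext}(n,k)$ be the family of all $\mathcal B_{n,k}(A,B)$ with $n/k-|A|$ odd and all $\overline{\mathcal B}_{n,k}(A,B)$ with $|A|$ odd, and let $\delta(n,k,\ell)=\max_{\mathcal H\in\mathcal H_{ext}(n,k)}\delta_\ell(\mathcal H)$. A $k$-graph $\mathcal H$ on $n$ vertices is $\epsilon$-close to a $k$-graph $\mathcal H'$ on $n$ vertices if $\mathcal H$ can be turned into a copy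 of $\mathcal H'$ by adding and deleting at most $\epsilon n^k$ edges in total. A Hamilton $(\ell,k-\ell)$-cycle in $\mathcal H$ is a partition $(L_0,R_0,L_1,R_1,\dots,L_{t-1},R_{t-1})$ of $V$, $t\ge 1$, with $|L_i|=\ell$, $|R_i|=k-\ell$ such that $L_i\cup R_i$ and $R_i\cup L_{i+1}$ (subscripts modulo $t$) are edges of $\mathcal H$ for all $i$. **Theorem 1.3 (Extremal Case).** Given integers $k\ge 7$ and $\ell$ with $k/2\le\ell\le k-1$, there exist a real $\epsilon>0$ and an integer $n_0=n_0(k,\epsilon)$ such that the following holds. Let $\mathcal H$ be a $k$-graph on $n\ge n_0$ vertices, where $k\mid n$. If $\mathcal H$ is $\epsilon$-close to $\mathcal B_{n,k}(A,B)$ or to $\overline{\mathcal B}_{n,k}(A,B)$ for some partition $V(\mathcal H)=A\cup B$ with $\bigl||A|-|B|\bigr|\le 1$, and $\delta_\ell(\mathcal H)>\delta(n,k,\ell)$, then $\mathcal H$ contains a Hamilton $(\ell,k-\ell)$-cycle. -/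

import Mathlib

universe u v

/-- A `k`-uniform hypergraph (`k`-graph) with vertex set `V`: a family of `k`-element subsets
of `V`. -/
@[ext]
structure KGraph (V : Type u) (k : ℕ) where
  /-- the edges -/
  edges : Finset (Finset V)
  /-- every edge has exactly `k` vertices -/
  uniform : ∀ e ∈ edges, e.card = k

namespace KGraph

/-- The image of a `k`-graph under a bijection of the vertices: a copy of `H` on `V`. -/
def map {W : Type v} {V : Type u} {k : ℕ} (σ : W ≃ V) (H : KGraph W k) : KGraph V k where
  edges := H.edges.map (Finset.mapEmbedding σ.toEmbedding).toEmbedding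
  uniform := by
    intro e he
    obtain ⟨f, hf, rfl⟩ := Finset.mem_map.1 he
    simpa using H.uniform f hf

/-- The complement of `H`: all `k`-subsets of `V` that are not edges of `H`. -/
def compl {V : Type u} [Fintype V] [DecidableEq V] {k : ℕ} (H : KGraph V k) : KGraph V k where
  edges := Finset.powersetCard k Finset.univ \ H.edges
  uniform := by
    intro e he
    exact (Finset.mem_powersetCard.1 (Finset.mem_sdiff.1 he).1).2

/-- The link of a vertex set `S`: all sets `T` disjoint from `S` such that `S ∪ T` is an edge
(they have `k - |S|` elements). -/
def link {V : Type u} [Fintype V] [DecidableEq V] {k : ℕ} (H : KGraph V k) (S : Finset V) :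
    Finset (Finset V) :=
  {T : Finset V | Disjoint S T ∧ S ∪ T ∈ H.edges}

/-- The degree of a vertex set `S`. -/
def degree {V : Type u} [Fintype V] [DecidableEq V] {k : ℕ} (H : KGraph V k) (S : Finset V) : ℕ :=
  (H.link S).card

/-- The minimum `l`-degree: the minimum of the degrees of all `l`-element sets of vertices.
(If there is no `l`-element set, that is `|V| < l`, the value is `0`.) -/
noncomputable def minDegree {V : Type u} [Fintype V] [DecidableEq V] {k : ℕ} (H : KGraph V k)
    (l : ℕ) : ℕ :=
  sInf {d : ℕ | ∃ S : Finset V, S.card = l ∧ H.degree S = d}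

/-- The `k`-graph `B_{n,k}(A, B)` where `B` is the complement of `A`: its edges are the
`k`-subsets of `V` that meet `A` in an odd number of vertices. -/
def oddGraph {V : Type u} [Fintype V] [DecidableEq V] (k : ℕ) (A : Finset V) : KGraph V k where
  edges := {e ∈ Finset.powersetCard k Finset.univ | Odd (e ∩ A).card}
  uniform := by
    intro e he
    exact (Finset.mem_powersetCard.1 (Finset.mem_filter.1 he).1).2

/-- The edges of the complement of `B_{n,k}(A, B)` are the `k`-subsets that meet `A` in an even
number of vertices. -/
theorem mem_compl_oddGraph {V : Type u} [Fintype V] [DecidableEq V] (k : ℕ) (A e : Finset V) :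
    e ∈ (oddGraph k A).compl.edges ↔ e.card = k ∧ Even (e ∩ A).card := by
  simp only [compl, oddGraph, Finset.mem_sdiff, Finset.mem_filter, Finset.mem_powersetCard_univ,
    not_and, Nat.not_odd_iff_even]
  tauto

/-- The family `H_ext(n,k)` on the vertex set `{0, …, n-1}`: all `B_{n,k}(A, B)` for which
`n/k - |A|` is odd and the complements of all `B_{n,k}(A, B)` for which `|A|` is odd
(used for `k ∣ n`). -/
def extremalFamily (n k : ℕ) : Set (KGraph (Fin n) k) :=
  {H | ∃ A : Finset (Fin n),
    (Odd (((n / k : ℕ) : ℤ) - (A.card : ℤ)) ∧ H = oddGraph k A) ∨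
    (Odd A.card ∧ H = (oddGraph k A).compl)}

/-- The number `δ(n,k,l)`: the maximum (over a finite family) of the minimum `l`-degrees of the
members of `H_ext(n,k)`. -/
noncomputable def extremalDegree (n k l : ℕ) : ℕ :=
  sSup {d : ℕ | ∃ H ∈ extremalFamily n k, H.minDegree l = d}

/-- `H` is `ε`-close to `H'`: adding and deleting at most `ε n ^ k` edges turns `H` into a copy
of `H'`, where `n` is the number of vertices. -/
def IsClose {V : Type u} {W : Type v} [Fintype V] [DecidableEq V] {k : ℕ} (ε : ℝ)
    (H : KGraph V k) (H' : KGraph W k) : Prop :=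
  ∃ σ : W ≃ V,
    ((symmDiff H.edges (H'.map σ).edges).card : ℝ) ≤ ε * (Fintype.card V : ℝ) ^ k

/-- The two parts `A` and `V \ A` have almost equal size, that is, their sizes differ by at
most one. -/
def IsBalanced {V : Type u} [Fintype V] [DecidableEq V] (A : Finset V) : Prop :=
  A.card ≤ Aᶜ.card + 1 ∧ Aᶜ.card ≤ A.card + 1

/-- `H` contains a Hamilton `(l, k - l)`-cycle: for some `t ≥ 1` there is a partition
`(L 0, R 0, …, L (t-1), R (t-1))` of the vertex set with `|L i| = l` and `|R i| = k - l` such that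
all `L i ∪ R i` and `R i ∪ L (i+1)` are edges. Indices are in `Fin t`, where addition is
modulo `t`. -/
def HasHamiltonCycle {V : Type u} [DecidableEq V] {k : ℕ} (H : KGraph V k) (l : ℕ) : Prop :=
  ∃ (t : ℕ) (_ : NeZero t) (L R : Fin t → Finset V),
    (∀ i, (L i).card = l) ∧ (∀ i, (R i).card = k - l) ∧
    Pairwise (Function.onFun Disjoint (Sum.elim L R)) ∧
    (∀ x : V, ∃ i, x ∈ L i ∨ x ∈ R i) ∧
    ∀ i, L i ∪ R i ∈ H.edges ∧ R i ∪ L (i + 1) ∈ H.edges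

end KGraph

open Finset


/-! Put `x = k - l`, so `x ≤ l`, and let `τ` be the parity of `|e ∩ A|` for the edges `e` of the
parity graph that `H` is close to. Call a `k`-set right if it has this parity and wrong otherwise;
`H` contains almost all right sets. In a Hamilton cycle the edges `L i ∪ R i` partition `V`, and so
do the edges `R i ∪ L (i+1)`. A cycle of right edges therefore forces `|A| ≡ tτ` modulo 2, where `t
= n / k`, and the members of the extremal family are exactly the parity graphs that violate this
congruence.

If the congruence fails, each of the two perfect matchings needs an odd number of wrong edges. The
minimum degree exceeds that of the parity graph with the same `|A|`. The degree of an `l`-set in a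
parity graph depends only on its number of vertices in `A`, so for some `i` every `l`-set with `i`
vertices in `A` lies in a wrong edge. Either some `l`-set or `x`-set has many wrong neighbours, or
there are at least a constant times `n ^ l` wrong edges. In the latter case an intersection theorem
proved by the delta-system method, `exists_disjoint_or_card_inter_eq`, yields two wrong edges that
are disjoint or meet in exactly `l` vertices. In each case `exists_hasShiftPath` builds a path of
bounded length with one wrong edge in each matching.

After a few vertices change sides (`exists_adjusted_part`), every vertex is typical or lies in many
right edges. The path is extended through the vertices of the second kind (`exists_absorb_set`).
`exists_completion` then closes it to a cycle. Further `x`-sets of low degree in the graph of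
missing right sets are chosen greedily, with a potential function ensuring that each remaining
vertex is compatible with most of them. The remaining vertices are distributed into `l`-sets between
consecutive `x`-sets by a local-improvement argument of Daykin–Häggkvist type
(`exists_perm_forall`). The numbers of vertices in `A` fit because each `l`-set may have one of
three sizes in `A`, all of the right parity. -/

/-! ### Intersection-closed families of subsets of a `k`-set. -/

/-- **Frankl–Katona**: if no nonempty subfamily `Y` of a family of subsets of `P` meets in exactly
`|Y| - 1` points, then the family has at most `|P|` members. -/
theorem card_le_of_card_inter_ne {α ι : Type*} [DecidableEq α] [DecidableEq ι]
    (P : Finset α) (I : Finset ι) (A : ι → Finset α) (hA : ∀ i ∈ I, A i ⊆ P)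
    (h : ∀ Y ⊆ I, Y.Nonempty → #{p ∈ P | ∀ y ∈ Y, p ∈ A y} + 1 ≠ #Y) : #I ≤ #P := by
  induction hn : #P using Nat.strong_induction_on generalizing P I A with
  | _ n ih =>
  subst hn
  -- A point of `A i` lies in at most `|A i|` members: apply induction on the ground set `A i`
  -- without `p` to the traces of the other members through `p`. Adding `i` to a bad subfamily of
  -- traces gives a bad subfamily of the original, since `p` adds one point and `i` one member.
  have hdeg : ∀ i ∈ I, ∀ p ∈ A i, #{j ∈ I | p ∈ A j} ≤ #(A i) := by
    intro i hi p hp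
    have hlt : #((A i).erase p) < #P :=
      (card_erase_lt_of_mem hp).trans_le (card_le_card (hA i hi))
    have key := ih _ hlt ((A i).erase p) (({j ∈ I | p ∈ A j}).erase i)
      (fun j => (A j ∩ A i).erase p)
      (fun j _ => erase_subset_erase _ inter_subset_right) ?_ rfl
    · rw [card_erase_of_mem hp, card_erase_of_mem (by simp [hi, hp])] at key
      have : 0 < #(A i) := card_pos.2 ⟨p, hp⟩
      omega
    · intro Y hY hYn heq
      have hiY : i ∉ Y := fun hh => by simpa using hY hh
      have hYI : ∀ y ∈ Y, y ∈ I ∧ p ∈ A y := fun y hy => by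
        have := hY hy; simp only [mem_erase, mem_filter] at this; exact this.2
      refine h (insert i Y) ?_ (insert_nonempty _ _) ?_
      · intro y hy
        rcases mem_insert.1 hy with rfl | hy
        · exact hi
        · exact (hYI y hy).1
      · rw [card_insert_of_notMem hiY, ← heq]
        have : ({q ∈ P | ∀ y ∈ insert i Y, q ∈ A y} : Finset α)
            = insert p ({q ∈ (A i).erase p | ∀ y ∈ Y, q ∈ (A y ∩ A i).erase p}) := by
          ext q
          simp only [mem_filter, mem_insert, mem_erase, mem_inter, forall_eq_or_imp]
          constructor
          · rintro ⟨-, h1, h2⟩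
            by_cases hq : q = p
            · exact Or.inl hq
            · exact Or.inr ⟨⟨hq, h1⟩, fun y hy => ⟨hq, h2 y hy, h1⟩⟩
          · rintro (rfl | ⟨⟨-, h1⟩, h2⟩)
            · exact ⟨hA i hi hp, hp, fun y hy => (hYI y hy).2⟩
            · exact ⟨hA i hi h1, h1, fun y hy => (h2 y hy).2.1⟩
        rw [this, card_insert_of_notMem (by simp)]
  have hne : ∀ i ∈ I, 0 < #(A i) := by
    intro i hi
    rw [card_pos, nonempty_iff_ne_empty]
    intro h0
    apply h {i} (by simpa using hi) (by simp)
    simp [h0]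
  -- Each member spreads weight 1 evenly over its points. By the degree bound every point receives
  -- weight at most 1.
  have hsum : (#I : ℚ) = ∑ p ∈ P, ∑ i ∈ I with p ∈ A i, (1 : ℚ) / #(A i) := by
    calc (#I : ℚ) = ∑ i ∈ I, ∑ p ∈ A i, (1 : ℚ) / #(A i) := by
          rw [card_eq_sum_ones, Nat.cast_sum]
          refine sum_congr rfl fun i hi => ?_
          have := hne i hi
          rw [sum_const, nsmul_eq_mul]
          field_simp
          simp
      _ = _ := by
          apply sum_comm'
          intro i p
          simp only [mem_filter]
          exact ⟨fun h => ⟨⟨h.1, h.2⟩, hA i h.1 h.2⟩, fun h => h.1⟩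
  have : (#I : ℚ) ≤ ∑ p ∈ P, (1 : ℚ) := by
    rw [hsum]
    refine sum_le_sum fun p _ => ?_
    set D := ({i ∈ I | p ∈ A i} : Finset ι) with hD
    rcases D.eq_empty_or_nonempty with h0 | h0
    · simp [h0]
    · have hDp : (0 : ℚ) < #D := by exact_mod_cast card_pos.2 h0
      calc ∑ i ∈ D, (1 : ℚ) / #(A i) ≤ ∑ i ∈ D, (1 : ℚ) / #D := by
            refine sum_le_sum fun i hi => ?_
            rw [hD, mem_filter] at hi
            apply one_div_le_one_div_of_le hDp
            exact_mod_cast hdeg i hi.1 p hi.2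
        _ = 1 := by rw [sum_const, nsmul_eq_mul]; field_simp
  have h2 : (#I : ℚ) ≤ (#P : ℚ) := by simpa using this
  exact_mod_cast h2

/-- An intersection-closed family of proper nonempty subsets of a `k`-set which covers all sets
with fewer than `l ≥ k / 2` elements has a member with `l` elements. -/
theorem exists_card_eq_of_inter_closed {k l : ℕ} (hl : 1 ≤ l) (hkl : k ≤ 2 * l)
    (I : Finset (Finset (Fin k))) (hI : ∀ J₁ ∈ I, ∀ J₂ ∈ I, J₁ ∩ J₂ ∈ I) (h0 : ∅ ∉ I)
    (h1 : univ ∉ I) (hcov : ∀ X : Finset (Fin k), #X < l → ∃ J ∈ I, X ⊆ J) :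
    ∃ J ∈ I, #J = l := by
  have hinf : ∀ {κ : Type} (Y : Finset κ) (hY : Y.Nonempty) (f : κ → Finset (Fin k)),
      (∀ y ∈ Y, f y ∈ I) → Y.inf' hY f ∈ I := fun Y hY f hf =>
    inf'_mem (I : Set (Finset (Fin k))) (fun a ha b hb => hI a ha b hb) _ hY f hf
  have hIne : I.Nonempty := by
    obtain ⟨J, hJ, -⟩ := hcov ∅ (by simp; omega)
    exact ⟨J, hJ⟩
  -- The intersection of all members is itself a member, hence nonempty.
  obtain ⟨v, hv⟩ : ∃ v, ∀ J ∈ I, v ∈ J := by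
    have hm := hinf I hIne id (fun y hy => hy)
    have : (I.inf' hIne id).Nonempty := by
      rw [nonempty_iff_ne_empty]; intro h; rw [h] at hm; exact h0 hm
    obtain ⟨v, hv⟩ := this
    exact ⟨v, fun J hJ => (Finset.inf'_le (s := I) id hJ : I.inf' hIne id ≤ J) hv⟩
  -- A smallest uncovered set. For each `z ∈ Z` some member `J z` contains `Z` without `z`, and by
  -- the choice of `Z` it misses `z`.
  obtain ⟨Z, hZ, hZmin⟩ := exists_min_image
    ({X : Finset (Fin k) | ∀ J ∈ I, ¬ X ⊆ J}) (fun X => #X)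
    ⟨univ, by
      simp only [mem_filter, mem_univ, true_and]
      intro J hJ hs
      exact h1 (by rwa [univ_subset_iff.1 hs] at hJ)⟩
  simp only [mem_filter, mem_univ, true_and] at hZ hZmin
  have hZl : l ≤ #Z := by
    by_contra hlt
    obtain ⟨J, hJ, hs⟩ := hcov Z (by omega)
    exact hZ J hJ hs
  have hJz : ∀ z ∈ Z, ∃ J ∈ I, Z.erase z ⊆ J := by
    intro z hz
    by_contra hcon
    push Not at hcon
    have := hZmin _ hcon
    have := card_erase_lt_of_mem hz
    omega
  have : ∀ z, ∃ J, z ∈ Z → J ∈ I ∧ Z.erase z ⊆ J := fun z => by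
    by_cases hz : z ∈ Z
    · obtain ⟨J, hJ, h⟩ := hJz z hz; exact ⟨J, fun _ => ⟨hJ, h⟩⟩
    · exact ⟨∅, fun h => absurd h hz⟩
  choose J hJ using this
  have hzJ : ∀ z ∈ Z, z ∉ J z := by
    intro z hz hzz
    refine hZ (J z) (hJ z hz).1 ?_
    rw [← insert_erase hz]
    exact insert_subset hzz (hJ z hz).2
  have hvZ : v ∉ Z := fun h => hzJ v h (hv _ (hJ v h).1)
  set P0 := (Zᶜ).erase v with hP0
  have hZk : #Z ≤ k := by simpa using card_le_univ Z
  have hP0c : #P0 + 1 + #Z = k := by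
    rw [hP0, card_erase_of_mem (by simpa using hvZ), card_compl, Fintype.card_fin]
    have : #Z < k := by
      have := card_lt_univ_of_notMem hvZ; simpa using this
    omega
  -- The traces of the `J z` outside `Z` and `v` are padded by `|Z| - l` common dummy points. The
  -- ground set then has `k - 1 - l < l ≤ |Z|` points, so some `Y` violates the Frankl–Katona
  -- condition.
  have hFK := mt (card_le_of_card_inter_ne (P0.disjSum (univ : Finset (Fin (#Z - l)))) Z
    (fun z => (J z ∩ P0).disjSum univ)
    (fun z _ => disjSum_mono inter_subset_right (subset_refl _))) (by
      rw [card_disjSum, card_univ, Fintype.card_fin]; omega)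
  push Not at hFK
  obtain ⟨Y, hYZ, hYn, hYc⟩ := hFK
  have hcount : #({p ∈ P0.disjSum (univ : Finset (Fin (#Z - l))) |
      ∀ y ∈ Y, p ∈ (J y ∩ P0).disjSum univ}) = #{p ∈ P0 | ∀ y ∈ Y, p ∈ J y} + (#Z - l) := by
    have : ({p ∈ P0.disjSum (univ : Finset (Fin (#Z - l))) |
      ∀ y ∈ Y, p ∈ (J y ∩ P0).disjSum univ}) =
        ({p ∈ P0 | ∀ y ∈ Y, p ∈ J y}).disjSum univ := by
      ext p
      rcases p with p | p
      · simp only [mem_filter, inl_mem_disjSum, mem_inter]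
        exact ⟨fun h => ⟨h.1, fun y hy => (h.2 y hy).1⟩, fun h => ⟨h.1, fun y hy => ⟨h.2 y hy, h.1⟩⟩⟩
      · simp
    rw [this, card_disjSum, card_univ, Fintype.card_fin]
  replace hYc : #{p ∈ P0 | ∀ y ∈ Y, p ∈ J y} + (#Z - l) + 1 = #Y := by
    rw [← hcount]; convert hYc
  refine ⟨Y.inf' hYn J, hinf Y hYn J fun y hy => (hJ y (hYZ hy)).1, ?_⟩
  have hmem : ∀ p, p ∈ Y.inf' hYn J ↔ ∀ y ∈ Y, p ∈ J y := by
    intro p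
    rw [← singleton_subset_iff]
    rw [le_inf'_iff]
    simp
  -- The intersection over `Y` consists of `v`, of `Z \ Y` and of `|Y| - 1 - (|Z| - l)` points
  -- elsewhere, which makes exactly `l`.
  have hdec : Y.inf' hYn J = (insert v (Z \ Y)) ∪ {p ∈ P0 | ∀ y ∈ Y, p ∈ J y} := by
    ext p
    rw [hmem]
    simp only [mem_union, mem_insert, mem_sdiff, mem_filter, hP0, mem_erase, mem_compl]
    constructor
    · intro h
      by_cases hpv : p = v
      · exact Or.inl (Or.inl hpv)
      by_cases hpZ : p ∈ Z
      · exact Or.inl (Or.inr ⟨hpZ, fun hpY => hzJ p hpZ (h p hpY)⟩)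
      · exact Or.inr ⟨⟨hpv, hpZ⟩, h⟩
    · rintro ((rfl | ⟨h1, h2⟩) | ⟨-, h⟩)
      · exact fun y hy => hv _ (hJ y (hYZ hy)).1
      · exact fun y hy => (hJ y (hYZ hy)).2 (mem_erase.2 ⟨fun h => h2 (h ▸ hy), h1⟩)
      · exact h
  have hYZc := card_le_card hYZ
  rw [hdec, card_union_of_disjoint, card_insert_of_notMem (by simp [hvZ]), card_sdiff_of_subset hYZ]
  · omega
  · rw [disjoint_left]
    intro p hp hp'
    simp only [mem_filter, hP0, mem_erase, mem_compl, mem_insert, mem_sdiff] at hp hp'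
    rcases hp with rfl | hp
    · exact hp'.1.1 rfl
    · exact hp'.1.2 hp.1


/-! ### Agreement sets of tuples and the intersection theorem. -/

/-- The set of coordinates in which two tuples agree. -/
def agreement {k : ℕ} {V : Type*} [DecidableEq V] (w w' : Fin k → V) : Finset (Fin k) :=
  {c | w c = w' c}

/-- The agreement sets of the pairs of distinct members of a family of tuples. -/
def agreements {k : ℕ} {V : Type*} [DecidableEq V] (T : Finset (Fin k → V)) :
    Finset (Finset (Fin k)) :=
  T.offDiag.image fun p => agreement p.1 p.2

section
variable {k : ℕ} {V : Type*} [DecidableEq V]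

theorem mem_agreement {w w' : Fin k → V} {c : Fin k} : c ∈ agreement w w' ↔ w c = w' c := by
  simp [agreement]

theorem mem_agreements {T : Finset (Fin k → V)} {J : Finset (Fin k)} :
    J ∈ agreements T ↔ ∃ w ∈ T, ∃ w' ∈ T, w ≠ w' ∧ agreement w w' = J := by
  simp only [agreements, mem_image, mem_offDiag, Prod.exists]
  constructor
  · rintro ⟨a, b, ⟨h1, h2, h3⟩, h4⟩; exact ⟨a, h1, b, h2, h3, h4⟩
  · rintro ⟨a, h1, b, h2, h3, h4⟩; exact ⟨a, b, ⟨h1, h2, h3⟩, h4⟩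

theorem agreements_mono {T T' : Finset (Fin k → V)} (h : T ⊆ T') :
    agreements T ⊆ agreements T' :=
  image_subset_image (offDiag_mono h)

theorem univ_notMem_agreements (T : Finset (Fin k → V)) : univ ∉ agreements T := by
  rw [mem_agreements]
  rintro ⟨w, -, w', -, hne, h⟩
  exact hne (funext fun c => mem_agreement.1 (h ▸ mem_univ c))

/-- Every family of tuples has a large subfamily all of whose fairly large subfamilies realise the
same agreement sets. -/
theorem exists_robust {ρ : ℝ} (hρ : 0 < ρ) (hρ1 : ρ ≤ 1) (T : Finset (Fin k → V)) :
    ∃ T' ⊆ T, ρ ^ #(agreements T) * #T ≤ #T' ∧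
      ∀ T'' ⊆ T', ρ * #T' ≤ #T'' → agreements T'' = agreements T' := by
  induction hn : #(agreements T) using Nat.strong_induction_on generalizing T with
  | _ n ih =>
  subst hn
  by_cases hrob : ∀ T'' ⊆ T, ρ * #T ≤ #T'' → agreements T'' = agreements T
  · refine ⟨T, subset_refl _, ?_, hrob⟩
    exact mul_le_of_le_one_left (Nat.cast_nonneg _) (pow_le_one₀ hρ.le hρ1)
  · push Not at hrob
    obtain ⟨T'', hsub, hbig, hne⟩ := hrob
    -- A failure of robustness costs a factor `ρ` but destroys at least one agreement set, so this
    -- happens at most `#(agreements T)` times.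
    have hlt : #(agreements T'') < #(agreements T) :=
      card_lt_card ((agreements_mono hsub).ssubset_of_ne hne)
    obtain ⟨T', h1, h2, h3⟩ := ih _ hlt T'' rfl
    refine ⟨T', h1.trans hsub, ?_, h3⟩
    calc ρ ^ #(agreements T) * #T ≤ ρ ^ (#(agreements T'') + 1) * #T := by
          apply mul_le_mul_of_nonneg_right _ (Nat.cast_nonneg _)
          exact pow_le_pow_of_le_one hρ.le hρ1 hlt
      _ = ρ ^ #(agreements T'') * (ρ * #T) := by ring
      _ ≤ ρ ^ #(agreements T'') * #T'' := by gcongr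
      _ ≤ _ := h2

/-- If for every member `w` of `F` the members `w'` with `agreement w w' = J` all meet a fixed tuple
outside `J`, then a positive proportion of `F` has no two members with agreement set `J`. -/
theorem exists_large_subfamily_avoiding (F : Finset (Fin k → V)) (J : Finset (Fin k))
    (hF : ∀ w ∈ F, ∃ u : Fin k → V, ∀ w' ∈ F, agreement w w' = J → ∃ c ∉ J, w' c = u c)
    (hJ : J ≠ univ) :
    ∃ G ⊆ F, #F ≤ (2 * k) * #G ∧ J ∉ agreements G := by
  classical
  rcases F.eq_empty_or_nonempty with h0 | ⟨w, hw⟩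
  · exact ⟨∅, empty_subset _, by simp [h0], by simp [agreements]⟩
  set π : (Fin k → V) → (Fin k → Option V) := fun w c => if c ∈ J then some (w c) else none with hπ
  have hπJ : ∀ w w', π w = π w' ↔ J ⊆ agreement w w' := by
    intro w w'
    rw [hπ, funext_iff]
    constructor
    · intro h c hc
      have := h c
      simp only [hc, if_true, Option.some.injEq] at this
      exact mem_agreement.2 this
    · intro h c
      by_cases hc : c ∈ J
      · simp only [hc, if_true, Option.some.injEq]; exact mem_agreement.1 (h hc)
      · simp only [hc, if_false]
  have hfib : ∀ p ∈ F.image π, ∃ cv : Fin k × V, cv.1 ∉ J ∧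
      #{w ∈ F | π w = p} ≤ (2 * k) * #{w ∈ {w ∈ F | π w = p} | w cv.1 = cv.2} := by
    intro p hp
    obtain ⟨w₀, hw₀, rfl⟩ := mem_image.1 hp
    obtain ⟨u, hu⟩ := hF w₀ hw₀
    -- A tuple in the same `J`-class as `w₀` either agrees with `w₀` exactly on `J`, and then meets
    -- `u` outside `J`, or agrees with `w₀` in a further coordinate. So at most `2 * k` coordinate
    -- values outside `J` cover the class.
    set K : Finset (Fin k × V) :=
      ((Jᶜ).image fun c => (c, u c)) ∪ ((Jᶜ).image fun c => (c, w₀ c)) with hK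
    have hKc : #K ≤ 2 * k := by
      have h1 : #((Jᶜ).image fun c => (c, u c)) ≤ k :=
        card_image_le.trans ((card_le_univ _).trans (by simp))
      have h2 : #((Jᶜ).image fun c => (c, w₀ c)) ≤ k :=
        card_image_le.trans ((card_le_univ _).trans (by simp))
      exact (card_union_le _ _).trans (by omega)
    have hKJ : ∀ cv ∈ K, cv.1 ∉ J := by
      intro cv hcv
      simp only [hK, mem_union, mem_image, mem_compl] at hcv
      rcases hcv with ⟨c, hc, rfl⟩ | ⟨c, hc, rfl⟩ <;> exact hc
    have hKn : K.Nonempty := by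
      obtain ⟨c, hc⟩ : ∃ c, c ∉ J := by
        by_contra h; push Not at h; exact hJ (eq_univ_of_forall h)
      exact ⟨(c, u c), by simp [hK, hc]⟩
    have hcover : ({w ∈ F | π w = π w₀}) ⊆
        K.biUnion fun cv => {w ∈ {w ∈ F | π w = π w₀} | w cv.1 = cv.2} := by
      intro w hw
      have hw' := hw
      rw [mem_filter] at hw'
      have hsub := (hπJ _ _).1 hw'.2.symm
      by_cases heq : agreement w₀ w = J
      · obtain ⟨c, hc, hcu⟩ := hu w hw'.1 heq
        exact mem_biUnion.2 ⟨(c, u c), by simp [hK, hc], mem_filter.2 ⟨hw, hcu⟩⟩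
      · obtain ⟨c, hc, hcJ⟩ := exists_of_ssubset (hsub.ssubset_of_ne (Ne.symm heq))
        exact mem_biUnion.2 ⟨(c, w₀ c), by simp [hK, hcJ],
          mem_filter.2 ⟨hw, (mem_agreement.1 hc).symm⟩⟩
    obtain ⟨cv, hcv, hmax⟩ := exists_max_image K
      (fun cv => #{w ∈ {w ∈ F | π w = π w₀} | w cv.1 = cv.2}) hKn
    refine ⟨cv, hKJ cv hcv, ?_⟩
    calc _ ≤ _ := card_le_card hcover
      _ ≤ ∑ cv ∈ K, #{w ∈ {w ∈ F | π w = π w₀} | w cv.1 = cv.2} := card_biUnion_le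
      _ ≤ #K * _ := by rw [← smul_eq_mul]; exact sum_le_card_nsmul _ _ _ hmax
      _ ≤ _ := Nat.mul_le_mul_right _ hKc
  have hex : ∀ p, ∃ cv : Fin k × V, p ∈ F.image π → cv.1 ∉ J ∧
      #{w ∈ F | π w = p} ≤ (2 * k) * #{w ∈ {w ∈ F | π w = p} | w cv.1 = cv.2} := by
    intro p
    by_cases hp : p ∈ F.image π
    · obtain ⟨cv, h⟩ := hfib p hp; exact ⟨cv, fun _ => h⟩
    · obtain ⟨cv, -⟩ := hfib _ (mem_image_of_mem π hw); exact ⟨cv, fun h => absurd h hp⟩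
  choose g hg using hex
  -- Keep in each `J`-class only the tuples with its most popular value. Two survivors from one
  -- class also agree in a coordinate outside `J`.
  refine ⟨{w ∈ F | w (g (π w)).1 = (g (π w)).2}, filter_subset _ _, ?_, ?_⟩
  · rw [card_eq_sum_card_image π F,
      card_eq_sum_card_fiberwise (f := π) (t := F.image π)
        (fun w hw => by
          simp only [coe_filter, Set.mem_ofPred_eq] at hw
          exact mem_coe.2 (mem_image_of_mem π hw.1)), mul_sum]
    refine sum_le_sum fun p hp => ((hg p hp).2).trans (Nat.mul_le_mul_left _ (card_le_card ?_))
    intro w hw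
    simp only [mem_filter] at hw ⊢
    obtain ⟨⟨h1, rfl⟩, h2⟩ := hw
    exact ⟨⟨h1, h2⟩, rfl⟩
  · rw [mem_agreements]
    rintro ⟨w, hw, w', hw', hne, heq⟩
    rw [mem_filter] at hw hw'
    have hp : π w = π w' := (hπJ _ _).2 heq.ge
    have hc := (hg (π w) (mem_image_of_mem π hw.1)).1
    apply hc
    rw [← heq, mem_agreement, hw.2, hp, hw'.2]

/-- Call `w` bad for `J` if a single tuple `u` meets, outside `J`, all tuples whose agreement set
with `w` is `J`. Robustness and `exists_large_subfamily_avoiding` make bad tuples rare, so some `w`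
is bad for neither set. Choose `w₁` agreeing with `w` exactly on `J₁`, then `w₂` agreeing with `w`
exactly on `J₂` and avoiding `w₁` outside `J₂`. Then `w₁` and `w₂` agree exactly on the
intersection. -/
theorem inter_mem_agreements {ρ : ℝ} (hρ : 4 * k * ρ < 1) (T : Finset (Fin k → V))
    (hT : T.Nonempty) (hrob : ∀ T' ⊆ T, ρ * #T ≤ #T' → agreements T' = agreements T)
    {J₁ J₂ : Finset (Fin k)} (h₁ : J₁ ∈ agreements T) (h₂ : J₂ ∈ agreements T) :
    J₁ ∩ J₂ ∈ agreements T := by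
  classical
  set bad : Finset (Fin k) → Finset (Fin k → V) := fun J =>
    {w ∈ T | ∃ u : Fin k → V, ∀ w' ∈ T, agreement w w' = J → ∃ c ∉ J, w' c = u c} with hbad
  have hsmall : ∀ J ∈ agreements T, (#(bad J) : ℝ) ≤ 2 * k * ρ * #T := by
    intro J hJ
    obtain ⟨G, hG, hGc, hGJ⟩ := exists_large_subfamily_avoiding (bad J) J (by
      intro w hw
      obtain ⟨u, hu⟩ := (mem_filter.1 hw).2
      exact ⟨u, fun w' hw' => hu w' (mem_filter.1 hw').1⟩)
      (fun h => univ_notMem_agreements T (h ▸ hJ))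
    have hlt : (#G : ℝ) < ρ * #T := by
      by_contra hge
      rw [hrob G (hG.trans (filter_subset _ _)) (not_lt.1 hge)] at hGJ
      exact hGJ hJ
    have : (#(bad J) : ℝ) ≤ 2 * k * #G := by exact_mod_cast hGc
    calc _ ≤ _ := this
      _ ≤ 2 * k * (ρ * #T) := by gcongr
      _ = _ := by ring
  have hex : ∃ w ∈ T, w ∉ bad J₁ ∧ w ∉ bad J₂ := by
    by_contra hcon
    push Not at hcon
    have hsub : T ⊆ bad J₁ ∪ bad J₂ := by
      intro w hw
      by_cases h : w ∈ bad J₁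
      · exact mem_union_left _ h
      · exact mem_union_right _ (hcon w hw h)
    have h3 : (#T : ℝ) ≤ #(bad J₁) + #(bad J₂) := by
      exact_mod_cast (card_le_card hsub).trans (card_union_le _ _)
    have h4 := hsmall J₁ h₁
    have h5 := hsmall J₂ h₂
    have h6 : (0 : ℝ) < #T := by exact_mod_cast card_pos.2 hT
    nlinarith
  obtain ⟨w, hw, hb1, hb2⟩ := hex
  simp only [hbad, mem_filter, not_and, not_exists, hw, true_imp_iff] at hb1 hb2
  obtain ⟨w₁, hw₁⟩ := not_forall.1 (hb1 w)
  obtain ⟨hw₁T, h⟩ := not_forall.1 hw₁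
  obtain ⟨hw₁J, -⟩ := not_forall.1 h
  obtain ⟨w₂, hw₂⟩ := not_forall.1 (hb2 w₁)
  obtain ⟨hw₂T, h⟩ := not_forall.1 hw₂
  obtain ⟨hw₂J, h⟩ := not_forall.1 h
  push Not at h
  have hag : agreement w₁ w₂ = J₁ ∩ J₂ := by
    ext c
    rw [mem_agreement, mem_inter]
    by_cases hc2 : c ∈ J₂
    · have e2 : w c = w₂ c := mem_agreement.1 (hw₂J ▸ hc2)
      rw [← e2, ← hw₁J, mem_agreement]
      exact ⟨fun h => ⟨h.symm, hc2⟩, fun h => h.1.symm⟩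
    · exact ⟨fun e => absurd e.symm (h c hc2), fun e => absurd e.2 hc2⟩
  refine mem_agreements.2 ⟨w₁, hw₁T, w₂, hw₂T, ?_, hag⟩
  rintro rfl
  apply univ_notMem_agreements T
  have : J₁ = univ := by
    rw [eq_univ_iff_forall]
    intro c
    have : c ∈ J₁ ∩ J₂ := by rw [← hag, mem_agreement]
    exact (mem_inter.1 this).1
  exact this ▸ h₁

/-- A family of `k`-sets has a `k`-partite subfamily of positive proportion. -/
theorem exists_partite [Fintype V] [NeZero k] (W : Finset (Finset V)) (hW : ∀ e ∈ W, #e = k) :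
    ∃ (χ : V → Fin k) (T : Finset (Fin k → V)), (∀ w ∈ T, ∀ c, χ (w c) = c) ∧
      (∀ w ∈ T, univ.image w ∈ W) ∧ #W ≤ k ^ k * #T := by
  classical
  set good : Finset V → Finset (V → Fin k) := fun e => {χ | ∀ c, ∃ v ∈ e, χ v = c} with hgood
  -- A colouring is determined by its restriction to `e` and by its recolouring along a fixed
  -- bijection of `e` with the colours, which is good for `e`. So `e` is rainbow in at least a `1 /
  -- k ^ k` fraction of all colourings.
  have hcount : ∀ e ∈ W, Fintype.card (V → Fin k) ≤ k ^ k * #(good e) := by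
    intro e he
    set φ : V → Fin k := fun v => if h : v ∈ e then e.equivFinOfCardEq (hW e he) ⟨v, h⟩ else 0
      with hφ
    have hinj : Function.Injective (fun χ : V → Fin k =>
        ((fun v : e => χ v), (fun v => if v ∈ e then φ v else χ v))) := by
      intro χ χ' h
      simp only [Prod.mk.injEq] at h
      funext v
      by_cases hv : v ∈ e
      · exact congrFun h.1 ⟨v, hv⟩
      · have := congrFun h.2 v
        simpa [hv] using this
    have hle := card_le_card_of_injOn (s := univ) (t := (univ : Finset (e → Fin k)) ×ˢ good e)
      (fun χ : V → Fin k => ((fun v : e => χ v), (fun v => if v ∈ e then φ v else χ v)))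
      (by
        intro χ _
        simp only [coe_product, Set.mem_prod, coe_univ, Set.mem_univ, true_and, hgood, coe_filter,
          mem_univ, Set.mem_ofPred_eq]
        intro c
        refine ⟨(e.equivFinOfCardEq (hW e he)).symm c, by simp, ?_⟩
        simp [hφ])
      hinj.injOn
    rw [card_product, card_univ, card_univ] at hle
    simpa [hW e he] using hle
  have hex : ∃ χ : V → Fin k, #W ≤ k ^ k * #{e ∈ W | χ ∈ good e} := by
    by_contra hcon
    push Not at hcon
    have h1 : ∑ χ : V → Fin k, k ^ k * #{e ∈ W | χ ∈ good e} < ∑ χ : V → Fin k, #W :=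
      sum_lt_sum_of_nonempty univ_nonempty fun χ _ => hcon χ
    have h2 : ∑ χ : V → Fin k, #{e ∈ W | χ ∈ good e} = ∑ e ∈ W, #(good e) := by
      simp only [card_filter]
      rw [sum_comm]
      refine sum_congr rfl fun e _ => ?_
      rw [← card_filter]
      congr 1
      ext χ
      simp
    rw [← mul_sum, h2, sum_const, card_univ, smul_eq_mul, mul_sum] at h1
    have h3 := sum_le_sum hcount
    rw [sum_const, smul_eq_mul] at h3
    rw [mul_comm] at h3
    omega
  obtain ⟨χ, hχ⟩ := hex
  refine ⟨χ, ({w | (∀ c, χ (w c) = c) ∧ univ.image w ∈ W} : Finset _), fun w hw => (mem_filter.1 hw).2.1,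
    fun w hw => (mem_filter.1 hw).2.2, hχ.trans (Nat.mul_le_mul_left _ ?_)⟩
  apply card_le_card_of_surjOn (fun w => univ.image w)
  intro e he
  simp only [hgood, coe_filter, mem_filter, mem_univ, true_and, Set.mem_ofPred_eq] at he
  choose w hw using he.2
  have himg : univ.image w = e := by
    apply eq_of_subset_of_card_le
    · intro v hv
      obtain ⟨c, -, rfl⟩ := mem_image.1 hv
      exact (hw c).1
    · rw [hW e he.1, card_image_of_injective, card_univ, Fintype.card_fin]
      intro c c' h
      rw [← (hw c).2, ← (hw c').2, h]
  refine ⟨w, ?_, himg⟩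
  simp only [coe_filter, mem_univ, true_and, Set.mem_ofPred_eq]
  exact ⟨fun c => (hw c).2, himg ▸ he.1⟩

/-- A family of more than `c n ^ l` sets of size `k ≤ 2 l` contains two sets which are disjoint or
meet in exactly `l` elements. -/
theorem exists_disjoint_or_card_inter_eq {k l : ℕ} (hl : 1 ≤ l) (hlk : l ≤ k) (hkl : k ≤ 2 * l)
    {c : ℝ} (hc : 0 < c) : ∃ N : ℕ, ∀ (V : Type*) [Fintype V] [DecidableEq V]
      (W : Finset (Finset V)), N ≤ Fintype.card V → (∀ e ∈ W, #e = k) →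
      c * (Fintype.card V : ℝ) ^ l ≤ #W →
      ∃ e₁ ∈ W, ∃ e₂ ∈ W, e₁ ≠ e₂ ∧ (Disjoint e₁ e₂ ∨ #(e₁ ∩ e₂) = l) := by
  have : NeZero k := ⟨by omega⟩
  have hk : (1 : ℝ) ≤ k := by exact_mod_cast (by omega : 1 ≤ k)
  set ρ : ℝ := 1 / (8 * k) with hρ
  have hρ0 : 0 < ρ := by positivity
  have hρ1 : ρ ≤ 1 := by
    rw [hρ, div_le_one (by positivity)]; linarith
  have hρk : 4 * k * ρ < 1 := by
    rw [hρ]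
    have : 4 * (k : ℝ) * (1 / (8 * k)) = 1 / 2 := by field_simp; norm_num
    rw [this]; norm_num
  -- The factor `k ^ k` is lost by passing to a `k`-partite family, and `ρ ^ 2 ^ k` by making it
  -- robust, as there are at most `2 ^ k` agreement sets.
  set C : ℝ := ρ ^ 2 ^ k * c / k ^ k with hC
  have hC0 : 0 < C := by positivity
  obtain ⟨N, hN⟩ := exists_nat_gt (1 / C)
  refine ⟨max N 1, fun V _ _ W hnN hW hWc => ?_⟩
  set n := Fintype.card V with hn
  have hn1 : 1 ≤ n := (le_max_right _ _).trans hnN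
  have hnC : 1 < C * n := by
    have : (N : ℝ) ≤ n := by exact_mod_cast (le_max_left _ _).trans hnN
    rw [div_lt_iff₀ hC0] at hN
    nlinarith
  have hn0 : (0 : ℝ) < n := by exact_mod_cast hn1
  obtain ⟨χ, T₀, hχ, hTW, hcard⟩ := exists_partite W hW
  obtain ⟨T, hTT, hTc, hrob⟩ := exists_robust hρ0 hρ1 T₀
  have hTbig : (n : ℝ) ^ (l - 1) < #T := by
    have h1 : (#W : ℝ) ≤ k ^ k * #T₀ := by exact_mod_cast hcard
    have h2 : ρ ^ 2 ^ k ≤ ρ ^ #(agreements T₀) := by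
      apply pow_le_pow_of_le_one hρ0.le hρ1
      simpa using card_le_univ (agreements T₀)
    have h3 : c * (n : ℝ) ^ l / k ^ k ≤ #T₀ := by
      rw [div_le_iff₀ (by positivity)]; linarith
    calc (n : ℝ) ^ (l - 1) < (C * n) * n ^ (l - 1) := by
          apply lt_mul_of_one_lt_left (by positivity) hnC
      _ = ρ ^ 2 ^ k * (c * n ^ l / k ^ k) := by
          obtain ⟨m, rfl⟩ : ∃ m, l = m + 1 := ⟨l - 1, by omega⟩
          rw [hC, Nat.add_sub_cancel]; ring
      _ ≤ ρ ^ #(agreements T₀) * #T₀ := by gcongr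
      _ ≤ _ := hTc
  have hTne : T.Nonempty := by
    rw [← card_pos]
    have : (0 : ℝ) < #T := lt_of_le_of_lt (by positivity) hTbig
    exact_mod_cast this
  -- Pigeonhole: there are more tuples than restrictions to fewer than `l` coordinates.
  have hcov : ∀ X : Finset (Fin k), #X < l → ∃ J ∈ agreements T, X ⊆ J := by
    intro X hX
    have hlt : #(univ : Finset (X → V)) < #T := by
      rw [card_univ, Fintype.card_fun, Fintype.card_coe]
      have : n ^ #X ≤ n ^ (l - 1) := Nat.pow_le_pow_right hn1 (by omega)
      have h2 : n ^ (l - 1) < #T := by exact_mod_cast hTbig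
      exact this.trans_lt h2
    obtain ⟨w, hw, w', hw', hne, heq⟩ := exists_ne_map_eq_of_card_lt_of_maps_to hlt
      (f := fun (w : Fin k → V) (c : X) => w c) (fun _ _ => mem_coe.2 (mem_univ _))
    refine ⟨_, mem_agreements.2 ⟨w, hw, w', hw', hne, rfl⟩, fun c hc => ?_⟩
    exact mem_agreement.2 (congrFun heq ⟨c, hc⟩)
  have hfin : ∃ J ∈ agreements T, J = ∅ ∨ #J = l := by
    by_cases h0 : ∅ ∈ agreements T
    · exact ⟨_, h0, Or.inl rfl⟩
    · obtain ⟨J, hJ, h⟩ := exists_card_eq_of_inter_closed hl hkl (agreements T)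
        (fun J₁ h₁ J₂ h₂ => inter_mem_agreements hρk T hTne hrob h₁ h₂) h0
        (univ_notMem_agreements T) hcov
      exact ⟨J, hJ, Or.inr h⟩
  obtain ⟨J, hJ, hJl⟩ := hfin
  obtain ⟨w, hw, w', hw', hne, rfl⟩ := mem_agreements.1 hJ
  have hw1 := hχ w (hTT hw)
  have hw2 := hχ w' (hTT hw')
  have hwinj : Function.Injective w := fun c c' h => by rw [← hw1 c, ← hw1 c', h]
  -- A vertex determines its coordinate through its colour, so intersections of edges correspond to
  -- agreement sets.
  have hinter : univ.image w ∩ univ.image w' = (agreement w w').image w := by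
    ext v
    simp only [mem_inter, mem_image, mem_univ, true_and, mem_agreement]
    constructor
    · rintro ⟨⟨c, rfl⟩, c', h⟩
      have : c' = c := by rw [← hw2 c', h, hw1 c]
      subst this
      exact ⟨c', h.symm, rfl⟩
    · rintro ⟨c, h, rfl⟩
      exact ⟨⟨c, rfl⟩, c, h.symm⟩
  refine ⟨_, hTW w (hTT hw), _, hTW w' (hTT hw'), ?_, ?_⟩
  · intro heq
    apply hne
    funext c
    have : w c ∈ univ.image w' := heq ▸ mem_image_of_mem w (mem_univ c)
    obtain ⟨c', -, h⟩ := mem_image.1 this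
    have : c' = c := by rw [← hw2 c', h, hw1 c]
    rw [← h, this]
  · rw [disjoint_iff_inter_eq_empty, hinter]
    rcases hJl with h | h
    · left; simp [h]
    · right; rw [card_image_of_injective _ hwinj, h]

end


/-! ### Rearranging tuples by local improvement. -/

open scoped Classical in
/-- A local-improvement form of the theorem of Daykin and Häggkvist: if every coordinate value lies
in few tuples violating `E`, then suitable permutations of the coordinates arrange the index set into
tuples satisfying `E`. -/
theorem exists_perm_forall {ι : Type*} [Fintype ι] (D M : ℕ)
    (E : (Fin (D + 1) → ι) → Prop) (hE : ∀ c u, #{f | f c = u ∧ ¬ E f} ≤ M)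
    (hM : (D + 1) * M < (Fintype.card ι - 1).descFactorial D) :
    ∃ π : Fin (D + 1) → Equiv.Perm ι, ∀ i, E fun c => π c i := by
  obtain ⟨π, -, hπ⟩ := exists_max_image (univ : Finset (Fin (D + 1) → Equiv.Perm ι))
    (fun π => #{i | E fun c => π c i}) ⟨fun _ => 1, mem_univ _⟩
  refine ⟨π, ?_⟩
  by_contra hcon
  push Not at hcon
  obtain ⟨i₀, hi₀⟩ := hcon
  -- Join the violating index `i₀` to `D` other indices and rotate coordinate `c` of these `D + 1`
  -- tuples by `c` places. If all the new tuples satisfy `E`, the maximality of `π` is contradicted.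
  set J : (Fin D ↪ {i // i ≠ i₀}) → (Fin (D + 1) → ι) := fun g => Fin.cons i₀ fun d => (g d).1 with hJ
  have hJinj : Function.Injective J := by
    intro g g' h
    ext d
    have := congrFun h d.succ
    simpa [hJ] using this
  have hJ0 : ∀ g, J g 0 = i₀ := fun g => by simp [hJ]
  have hJi : ∀ g, Function.Injective (J g) := by
    intro g
    rw [hJ]
    refine Fin.cons_injective_iff.2 ⟨?_, fun a b h => g.injective (Subtype.ext h)⟩
    rintro ⟨d, hd⟩
    exact (g d).2 hd
  have hex : ∃ g, ∀ r, E fun c => π c (J g (r + c)) := by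
    by_contra hcon
    push Not at hcon
    have hsub : (univ : Finset (Fin D ↪ {i // i ≠ i₀})) ⊆
        univ.biUnion fun r => ({g | ¬ E fun c => π c (J g (r + c))} : Finset _) := by
      intro g _
      obtain ⟨r, hr⟩ := hcon g
      exact mem_biUnion.2 ⟨r, mem_univ r, by simpa using hr⟩
    have hr : ∀ r, #({g | ¬ E fun c => π c (J g (r + c))} : Finset (Fin D ↪ {i // i ≠ i₀})) ≤ M := by
      intro r
      -- In the `r`-th rotated tuple the coordinate `-r` comes from `i₀`, whatever the other indices
      -- are, so at most `M` choices spoil it.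
      refine le_trans ?_ (hE (-r) (π (-r) i₀))
      apply card_le_card_of_injOn (fun g c => π c (J g (r + c)))
      · intro g hg
        simp only [coe_filter, mem_univ, true_and, Set.mem_ofPred_eq] at hg ⊢
        exact ⟨by simp [hJ0], hg⟩
      · intro g _ g' _ h
        apply hJinj
        funext d
        have := (π (d - r)).injective (congrFun h (d - r))
        simpa using this
    have h1 := card_le_card hsub
    have h2 : #(univ.biUnion fun r => ({g | ¬ E fun c => π c (J g (r + c))} :
        Finset (Fin D ↪ {i // i ≠ i₀}))) ≤ (D + 1) * M := by
      refine card_biUnion_le.trans ((sum_le_sum fun r _ => hr r).trans ?_)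
      simp
    rw [card_univ, Fintype.card_embedding_eq, Fintype.card_fin] at h1
    have h3 : Fintype.card {i // i ≠ i₀} = Fintype.card ι - 1 := by
      simp
    rw [h3] at h1
    omega
  obtain ⟨g, hg⟩ := hex
  set e : Fin (D + 1) ↪ ι := ⟨J g, hJi g⟩ with he
  set σ : Fin (D + 1) → Equiv.Perm ι := fun c => (Equiv.addRight c).viaFintypeEmbedding e with hσ
  have hσ1 : ∀ c r, σ c (J g r) = J g (r + c) := fun c r =>
    Equiv.Perm.viaFintypeEmbedding_apply_image (Equiv.addRight c) e r
  have hσ2 : ∀ c i, i ∉ Set.range (J g) → σ c i = i := fun c i hi =>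
    Equiv.Perm.viaFintypeEmbedding_apply_notMem_range (Equiv.addRight c) e hi
  have hmul : ∀ c r, (π c * σ c) (J g r) = π c (J g (r + c)) := fun c r => by
    rw [Equiv.Perm.mul_apply, hσ1]
  have hlt : #{i | E fun c => π c i} < #{i | E fun c => (π c * σ c) i} := by
    apply card_lt_card
    rw [ssubset_iff_of_subset]
    · refine ⟨i₀, mem_filter.2 ⟨mem_univ _, ?_⟩, by simpa using hi₀⟩
      rw [← hJ0 g]
      simpa only [hmul] using hg 0
    · intro i hi
      refine mem_filter.2 ⟨mem_univ _, ?_⟩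
      by_cases hr : i ∈ Set.range (J g)
      · obtain ⟨r, rfl⟩ := hr
        simpa only [hmul] using hg r
      · have := (mem_filter.1 hi).2
        simpa only [Equiv.Perm.mul_apply, hσ2 _ _ hr] using this
  exact absurd (hπ (fun c => π c * σ c) (mem_univ _)) (not_le.2 hlt)

/-! ### Paths of alternating `x`-sets and `l`-sets. -/

/-- `LRPath H l x R₀ R Z m`: there are pairwise disjoint sets `R₀, L₁, R₁, …, L_m, R_m = R`, where
`|L_i| = l` and `|R_i| = x`, with union `Z` such that consecutive sets form members of `H`. -/
inductive LRPath {V : Type*} [DecidableEq V] (H : Finset (Finset V)) (l x : ℕ) (R₀ : Finset V) :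
    Finset V → Finset V → ℕ → Prop
  | base (h : #R₀ = x) : LRPath H l x R₀ R₀ R₀ 0
  | snoc {R Z L R' : Finset V} {m : ℕ} (h : LRPath H l x R₀ R Z m) (hL : #L = l) (hR : #R' = x)
      (hLR : Disjoint L R') (hd : Disjoint (L ∪ R') Z) (h₁ : R ∪ L ∈ H) (h₂ : L ∪ R' ∈ H) :
      LRPath H l x R₀ R' (Z ∪ (L ∪ R')) (m + 1)

namespace LRPath
variable {V : Type*} [DecidableEq V] {H : Finset (Finset V)} {l x m : ℕ} {R₀ R Z : Finset V}

/-- The passage from the inductive form, convenient for extending paths, to the indexed families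
required by `KGraph.HasHamiltonCycle`. -/
theorem exists_fun (h : LRPath H l x R₀ R Z m) : ∃ L' R' : ℕ → Finset V,
    R' 0 = R₀ ∧ R' m = R ∧ (∀ i ≤ m, #(R' i) = x ∧ R' i ⊆ Z) ∧
    (∀ i < m, #(L' i) = l ∧ L' i ⊆ Z ∧ R' i ∪ L' i ∈ H ∧ L' i ∪ R' (i + 1) ∈ H) ∧
    (∀ i ≤ m, ∀ j ≤ m, i ≠ j → Disjoint (R' i) (R' j)) ∧
    (∀ i < m, ∀ j < m, i ≠ j → Disjoint (L' i) (L' j)) ∧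
    (∀ i < m, ∀ j ≤ m, Disjoint (L' i) (R' j)) ∧
    ∀ v ∈ Z, (∃ i ≤ m, v ∈ R' i) ∨ ∃ i < m, v ∈ L' i := by
  induction h with
  | base h =>
    refine ⟨fun _ => ∅, fun _ => R₀, rfl, rfl, fun i _ => ⟨h, subset_refl _⟩, by simp, ?_, by simp,
      by simp, fun v hv => Or.inl ⟨0, le_refl _, hv⟩⟩
    intro i hi j hj hij
    omega
  | @snoc R Z L R₁ m h hL hR hLR hd h₁ h₂ ih =>
    obtain ⟨L', R', e0, em, hR', hL', dRR, dLL, dLR, hcov⟩ := ih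
    rw [disjoint_union_left] at hd
    refine ⟨fun i => if i = m then L else L' i, fun i => if i = m + 1 then R₁ else R' i,
      by simpa using e0, by simp, ?_, ?_, ?_, ?_, ?_, ?_⟩
    · intro i hi
      by_cases him : i = m + 1
      · simp only [him, if_true]
        exact ⟨hR, subset_union_right.trans subset_union_right⟩
      · simp only [him, if_false]
        obtain ⟨h1, h2⟩ := hR' i (by omega)
        exact ⟨h1, h2.trans subset_union_left⟩
    · intro i hi
      by_cases him : i = m
      · subst him
        have : ¬ i = i + 1 := by omega
        simp only [if_true, this, if_false, em]
        exact ⟨hL, subset_union_left.trans subset_union_right, h₁, h₂⟩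
      · have h2 : ¬ i = m + 1 := by omega
        have h3 : ¬ i + 1 = m + 1 := by omega
        simp only [him, h2, h3, if_false]
        obtain ⟨h4, h5, h6⟩ := hL' i (by omega)
        exact ⟨h4, h5.trans subset_union_left, h6⟩
    · intro i hi j hj hij
      by_cases him : i = m + 1 <;> by_cases hjm : j = m + 1
      · omega
      · simp only [him, hjm, if_true, if_false]
        exact hd.2.mono_right (hR' j (by omega)).2
      · simp only [him, hjm, if_true, if_false]
        exact (hd.2.mono_right (hR' i (by omega)).2).symm
      · simp only [him, hjm, if_false]
        exact dRR i (by omega) j (by omega) hij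
    · intro i hi j hj hij
      by_cases him : i = m <;> by_cases hjm : j = m
      · omega
      · simp only [him, hjm, if_true, if_false]
        exact hd.1.mono_right (hL' j (by omega)).2.1
      · simp only [him, hjm, if_true, if_false]
        exact (hd.1.mono_right (hL' i (by omega)).2.1).symm
      · simp only [him, hjm, if_false]
        exact dLL i (by omega) j (by omega) hij
    · intro i hi j hj
      by_cases him : i = m <;> by_cases hjm : j = m + 1
      · simpa only [him, hjm, if_true] using hLR
      · simp only [him, hjm, if_true, if_false]
        exact hd.1.mono_right (hR' j (by omega)).2
      · simp only [him, hjm, if_true, if_false]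
        exact (hd.2.mono_right (hL' i (by omega)).2.1).symm
      · simp only [him, hjm, if_false]
        exact dLR i (by omega) j (by omega)
    · intro v hv
      rcases mem_union.1 hv with hv | hv
      · rcases hcov v hv with ⟨i, hi, hvi⟩ | ⟨i, hi, hvi⟩
        · refine Or.inl ⟨i, by omega, ?_⟩
          simpa only [if_neg (show ¬ i = m + 1 by omega)] using hvi
        · refine Or.inr ⟨i, by omega, ?_⟩
          simpa only [if_neg (show ¬ i = m by omega)] using hvi
      · rcases mem_union.1 hv with hv | hv
        · exact Or.inr ⟨m, by omega, by simpa using hv⟩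
        · exact Or.inl ⟨m + 1, by omega, by simpa using hv⟩

/-- A path whose complement is an `l`-set joining its ends closes to a Hamilton cycle. -/
theorem hasHamiltonCycle {k : ℕ} {H : KGraph V k} (hk : x = k - l)
    (h : LRPath H.edges l x R₀ R Z m) {L : Finset V}
    (hL : #L = l) (hLZ : Disjoint L Z) (hcov : ∀ v, v ∈ L ∨ v ∈ Z) (h₁ : R ∪ L ∈ H.edges)
    (h₂ : L ∪ R₀ ∈ H.edges) : H.HasHamiltonCycle l := by
  obtain ⟨L', R', e0, em, hR', hL', dRR, dLL, dLR, hc⟩ := h.exists_fun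
  -- The closing set becomes `L 0`, between the last and the first `x`-set, so the `l`-sets of the
  -- path move up by one index.
  refine ⟨m + 1, inferInstance, fun i => Fin.cases L (fun j => L' j) i, fun i => R' i, ?_, ?_, ?_,
    ?_, ?_⟩
  · intro i
    refine Fin.cases ?_ (fun j => ?_) i
    · simpa using hL
    · simpa using (hL' j j.2).1
  · intro i
    rw [← hk]
    exact (hR' i (by omega)).1
  · have hLL : ∀ i j : Fin (m + 1), i ≠ j → Disjoint
        (Fin.cases (motive := fun _ => Finset V) L (fun j : Fin m => L' j) i)
        (Fin.cases (motive := fun _ => Finset V) L (fun j : Fin m => L' j) j) := by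
      intro i j
      refine Fin.cases (fun hij => ?_) (fun i hij => ?_) i
      · revert hij
        refine Fin.cases (fun hij => absurd rfl hij) (fun j hij => ?_) j
        simp only [Fin.cases_zero, Fin.cases_succ]
        exact hLZ.mono_right (hL' j j.2).2.1
      · revert hij
        refine Fin.cases (fun hij => ?_) (fun j hij => ?_) j
        · simp only [Fin.cases_zero, Fin.cases_succ]
          exact (hLZ.mono_right (hL' i i.2).2.1).symm
        · simp only [Fin.cases_succ]
          refine dLL i i.2 j j.2 fun h => hij ?_
          rw [Fin.ext h]
    have hLR : ∀ i j : Fin (m + 1), Disjoint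
        (Fin.cases (motive := fun _ => Finset V) L (fun j : Fin m => L' j) i) (R' j) := by
      intro i j
      refine Fin.cases ?_ (fun i => ?_) i
      · simp only [Fin.cases_zero]
        exact hLZ.mono_right (hR' j (by omega)).2
      · simp only [Fin.cases_succ]
        exact dLR i i.2 j (by omega)
    rintro (i | i) (j | j) hij
    · exact hLL i j fun h => hij (by rw [h])
    · exact hLR i j
    · exact (hLR j i).symm
    · exact dRR i (by omega) j (by omega) fun h => hij (by rw [Fin.ext h])
  · intro v
    rcases hcov v with hv | hv
    · exact ⟨0, Or.inl (by simpa using hv)⟩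
    · rcases hc v hv with ⟨i, hi, hvi⟩ | ⟨i, hi, hvi⟩
      · exact ⟨⟨i, by omega⟩, Or.inr hvi⟩
      · refine ⟨(⟨i, hi⟩ : Fin m).succ, Or.inl ?_⟩
        simpa only [Fin.cases_succ] using hvi
  · intro i
    constructor
    · refine Fin.cases ?_ (fun j => ?_) i
      · simpa [e0] using h₂
      · simpa using (hL' j j.2).2.2.2
    · refine Fin.lastCases ?_ (fun j => ?_) i
      · simpa [em] using h₁
      · rw [Fin.coeSucc_eq_succ]
        simpa using (hL' j j.2).2.2.1

theorem card_start (h : LRPath H l x R₀ R Z m) : #R₀ = x := by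
  induction h with
  | base h => exact h
  | snoc _ _ _ _ _ _ _ ih => exact ih

theorem card_end (h : LRPath H l x R₀ R Z m) : #R = x := by
  cases h with
  | base h => exact h
  | snoc _ _ h => exact h

theorem start_subset (h : LRPath H l x R₀ R Z m) : R₀ ⊆ Z := by
  induction h with
  | base h => exact subset_refl _
  | snoc _ _ _ _ _ _ _ ih => exact ih.trans subset_union_left

theorem end_subset (h : LRPath H l x R₀ R Z m) : R ⊆ Z := by
  cases h with
  | base h => exact subset_refl _
  | snoc _ _ h => exact subset_union_right.trans subset_union_right

theorem card_eq (h : LRPath H l x R₀ R Z m) : #Z = x + m * (l + x) := by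
  induction h with
  | base h => simpa using h
  | snoc h hL hR hLR hd _ _ ih =>
    rw [card_union_of_disjoint hd.symm, card_union_of_disjoint hLR, ih, hL, hR]
    ring

end LRPath


/-! ### Parities, links, and counting sets by type. -/

/-- The parity of the number of elements of `S` in `A`. -/
def par {V : Type*} [DecidableEq V] (A S : Finset V) : ZMod 2 := (#(S ∩ A) : ZMod 2)

theorem par_union {V : Type*} [DecidableEq V] {A S T : Finset V} (h : Disjoint S T) : par A (S ∪ T) = par A S + par A T := by
  rw [par, union_inter_distrib_right, card_union_of_disjoint
    (h.mono inter_subset_left inter_subset_left), Nat.cast_add]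
  rfl

theorem card_le_pow_of_forall_card {V : Type*} [Fintype V] {𝒯 : Finset (Finset V)} {j : ℕ}
    (h : ∀ T ∈ 𝒯, #T = j) :
    #𝒯 ≤ Fintype.card V ^ j := by
  have : 𝒯 ⊆ powersetCard j univ := fun T hT => mem_powersetCard_univ.2 (h T hT)
  refine (card_le_card this).trans ?_
  rw [card_powersetCard, card_univ]
  exact Nat.choose_le_pow _ _

section
variable {V : Type*} [Fintype V] [DecidableEq V]

/-- The sets `T` disjoint from `S` with `S ∪ T ∈ F`. -/
def nb (F : Finset (Finset V)) (S : Finset V) : Finset (Finset V) :=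
  {T | Disjoint S T ∧ S ∪ T ∈ F}

theorem mem_nb {F : Finset (Finset V)} {S T : Finset V} :
    T ∈ nb F S ↔ Disjoint S T ∧ S ∪ T ∈ F := by simp [nb]

theorem card_of_mem_nb {F : Finset (Finset V)} {k : ℕ} (hF : ∀ e ∈ F, #e = k) {S T : Finset V}
    (h : T ∈ nb F S) : #S + #T = k := by
  rw [mem_nb] at h
  rw [← card_union_of_disjoint h.1, hF _ h.2]

theorem nb_mono {F G : Finset (Finset V)} (h : F ⊆ G) (S : Finset V) : nb F S ⊆ nb G S := by
  intro T
  rw [mem_nb, mem_nb]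
  exact fun hT => ⟨hT.1, h hT.2⟩

theorem card_nb_le {F : Finset (Finset V)} {k j : ℕ} (hF : ∀ e ∈ F, #e = k) {S : Finset V}
    (hS : #S + j = k) : #(nb F S) ≤ Fintype.card V ^ j :=
  card_le_pow_of_forall_card fun T hT => by have := card_of_mem_nb hF hT; omega

theorem card_nb_union {F : Finset (Finset V)} {P Q : Finset V} (h : Disjoint P Q) :
    #(nb F (P ∪ Q)) = #{U ∈ nb F P | Q ⊆ U} := by
  apply card_nbij' (fun T => Q ∪ T) (fun U => U \ Q)
  · intro T hT
    simp only [mem_coe, mem_nb, mem_filter] at hT ⊢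
    rw [disjoint_union_left] at hT
    exact ⟨⟨disjoint_union_right.2 ⟨h, hT.1.1⟩, by rw [← union_assoc]; exact hT.2⟩,
      subset_union_left⟩
  · intro U hU
    simp only [mem_coe, mem_nb, mem_filter] at hU ⊢
    refine ⟨disjoint_union_left.2 ⟨hU.1.1.mono_right sdiff_subset, disjoint_sdiff⟩, ?_⟩
    rw [union_assoc, union_sdiff_of_subset hU.2]
    exact hU.1.2
  · intro T hT
    simp only [mem_coe, mem_nb] at hT
    rw [disjoint_union_left] at hT
    exact union_sdiff_cancel_left hT.1.2
  · intro U hU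
    simp only [mem_coe, mem_filter] at hU
    exact union_sdiff_of_subset hU.2

/-- Double counting of degrees. -/
theorem sum_card_nb_union_le {F : Finset (Finset V)} {k : ℕ} (hF : ∀ e ∈ F, #e = k)
    {P : Finset V} (𝒬 : Finset (Finset V)) (h𝒬 : ∀ Q ∈ 𝒬, Disjoint P Q) :
    ∑ Q ∈ 𝒬, #(nb F (P ∪ Q)) ≤ 2 ^ k * #(nb F P) := by
  calc ∑ Q ∈ 𝒬, #(nb F (P ∪ Q)) = ∑ Q ∈ 𝒬, #{U ∈ nb F P | Q ⊆ U} :=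
        sum_congr rfl fun Q hQ => card_nb_union (h𝒬 Q hQ)
    _ = ∑ U ∈ nb F P, #{Q ∈ 𝒬 | Q ⊆ U} := by
        simp only [card_filter]
        exact sum_comm
    _ ≤ ∑ U ∈ nb F P, 2 ^ k := by
        refine sum_le_sum fun U hU => ?_
        have h1 : ({Q ∈ 𝒬 | Q ⊆ U} : Finset _) ⊆ U.powerset := fun Q hQ =>
          mem_powerset.2 (mem_filter.1 hQ).2
        refine (card_le_card h1).trans ?_
        rw [card_powerset]
        have := card_of_mem_nb hF hU
        exact Nat.pow_le_pow_right (by norm_num) (by omega)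
    _ = _ := by rw [sum_const, smul_eq_mul, mul_comm]

/-- Markov's inequality for the double count `sum_card_nb_union_le`. -/
theorem card_filter_lt_card_nb_le {F : Finset (Finset V)} {k : ℕ} (hF : ∀ e ∈ F, #e = k)
    {P : Finset V} (𝒬 : Finset (Finset V)) (h𝒬 : ∀ Q ∈ 𝒬, Disjoint P Q) (θ : ℝ) :
    (#{Q ∈ 𝒬 | θ < #(nb F (P ∪ Q))} : ℝ) * θ ≤ 2 ^ k * #(nb F P) := by
  calc (#{Q ∈ 𝒬 | θ < #(nb F (P ∪ Q))} : ℝ) * θ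
      = ∑ Q ∈ 𝒬 with θ < #(nb F (P ∪ Q)), θ := by rw [sum_const, nsmul_eq_mul]
    _ ≤ ∑ Q ∈ 𝒬 with θ < #(nb F (P ∪ Q)), (#(nb F (P ∪ Q)) : ℝ) :=
        sum_le_sum fun Q hQ => (mem_filter.1 hQ).2.le
    _ ≤ 2 ^ k * #(nb F P) := by
        exact_mod_cast sum_card_nb_union_le hF {Q ∈ 𝒬 | θ < #(nb F (P ∪ Q))}
          fun Q hQ => h𝒬 Q (mem_filter.1 hQ).1

theorem card_filter_mem_le {𝒯 : Finset (Finset V)} {j : ℕ} (h : ∀ T ∈ 𝒯, #T = j) (v : V) :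
    #{T ∈ 𝒯 | v ∈ T} ≤ Fintype.card V ^ (j - 1) := by
  have : #{T ∈ 𝒯 | v ∈ T} = #({T ∈ 𝒯 | v ∈ T}.image fun T => T.erase v) := by
    rw [card_image_of_injOn]
    intro T hT T' hT' heq
    simp only [coe_filter, Set.mem_ofPred_eq] at hT hT'
    simp only at heq
    rw [← insert_erase hT.2, heq, insert_erase hT'.2]
  rw [this]
  apply card_le_pow_of_forall_card
  intro T hT
  obtain ⟨T', hT', rfl⟩ := mem_image.1 hT
  rw [mem_filter] at hT'
  rw [card_erase_of_mem hT'.2, h T' hT'.1]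

theorem card_filter_not_disjoint_le {𝒯 : Finset (Finset V)} {j : ℕ} (h : ∀ T ∈ 𝒯, #T = j)
    (Z : Finset V) : #{T ∈ 𝒯 | ¬ Disjoint T Z} ≤ #Z * Fintype.card V ^ (j - 1) := by
  have hsub : ({T ∈ 𝒯 | ¬ Disjoint T Z} : Finset _) ⊆ Z.biUnion fun v => {T ∈ 𝒯 | v ∈ T} := by
    intro T hT
    rw [mem_filter, not_disjoint_iff] at hT
    obtain ⟨hT, v, hv, hvZ⟩ := hT
    exact mem_biUnion.2 ⟨v, hvZ, mem_filter.2 ⟨hT, hv⟩⟩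
  refine (card_le_card hsub).trans (card_biUnion_le.trans ?_)
  rw [← smul_eq_mul]
  exact sum_le_card_nsmul _ _ _ fun v _ => card_filter_mem_le h v

/-- A large family of `j`-sets has a member outside a small exceptional family which avoids a small
set of vertices. -/
theorem exists_mem_disjoint_not {𝒯 : Finset (Finset V)} {j : ℕ} (h : ∀ T ∈ 𝒯, #T = j)
    (hj : 1 ≤ j) {c : ℝ} (hc : 0 < c) (hn : 0 < Fintype.card V) (P : Finset V → Prop)
    [DecidablePred P]
    (h𝒯 : c * (Fintype.card V : ℝ) ^ j ≤ #𝒯)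
    (hP : (#{T ∈ 𝒯 | P T} : ℝ) ≤ c / 3 * (Fintype.card V : ℝ) ^ j) {Z : Finset V}
    (hZ : (#Z : ℝ) ≤ c / 3 * Fintype.card V) : ∃ T ∈ 𝒯, Disjoint T Z ∧ ¬ P T := by
  by_contra hcon
  push Not at hcon
  have hsub : 𝒯 ⊆ {T ∈ 𝒯 | ¬ Disjoint T Z} ∪ {T ∈ 𝒯 | P T} := by
    intro T hT
    rw [mem_union, mem_filter, mem_filter]
    by_cases hd : Disjoint T Z
    · exact Or.inr ⟨hT, hcon T hT hd⟩
    · exact Or.inl ⟨hT, hd⟩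
  have h1 : (#𝒯 : ℝ) ≤ #{T ∈ 𝒯 | ¬ Disjoint T Z} + #{T ∈ 𝒯 | P T} := by
    exact_mod_cast (card_le_card hsub).trans (card_union_le _ _)
  have h2 : (#{T ∈ 𝒯 | ¬ Disjoint T Z} : ℝ) ≤ #Z * (Fintype.card V : ℝ) ^ (j - 1) := by
    exact_mod_cast card_filter_not_disjoint_le h Z
  have hn' : (0 : ℝ) < Fintype.card V := by exact_mod_cast hn
  have h3 : (#Z : ℝ) * (Fintype.card V : ℝ) ^ (j - 1) ≤ c / 3 * (Fintype.card V : ℝ) ^ j := by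
    obtain ⟨i, rfl⟩ : ∃ i, j = i + 1 := ⟨j - 1, by omega⟩
    rw [Nat.add_sub_cancel, pow_succ, mul_comm _ (Fintype.card V : ℝ), ← mul_assoc]
    gcongr
  have h4 : 0 < c * (Fintype.card V : ℝ) ^ j := by positivity
  linarith

/-- The `j`-sets inside `U` with `a` elements in `A` and `b` outside. -/
def typedSets (A U : Finset V) (a b : ℕ) : Finset (Finset V) :=
  {T | T ⊆ U ∧ #(T ∩ A) = a ∧ #(T \ A) = b}

theorem mem_typedSets {A U T : Finset V} {a b : ℕ} :
    T ∈ typedSets A U a b ↔ T ⊆ U ∧ #(T ∩ A) = a ∧ #(T \ A) = b := by simp [typedSets]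

theorem card_of_mem_typedSets {A U T : Finset V} {a b : ℕ} (h : T ∈ typedSets A U a b) :
    #T = a + b := by
  rw [mem_typedSets] at h
  rw [← card_inter_add_card_sdiff T A, h.2.1, h.2.2]

theorem card_typedSets (A U : Finset V) (a b : ℕ) :
    #(typedSets A U a b) = (#(U ∩ A)).choose a * (#(U \ A)).choose b := by
  rw [← card_powersetCard, ← card_powersetCard, ← card_product]
  apply card_nbij' (fun T => (T ∩ A, T \ A)) (fun p => p.1 ∪ p.2)
  · intro T hT
    simp only [mem_coe, mem_typedSets, mem_product, mem_powersetCard] at hT ⊢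
    exact ⟨⟨inter_subset_inter_right hT.1, hT.2.1⟩, sdiff_subset_sdiff hT.1 (subset_refl _), hT.2.2⟩
  · rintro ⟨P, Q⟩ hPQ
    simp only [mem_coe, mem_typedSets, mem_product, mem_powersetCard] at hPQ ⊢
    obtain ⟨⟨hP, rfl⟩, hQ, rfl⟩ := hPQ
    have h1 : P ∩ A = P := inter_eq_left.2 (hP.trans inter_subset_right)
    have h2 : Q ∩ A = ∅ := disjoint_iff_inter_eq_empty.1 (disjoint_of_subset_left hQ sdiff_disjoint)
    refine ⟨union_subset (hP.trans inter_subset_left) (hQ.trans sdiff_subset), ?_, ?_⟩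
    · rw [union_inter_distrib_right, h1, h2, union_empty]
    · rw [union_sdiff_distrib, sdiff_eq_empty_iff_subset.2 (hP.trans inter_subset_right),
        empty_union, sdiff_eq_self_of_disjoint (disjoint_iff_inter_eq_empty.2 h2)]
  · intro T _
    exact (union_comm _ _).trans (sdiff_union_inter T A)
  · rintro ⟨P, Q⟩ hPQ
    simp only [mem_coe, mem_product, mem_powersetCard] at hPQ
    obtain ⟨⟨hP, rfl⟩, hQ, rfl⟩ := hPQ
    have h1 : P ∩ A = P := inter_eq_left.2 (hP.trans inter_subset_right)
    have h2 : Q ∩ A = ∅ := disjoint_iff_inter_eq_empty.1 (disjoint_of_subset_left hQ sdiff_disjoint)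
    simp only [Prod.mk.injEq]
    constructor
    · rw [union_inter_distrib_right, h1, h2, union_empty]
    · rw [union_sdiff_distrib, sdiff_eq_empty_iff_subset.2 (hP.trans inter_subset_right),
        empty_union, sdiff_eq_self_of_disjoint (disjoint_iff_inter_eq_empty.2 h2)]

theorem pow_le_factorial_mul_choose {m a : ℕ} {y : ℝ} (hy : 0 ≤ y) (h : y + a ≤ m) :
    y ^ a ≤ a.factorial * (m.choose a : ℝ) := by
  have h1 : a ≤ m := by
    have : (a : ℝ) ≤ m := by linarith
    exact_mod_cast this
  have h2 := Nat.pow_sub_le_descFactorial m a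
  rw [Nat.descFactorial_eq_factorial_mul_choose] at h2
  have h3 : y ≤ ((m + 1 - a : ℕ) : ℝ) := by
    rw [Nat.cast_sub (by omega)]; push_cast; linarith
  calc y ^ a ≤ ((m + 1 - a : ℕ) : ℝ) ^ a := by gcongr
    _ ≤ _ := by exact_mod_cast h2

theorem le_card_typedSets {A U : Finset V} {a b : ℕ} {y : ℝ} (hy : 0 ≤ y)
    (hA : y + a ≤ #(U ∩ A)) (hB : y + b ≤ #(U \ A)) :
    y ^ (a + b) / (a + b).factorial ≤ #(typedSets A U a b) := by
  rw [card_typedSets, div_le_iff₀ (by positivity), pow_add]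
  have h1 := pow_le_factorial_mul_choose hy hA
  have h2 := pow_le_factorial_mul_choose hy hB
  have h3 : (a.factorial * b.factorial : ℝ) ≤ (a + b).factorial := by
    exact_mod_cast Nat.le_of_dvd (Nat.factorial_pos _) (Nat.factorial_mul_factorial_dvd_factorial_add a b)
  calc y ^ a * y ^ b
      ≤ (a.factorial * ((#(U ∩ A)).choose a : ℝ)) * (b.factorial * ((#(U \ A)).choose b : ℝ)) := by
        gcongr
    _ = (((#(U ∩ A)).choose a * (#(U \ A)).choose b : ℕ) : ℝ) * (a.factorial * b.factorial) := by
        push_cast; ring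
    _ ≤ _ := by gcongr

end


/-! ### Greedy choice of good `x`-sets with a potential function. -/

/-- Averaging over `C`: each weight is doubled with probability at most `ξ`, so the expected total
grows by a factor of at most `1 + ξ`. -/
theorem exists_weight_le {V β : Type*} (S : Finset V) (C : Finset β) (hC : C.Nonempty)
    (bad : V → β → Prop) [∀ v, DecidablePred (bad v)] (w : V → ℝ) (hw : ∀ v, 0 ≤ w v) {ξ : ℝ}
    (hbad : ∀ v ∈ S, (#{R ∈ C | bad v R} : ℝ) ≤ ξ * #C) :
    ∃ R ∈ C, ∑ v ∈ S, w v * (if bad v R then 2 else 1) ≤ (1 + ξ) * ∑ v ∈ S, w v := by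
  apply exists_le_of_sum_le hC
  rw [sum_comm, sum_const, nsmul_eq_mul, mul_sum, mul_sum]
  refine sum_le_sum fun v hv => ?_
  rw [← mul_sum]
  have : ∑ R ∈ C, (if bad v R then (2 : ℝ) else 1) = #C + #{R ∈ C | bad v R} := by
    rw [card_filter, Nat.cast_sum, card_eq_sum_ones, Nat.cast_sum, ← sum_add_distrib]
    refine sum_congr rfl fun R _ => ?_
    split_ifs <;> norm_num
  rw [this]
  have := hbad v hv
  have hwv := hw v
  nlinarith

section
variable {V : Type*} [Fintype V] [DecidableEq V]

/-- The degree of `S` in the `k`-graph `F` is at most the proportion `γ` of the trivial bound. -/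
def IsGood (F : Finset (Finset V)) (k : ℕ) (γ : ℝ) (S : Finset V) : Prop :=
  (#(nb F S) : ℝ) ≤ γ * (Fintype.card V : ℝ) ^ (k - #S)

noncomputable instance (F : Finset (Finset V)) (k : ℕ) (γ : ℝ) : DecidablePred (IsGood F k γ) :=
  Classical.decPred _

/-- Markov's inequality with the slack split evenly: degree proportion `γ ^ 2 / 2 ^ k` at `P` leaves
at most a proportion `γ` of extensions with degree proportion above `γ`. -/
theorem card_filter_not_isGood_le {F : Finset (Finset V)} {k : ℕ} (hF : ∀ e ∈ F, #e = k)
    (hn : 0 < Fintype.card V) {γ : ℝ} (hγ : 0 < γ) {P : Finset V} {j : ℕ} (hPj : #P + j ≤ k)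
    (hP : 2 ^ k * (#(nb F P) : ℝ) ≤ γ ^ 2 * (Fintype.card V : ℝ) ^ (k - #P))
    (𝒬 : Finset (Finset V)) (h𝒬 : ∀ Q ∈ 𝒬, #Q = j) (hd : ∀ Q ∈ 𝒬, Disjoint P Q) :
    (#{Q ∈ 𝒬 | ¬ IsGood F k γ (P ∪ Q)} : ℝ) ≤ γ * (Fintype.card V : ℝ) ^ j := by
  have hn' : (0 : ℝ) < Fintype.card V := by exact_mod_cast hn
  set θ : ℝ := γ * (Fintype.card V : ℝ) ^ (k - #P - j) with hθ
  have hθ0 : 0 < θ := by positivity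
  have h1 := card_filter_lt_card_nb_le hF 𝒬 hd θ
  have h2 : ({Q ∈ 𝒬 | ¬ IsGood F k γ (P ∪ Q)} : Finset _) = {Q ∈ 𝒬 | θ < #(nb F (P ∪ Q))} := by
    apply filter_congr
    intro Q hQ
    rw [IsGood, not_le, card_union_of_disjoint (hd Q hQ), h𝒬 Q hQ, hθ, Nat.sub_sub]
  rw [← h2] at h1
  have h3 : γ ^ 2 * (Fintype.card V : ℝ) ^ (k - #P) = (γ * (Fintype.card V : ℝ) ^ j) * θ := by
    have : k - #P = j + (k - #P - j) := by omega
    rw [this, pow_add, hθ]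
    ring
  exact le_of_mul_le_mul_right (by linarith) hθ0

open scoped Classical in
/-- Disjoint good `x`-sets of prescribed types can be chosen such that every vertex of low degree
forms a good set with all but a few of them. -/
theorem exists_disjoint_good_sets {F : Finset (Finset V)} {k x : ℕ} (hF : ∀ e ∈ F, #e = k)
    (hn : 0 < Fintype.card V) (hxk : x + 1 ≤ k) {γ c : ℝ} (hγ : 0 < γ) (hγc : γ ≤ c / 2)
    (hF0 : 2 ^ k * (#F : ℝ) ≤ γ ^ 2 * (Fintype.card V : ℝ) ^ k)
    (S : Finset V)
    (hFS : ∀ v ∈ S, 2 ^ k * (#(nb F {v}) : ℝ) ≤ γ ^ 2 * (Fintype.card V : ℝ) ^ (k - 1))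
    (A U : Finset V) (a : ℕ → ℕ) (ha : ∀ i, a i ≤ x) (N : ℕ)
    (hcand : ∀ i < N, ∀ Y ⊆ U, #(Y ∩ A) = ∑ j ∈ range i, a j →
      #(Y \ A) = ∑ j ∈ range i, (x - a j) →
      c * (Fintype.card V : ℝ) ^ x ≤ #(typedSets A (U \ Y) (a i) (x - a i))) :
    ∃ R : ℕ → Finset V, (∀ i < N, R i ∈ typedSets A U (a i) (x - a i) ∧ IsGood F k γ (R i)) ∧
      (∀ i < N, ∀ j < N, i ≠ j → Disjoint (R i) (R j)) ∧
      ∑ v ∈ S, (2 : ℝ) ^ #{i ∈ range N | v ∉ R i ∧ ¬ IsGood F k γ ({v} ∪ R i)} ≤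
        Fintype.card V * (1 + 2 * γ / c) ^ N := by
  have hc : 0 < c := by linarith
  have hn' : (0 : ℝ) < Fintype.card V := by exact_mod_cast hn
  induction N with
  | zero =>
    refine ⟨fun _ => ∅, by simp, by simp, ?_⟩
    simp only [range_zero, filter_empty, card_empty, pow_zero, sum_const, nsmul_eq_mul, mul_one]
    exact_mod_cast card_le_univ S
  | succ N ih =>
    obtain ⟨R, hR, hRd, hΦ⟩ := ih fun i hi => hcand i (by omega)
    set Y := (range N).biUnion R with hY
    have hYU : Y ⊆ U := biUnion_subset.2 fun i hi =>
      (mem_typedSets.1 (hR i (mem_range.1 hi)).1).1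
    have hpd : ∀ i ∈ range N, ∀ j ∈ range N, i ≠ j → Disjoint (R i) (R j) := fun i hi j hj =>
      hRd i (mem_range.1 hi) j (mem_range.1 hj)
    have hYA : #(Y ∩ A) = ∑ j ∈ range N, a j := by
      rw [hY, biUnion_inter, card_biUnion]
      · exact sum_congr rfl fun i hi => (mem_typedSets.1 (hR i (mem_range.1 hi)).1).2.1
      · exact fun i hi j hj hij => (hpd i hi j hj hij).mono inter_subset_left inter_subset_left
    have hYB : #(Y \ A) = ∑ j ∈ range N, (x - a j) := by
      rw [hY, show (range N).biUnion R \ A = (range N).biUnion fun i => R i \ A by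
        ext v; simp only [mem_sdiff, mem_biUnion]; tauto, card_biUnion]
      · exact sum_congr rfl fun i hi => (mem_typedSets.1 (hR i (mem_range.1 hi)).1).2.2
      · exact fun i hi j hj hij => (hpd i hi j hj hij).mono sdiff_subset sdiff_subset
    have hC := hcand N (by omega) Y hYU hYA hYB
    set C := typedSets A (U \ Y) (a N) (x - a N) with hCdef
    have hCx : ∀ Q ∈ C, #Q = x := fun Q hQ => by
      rw [card_of_mem_typedSets hQ]; have := ha N; omega
    have hbad0 : (#{Q ∈ C | ¬ IsGood F k γ Q} : ℝ) ≤ γ * (Fintype.card V : ℝ) ^ x := by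
      have := card_filter_not_isGood_le hF hn hγ (P := ∅) (j := x) (by simp; omega)
        (by simpa [nb] using hF0) C hCx (by simp)
      simpa using this
    -- As `γ ≤ c / 2`, at least half of the guaranteed number of candidates is good.
    set C' := ({Q ∈ C | IsGood F k γ Q} : Finset _) with hC'
    have hC'c : c / 2 * (Fintype.card V : ℝ) ^ x ≤ #C' := by
      have h1 : (#C' : ℝ) + #{Q ∈ C | ¬ IsGood F k γ Q} = #C := by
        exact_mod_cast card_filter_add_card_filter_not (s := C) (IsGood F k γ)
      have : 0 < (Fintype.card V : ℝ) ^ x := by positivity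
      nlinarith
    have hC'n : C'.Nonempty := by
      rw [← card_pos]
      have : (0 : ℝ) < #C' := lt_of_lt_of_le (by positivity) hC'c
      exact_mod_cast this
    -- The weight of `v` is 2 to the number of earlier sets with which `v` is not good. A vertex of
    -- low degree is bad for at most `γ n ^ x` sets, a proportion `2 * γ / c` of `C'`.
    obtain ⟨Q, hQ, hQΦ⟩ := exists_weight_le S C' hC'n
      (fun v Q => v ∉ Q ∧ ¬ IsGood F k γ ({v} ∪ Q))
      (fun v => (2 : ℝ) ^ #{i ∈ range N | v ∉ R i ∧ ¬ IsGood F k γ ({v} ∪ R i)})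
      (fun v => by positivity) (ξ := 2 * γ / c) (by
        intro v hv
        have h1 := card_filter_not_isGood_le hF hn hγ (P := {v}) (j := x) (by simp; omega)
          (by simpa using hFS v hv) {Q ∈ C' | v ∉ Q}
          (fun Q hQ => hCx Q (mem_filter.1 (mem_filter.1 hQ).1).1)
          (fun Q hQ => by simpa using (mem_filter.1 hQ).2)
        rw [filter_filter] at h1
        refine h1.trans ?_
        calc γ * (Fintype.card V : ℝ) ^ x = 2 * γ / c * (c / 2 * (Fintype.card V : ℝ) ^ x) := by
              field_simp
          _ ≤ _ := by gcongr)
    simp only [hC', hCdef, mem_filter, mem_typedSets] at hQ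
    obtain ⟨⟨hQU, hQA, hQB⟩, hQg⟩ := hQ
    refine ⟨fun i => if i = N then Q else R i, ?_, ?_, ?_⟩
    · intro i hi
      by_cases hiN : i = N
      · simp only [hiN, if_true]
        exact ⟨mem_typedSets.2 ⟨hQU.trans sdiff_subset, hQA, hQB⟩, hQg⟩
      · simp only [hiN, if_false]
        exact hR i (by omega)
    · have hQR : ∀ i < N, Disjoint Q (R i) := fun i hi =>
        (disjoint_of_subset_left hQU sdiff_disjoint).mono_right
          (subset_biUnion_of_mem R (mem_range.2 hi))
      intro i hi j hj hij
      by_cases hiN : i = N <;> by_cases hjN : j = N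
      · omega
      · simp only [hiN, hjN, if_true, if_false]; exact hQR j (by omega)
      · simp only [hiN, hjN, if_true, if_false]; exact (hQR i (by omega)).symm
      · simp only [hiN, hjN, if_false]; exact hRd i (by omega) j (by omega) hij
    · calc _ = ∑ v ∈ S, (2 : ℝ) ^ #{i ∈ range N | v ∉ R i ∧ ¬ IsGood F k γ ({v} ∪ R i)} *
            (if v ∉ Q ∧ ¬ IsGood F k γ ({v} ∪ Q) then 2 else 1) := by
            refine sum_congr rfl fun v _ => ?_
            rw [range_add_one, filter_insert]
            have hcongr : ({i ∈ range N | v ∉ (if i = N then Q else R i) ∧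
                ¬ IsGood F k γ ({v} ∪ if i = N then Q else R i)} : Finset ℕ) =
                {i ∈ range N | v ∉ R i ∧ ¬ IsGood F k γ ({v} ∪ R i)} := by
              apply filter_congr
              intro i hi
              rw [if_neg (by have := mem_range.1 hi; omega)]
            rw [hcongr]
            simp only [if_true]
            split_ifs
            · rw [card_insert_of_notMem
                (fun h => absurd (mem_range.1 (mem_filter.1 h).1) (lt_irrefl _)), pow_succ]
            · rw [mul_one]
        _ ≤ _ := hQΦ
        _ ≤ (1 + 2 * γ / c) * (Fintype.card V * (1 + 2 * γ / c) ^ N) := by gcongr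
        _ = _ := by ring

/-- Exponential decay turns the weight bound of `exists_disjoint_good_sets` into a bound on each
single vertex. -/
theorem mul_lt_of_two_pow_le {m N n q : ℕ} {ξ : ℝ} (hξ : 0 ≤ ξ) (hξq : (1 + ξ) ^ q ≤ 3 / 2)
    (hNn : N ≤ n) (hn : (n : ℝ) ^ q * (3 / 2) ^ n < 2 ^ n)
    (h : (2 : ℝ) ^ m ≤ n * (1 + ξ) ^ N) : m * q < n := by
  by_contra hcon
  push Not at hcon
  have : (2 : ℝ) ^ n ≤ n ^ q * (3 / 2) ^ n := by
    calc (2 : ℝ) ^ n ≤ 2 ^ (m * q) := pow_le_pow_right₀ (by norm_num) hcon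
      _ = (2 ^ m) ^ q := pow_mul _ _ _
      _ ≤ (n * (1 + ξ) ^ N) ^ q := by gcongr
      _ = n ^ q * ((1 + ξ) ^ q) ^ N := by rw [mul_pow, ← pow_mul, ← pow_mul, mul_comm N q]
      _ ≤ n ^ q * (3 / 2) ^ N := by gcongr
      _ ≤ n ^ q * (3 / 2) ^ n := by gcongr; norm_num
  linarith

theorem exists_forall_pow_mul_lt (q : ℕ) :
    ∃ N : ℕ, ∀ n ≥ N, (n : ℝ) ^ q * (3 / 2) ^ n < 2 ^ n := by
  have h := tendsto_pow_const_mul_const_pow_of_abs_lt_one q (r := (3 / 4 : ℝ))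
    (by rw [abs_lt]; constructor <;> norm_num)
  obtain ⟨N, hN⟩ := (h.eventually_lt_const (show (0 : ℝ) < 1 by norm_num)).exists_forall_of_atTop
  refine ⟨N, fun n hn => ?_⟩
  have h1 := hN n hn
  have h2 : (3 / 2 : ℝ) ^ n = (3 / 4) ^ n * 2 ^ n := by rw [← mul_pow]; norm_num
  rw [h2, ← mul_assoc]
  exact mul_lt_of_lt_one_left (by positivity) h1

theorem exists_pos_pow_le (q : ℕ) : ∃ ξ : ℝ, 0 < ξ ∧ (1 + ξ) ^ q ≤ 3 / 2 := by
  have h : Filter.Tendsto (fun ξ : ℝ => (1 + ξ) ^ q) (nhds 0) (nhds ((1 + 0) ^ q)) :=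
    (Continuous.tendsto (by fun_prop) 0)
  rw [add_zero, one_pow] at h
  have h2 := h.eventually_lt_const (show (1 : ℝ) < 3 / 2 by norm_num)
  obtain ⟨δ, hδ, hb⟩ := Metric.eventually_nhds_iff.1 h2
  refine ⟨δ / 2, by positivity, (hb ?_).le⟩
  rw [Real.dist_eq, sub_zero, abs_of_pos (by positivity)]
  linarith

end


/-! ### Filling slots between given `x`-sets. -/

/-- Two vertex classes of sizes `a s` and `(l - a) s` are arranged into `s` rows of length `l`. -/
theorem exists_arrangement {V : Type*} [DecidableEq V] {UA UB : Finset V} (hd : Disjoint UA UB) {l a s : ℕ} (ha : a ≤ l)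
    (hUA : #UA = a * s) (hUB : #UB = (l - a) * s) : ∃ u : Fin l → Fin s → V,
      (∀ c i c' i', u c i = u c' i' → c = c' ∧ i = i') ∧
      (∀ (c : Fin l) (i : Fin s), ((c : ℕ) < a → u c i ∈ UA) ∧ (¬ (c : ℕ) < a → u c i ∈ UB)) ∧
      ∀ v ∈ UA ∪ UB, ∃ c i, u c i = v := by
  have eA : Fin a × Fin s ≃ UA := Fintype.equivOfCardEq (by simp [hUA])
  have eB : Fin (l - a) × Fin s ≃ UB := Fintype.equivOfCardEq (by simp [hUB])
  refine ⟨fun c i => if h : (c : ℕ) < a then eA (⟨c, h⟩, i) else eB (⟨c - a, by omega⟩, i),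
    ?_, ?_, ?_⟩
  · intro c i c' i' h
    by_cases hc : (c : ℕ) < a <;> by_cases hc' : (c' : ℕ) < a
    · simp only [hc, hc', dif_pos] at h
      have := eA.injective (Subtype.ext h)
      simp only [Prod.mk.injEq, Fin.mk.injEq] at this
      exact ⟨Fin.ext this.1, this.2⟩
    · simp only [hc, hc', dif_pos, dif_neg, not_false_eq_true] at h
      exact absurd (h ▸ (eA _).2) (disjoint_right.1 hd (eB _).2)
    · simp only [hc, hc', dif_pos, dif_neg, not_false_eq_true] at h
      exact absurd (h ▸ (eB _).2) (disjoint_left.1 hd (eA _).2)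
    · simp only [hc, hc', dif_neg, not_false_eq_true] at h
      have := eB.injective (Subtype.ext h)
      simp only [Prod.mk.injEq, Fin.mk.injEq] at this
      exact ⟨Fin.ext (by omega), this.2⟩
  · intro c i
    constructor
    · intro hc; simp only [hc, dif_pos, coe_mem]
    · intro hc; simp only [hc, dif_neg, not_false_eq_true, coe_mem]
  · intro v hv
    rcases mem_union.1 hv with hv | hv
    · set p := eA.symm ⟨v, hv⟩ with hp
      refine ⟨⟨p.1, by omega⟩, p.2, ?_⟩
      simp [hp]
    · set p := eB.symm ⟨v, hv⟩ with hp
      refine ⟨⟨p.1 + a, by omega⟩, p.2, ?_⟩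
      simp [hp]

section
variable {V : Type*} [Fintype V] [DecidableEq V]

open scoped Classical in
/-- If the boundary sets `ρ j` and `ρ' j` of `s` slots have low degree in the family `F` of missing
edges, on their own and on average together with each vertex of `UA ∪ UB`, then `UA ∪ UB` can be
divided into `l`-sets joining `ρ j` to `ρ' j`. -/
theorem exists_fill {H F : Finset (Finset V)} {A UA UB : Finset V} {τ β : ZMod 2}
    {k l x a s M : ℕ} (hk : k = l + x)
    (hF : ∀ e, #e = k → par A e = τ → e ∉ F → e ∈ H)
    (ρ ρ' : Fin s → Finset V) (hρ : ∀ j, #(ρ j) = x ∧ par A (ρ j) = β ∧ Disjoint (ρ j) (UA ∪ UB))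
    (hρ' : ∀ j, #(ρ' j) = x ∧ par A (ρ' j) = β ∧ Disjoint (ρ' j) (UA ∪ UB))
    (hUAA : UA ⊆ A) (hUBA : Disjoint UB A) (ha : a ≤ l) (hUA : #UA = a * s)
    (hUB : #UB = (l - a) * s) (hτ : (a : ZMod 2) + β = τ)
    (hslot : ∀ j, #(nb F (ρ j)) + #(nb F (ρ' j)) ≤ M)
    (hvert : ∀ v ∈ UA ∪ UB, ∑ j, #(nb F ({v} ∪ ρ j)) + ∑ j, #(nb F ({v} ∪ ρ' j)) ≤ M)
    (hM : (l + 1) * M < (s - 1).descFactorial l) :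
    ∃ L : Fin s → Finset V, (∀ j, #(L j) = l) ∧ (∀ i j, i ≠ j → Disjoint (L i) (L j)) ∧
      (∀ j, L j ⊆ UA ∪ UB) ∧ (∀ v ∈ UA ∪ UB, ∃ j, v ∈ L j) ∧
      ∀ j, ρ j ∪ L j ∈ H ∧ L j ∪ ρ' j ∈ H := by
  have hdis : Disjoint UA UB := disjoint_of_subset_left hUAA hUBA.symm
  obtain ⟨u, hu, huc, hucov⟩ := exists_arrangement hdis ha hUA hUB
  have huU : ∀ c i, u c i ∈ UA ∪ UB := fun c i => by
    by_cases hc : (c : ℕ) < a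
    · exact mem_union_left _ ((huc c i).1 hc)
    · exact mem_union_right _ ((huc c i).2 hc)
  -- Coordinate `0` of a tuple selects a slot and coordinate `c + 1` the row from which the vertex
  -- of column `c` is taken. As each column lies in one class, all these sets have `a` vertices in
  -- `A`, hence the same parity.
  set S : (Fin (l + 1) → Fin s) → Finset V := fun f => univ.image fun c : Fin l => u c (f c.succ)
    with hS
  have hSl : ∀ f, #(S f) = l := fun f => by
    rw [hS, card_image_of_injective, card_univ, Fintype.card_fin]
    intro c c' h
    exact (hu _ _ _ _ h).1
  have hSU : ∀ f, S f ⊆ UA ∪ UB := fun f => by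
    intro v hv
    obtain ⟨c, -, rfl⟩ := mem_image.1 hv
    exact huU _ _
  have hSA : ∀ f, par A (S f) = a := fun f => by
    have : S f ∩ A = ({c : Fin l | (c : ℕ) < a} : Finset _).image fun c => u c (f c.succ) := by
      ext v
      simp only [hS, mem_inter, mem_image, mem_univ, true_and, mem_filter]
      constructor
      · rintro ⟨⟨c, rfl⟩, hA⟩
        refine ⟨c, ?_, rfl⟩
        by_contra hc
        exact disjoint_left.1 hUBA ((huc c _).2 hc) hA
      · rintro ⟨c, hc, rfl⟩
        exact ⟨⟨c, rfl⟩, hUAA ((huc c _).1 hc)⟩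
    rw [par, this, card_image_of_injective]
    · congr 1
      rw [Fin.card_filter_val_lt]
      exact min_eq_right ha
    · intro c c' h
      exact (hu _ _ _ _ h).1
  have hSinj : ∀ f f' : Fin (l + 1) → Fin s, f 0 = f' 0 → S f = S f' → f = f' := by
    intro f f' h0 h
    funext c
    refine Fin.cases h0 (fun d => ?_) c
    have : u d (f d.succ) ∈ S f' := h ▸ mem_image_of_mem (fun c : Fin l => u c (f c.succ)) (mem_univ d)
    obtain ⟨d', -, hd'⟩ := mem_image.1 this
    obtain ⟨rfl, h2⟩ := hu _ _ _ _ hd'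
    exact h2.symm
  have hnb : ∀ (ρ : Fin s → Finset V), (∀ j, #(ρ j) = x ∧ par A (ρ j) = β ∧
      Disjoint (ρ j) (UA ∪ UB)) → ∀ f, ρ (f 0) ∪ S f ∉ H → S f ∈ nb F (ρ (f 0)) := by
    intro ρ hρ f hf
    obtain ⟨h1, h2, h3⟩ := hρ (f 0)
    have hd : Disjoint (ρ (f 0)) (S f) := h3.mono_right (hSU f)
    rw [mem_nb]
    refine ⟨hd, ?_⟩
    by_contra hcon
    refine hf (hF _ ?_ ?_ hcon)
    · rw [card_union_of_disjoint hd, h1, hSl, hk, add_comm]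
    · rw [par_union hd, h2, hSA, add_comm, hτ]
  have hcount0 : ∀ (ρ : Fin s → Finset V) (j : Fin s),
      #{f | f 0 = j ∧ S f ∈ nb F (ρ (f 0))} ≤ #(nb F (ρ j)) := by
    intro ρ j
    apply card_le_card_of_injOn S
    · intro f hf
      simp only [coe_filter, mem_univ, true_and, Set.mem_ofPred_eq] at hf
      rw [← hf.1]
      exact hf.2
    · intro f hf f' hf' h
      simp only [coe_filter, mem_univ, true_and, Set.mem_ofPred_eq] at hf hf'
      exact hSinj f f' (hf.1.trans hf'.1.symm) h
  -- A bad tuple through a fixed vertex is determined by its slot and the other vertices, which form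
  -- a neighbour of that vertex together with the boundary set.
  have hcount1 : ∀ (ρ : Fin s → Finset V), (∀ j, Disjoint (ρ j) (UA ∪ UB)) →
      ∀ (d : Fin l) (i : Fin s), #{f | f d.succ = i ∧ S f ∈ nb F (ρ (f 0))} ≤
        ∑ j, #(nb F ({u d i} ∪ ρ j)) := by
    intro ρ hρ d i
    rw [← card_sigma]
    have hmem : ∀ f : Fin (l + 1) → Fin s, f d.succ = i → u d i ∈ S f := by
      rintro f rfl
      exact mem_image_of_mem (fun c : Fin l => u c (f c.succ)) (mem_univ d)
    apply card_le_card_of_injOn (fun f => (⟨f 0, (S f).erase (u d i)⟩ : Σ _ : Fin s, Finset V))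
    · intro f hf
      simp only [coe_filter, mem_univ, true_and, Set.mem_ofPred_eq, mem_nb] at hf
      simp only [mem_coe, mem_sigma, mem_univ, true_and, mem_nb]
      refine ⟨disjoint_union_left.2 ⟨by simp, hf.2.1.mono_right (erase_subset _ _)⟩, ?_⟩
      convert hf.2.2 using 1
      rw [union_comm {u d i}, union_assoc]
      congr 1
      rw [← insert_eq, insert_erase (hmem f hf.1)]
    · intro f hf f' hf' h
      simp only [coe_filter, mem_univ, true_and, Set.mem_ofPred_eq] at hf hf'
      simp only [Sigma.mk.injEq, heq_eq_eq] at h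
      apply hSinj f f' h.1
      rw [← insert_erase (hmem f hf.1), h.2, insert_erase (hmem f' hf'.1)]
  obtain ⟨π, hπ⟩ := exists_perm_forall l M
    (fun f => ρ (f 0) ∪ S f ∈ H ∧ ρ' (f 0) ∪ S f ∈ H) (by
      intro c i
      have hsub : ({f | f c = i ∧ ¬ (ρ (f 0) ∪ S f ∈ H ∧ ρ' (f 0) ∪ S f ∈ H)} :
          Finset (Fin (l + 1) → Fin s)) ⊆ ({f | f c = i ∧ S f ∈ nb F (ρ (f 0))} : Finset _) ∪
            ({f | f c = i ∧ S f ∈ nb F (ρ' (f 0))} : Finset _) := by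
        intro f hf
        simp only [mem_filter, mem_univ, true_and, mem_union] at hf ⊢
        by_cases h : ρ (f 0) ∪ S f ∈ H
        · exact Or.inr ⟨hf.1, hnb ρ' hρ' f fun h' => hf.2 ⟨h, h'⟩⟩
        · exact Or.inl ⟨hf.1, hnb ρ hρ f h⟩
      have hle := (card_le_card hsub).trans (card_union_le _ _)
      refine le_trans (le_of_eq (by congr!)) (hle.trans ?_)
      refine Fin.cases ?_ (fun d => ?_) c
      · exact (add_le_add (hcount0 ρ i) (hcount0 ρ' i)).trans (hslot i)
      · exact (add_le_add (hcount1 ρ (fun j => (hρ j).2.2) d i)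
          (hcount1 ρ' (fun j => (hρ' j).2.2) d i)).trans (hvert _ (huU d i)))
    (by simpa using hM)
  -- Reindexed so that the tuple numbered `j` uses slot `j`.
  set f : Fin s → Fin (l + 1) → Fin s := fun j c => π c ((π 0).symm j) with hf
  have hf0 : ∀ j, f j 0 = j := fun j => by simp [hf]
  refine ⟨fun j => S (f j), fun j => hSl _, ?_, fun j => hSU _, ?_, ?_⟩
  · intro i j hij
    rw [disjoint_left]
    intro v hv hv'
    obtain ⟨c, -, rfl⟩ := mem_image.1 hv
    obtain ⟨c', -, h⟩ := mem_image.1 hv'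
    obtain ⟨rfl, h2⟩ := hu _ _ _ _ h
    exact hij ((π 0).symm.injective ((π c'.succ).injective h2)).symm
  · intro v hv
    obtain ⟨c, i, rfl⟩ := hucov v hv
    refine ⟨π 0 ((π c.succ).symm i), mem_image.2 ⟨c, mem_univ _, ?_⟩⟩
    simp [hf]
  · intro j
    have := hπ ((π 0).symm j)
    simp only [Equiv.apply_symm_apply] at this
    refine ⟨this.1, ?_⟩
    rw [union_comm]
    exact this.2

end


/-! ### Closing a path through filled slots. -/

theorem LRPath.extend {V : Type*} [DecidableEq V] {H : Finset (Finset V)} {l x m : ℕ}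
    {R₀ R Z : Finset V} (h : LRPath H l x R₀ R Z m) (L ρ : ℕ → Finset V) (N : ℕ) (h0 : ρ 0 = R)
    (hL : ∀ i < N, #(L i) = l) (hρ : ∀ i < N, #(ρ (i + 1)) = x)
    (hd : ∀ i < N, Disjoint (L i) (ρ (i + 1))) (hZ : ∀ i < N, Disjoint (L i ∪ ρ (i + 1)) Z)
    (hp : ∀ i < N, ∀ j < N, i ≠ j → Disjoint (L i ∪ ρ (i + 1)) (L j ∪ ρ (j + 1)))
    (h₁ : ∀ i < N, ρ i ∪ L i ∈ H) (h₂ : ∀ i < N, L i ∪ ρ (i + 1) ∈ H) :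
    LRPath H l x R₀ (ρ N) (Z ∪ (range N).biUnion fun i => L i ∪ ρ (i + 1)) (m + N) := by
  induction N with
  | zero => simpa [h0] using h
  | succ N ih =>
    have ih' := ih (fun i hi => hL i (by omega)) (fun i hi => hρ i (by omega))
      (fun i hi => hd i (by omega)) (fun i hi => hZ i (by omega))
      (fun i hi j hj => hp i (by omega) j (by omega)) (fun i hi => h₁ i (by omega))
      (fun i hi => h₂ i (by omega))
    have := ih'.snoc (hL N (by omega)) (hρ N (by omega)) (hd N (by omega)) ?_ (h₁ N (by omega))
      (h₂ N (by omega))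
    · convert this using 1
      · rw [range_add_one, biUnion_insert]
        ac_rfl
      · omega
    · rw [disjoint_union_right, disjoint_biUnion_right]
      refine ⟨hZ N (by omega), fun i hi => ?_⟩
      have := mem_range.1 hi
      exact hp N (by omega) i (by omega) (by omega)

section
variable {V : Type*} [Fintype V] [DecidableEq V]

/-- The `k`-sets `e` with `par A e = τ` that are not in `H`. -/
def missing (H : Finset (Finset V)) (A : Finset V) (τ : ZMod 2) (k : ℕ) : Finset (Finset V) :=
  {e | #e = k ∧ par A e = τ ∧ e ∉ H}

theorem mem_missing {H : Finset (Finset V)} {A e : Finset V} {τ : ZMod 2} {k : ℕ} :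
    e ∈ missing H A τ k ↔ #e = k ∧ par A e = τ ∧ e ∉ H := by simp [missing]

theorem card_of_mem_missing {H : Finset (Finset V)} {A : Finset V} {τ : ZMod 2} {k : ℕ} :
    ∀ e ∈ missing H A τ k, #e = k := fun _ he => (mem_missing.1 he).1

/-- Slots good with `v` contribute at most `γ n ^ (l - 1)` each. At most `2 n / q` slots are bad,
and each of them contributes at most the trivial `n ^ (l - 1)`. -/
theorem sum_card_nb_le {F : Finset (Finset V)} {k x l s q : ℕ} {γ : ℝ} (hF : ∀ e ∈ F, #e = k)
    (hk : k = l + x) (hl : 1 ≤ l) (hγ : 0 ≤ γ) (hq : 0 < q) (hs : s ≤ Fintype.card V)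
    (v : V) (ρ : Fin s → Finset V) (hρ : ∀ j, #(ρ j) = x ∧ v ∉ ρ j)
    (hbad : #{j | ¬ IsGood F k γ ({v} ∪ ρ j)} * q ≤ 2 * Fintype.card V) :
    (∑ j, #(nb F ({v} ∪ ρ j)) : ℝ) ≤ (2 / q + γ) * (Fintype.card V : ℝ) ^ l := by
  have hcard : ∀ j, #({v} ∪ ρ j) = x + 1 := fun j => by
    rw [card_union_of_disjoint (by simpa using (hρ j).2), (hρ j).1, card_singleton, add_comm]
  have hterm : ∀ j, (#(nb F ({v} ∪ ρ j)) : ℝ) ≤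
      (if ¬ IsGood F k γ ({v} ∪ ρ j) then 1 else 0) * (Fintype.card V : ℝ) ^ (l - 1) +
        γ * (Fintype.card V : ℝ) ^ (l - 1) := by
    intro j
    have hpos : 0 ≤ γ * (Fintype.card V : ℝ) ^ (l - 1) := by positivity
    by_cases hg : IsGood F k γ ({v} ∪ ρ j)
    · rw [if_neg (not_not.2 hg), zero_mul, zero_add]
      rw [IsGood, hcard] at hg
      rwa [show k - (x + 1) = l - 1 by omega] at hg
    · rw [if_pos hg, one_mul]
      have : #(nb F ({v} ∪ ρ j)) ≤ Fintype.card V ^ (l - 1) :=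
        card_nb_le hF (by rw [hcard]; omega)
      have : (#(nb F ({v} ∪ ρ j)) : ℝ) ≤ (Fintype.card V : ℝ) ^ (l - 1) := by exact_mod_cast this
      linarith
  have hq' : (0 : ℝ) < q := by exact_mod_cast hq
  have hbad' : (#{j | ¬ IsGood F k γ ({v} ∪ ρ j)} : ℝ) ≤ 2 / q * Fintype.card V := by
    rw [div_mul_eq_mul_div, le_div_iff₀ hq']
    exact_mod_cast hbad
  have hs' : (s : ℝ) ≤ Fintype.card V := by exact_mod_cast hs
  calc (∑ j, #(nb F ({v} ∪ ρ j)) : ℝ)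
      ≤ ∑ j, ((if ¬ IsGood F k γ ({v} ∪ ρ j) then 1 else 0) * (Fintype.card V : ℝ) ^ (l - 1) +
        γ * (Fintype.card V : ℝ) ^ (l - 1)) := sum_le_sum fun j _ => hterm j
    _ = #{j | ¬ IsGood F k γ ({v} ∪ ρ j)} * (Fintype.card V : ℝ) ^ (l - 1) +
        s * (γ * (Fintype.card V : ℝ) ^ (l - 1)) := by
        rw [sum_add_distrib, ← sum_mul, card_filter, Nat.cast_sum, sum_const, card_univ,
          Fintype.card_fin, nsmul_eq_mul]
        simp only [Nat.cast_ite, Nat.cast_one, Nat.cast_zero]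
    _ ≤ (2 / q * Fintype.card V) * (Fintype.card V : ℝ) ^ (l - 1) +
        Fintype.card V * (γ * (Fintype.card V : ℝ) ^ (l - 1)) := by gcongr
    _ = (2 / q + γ) * (Fintype.card V : ℝ) ^ l := by
        obtain ⟨i, rfl⟩ : ∃ i, l = i + 1 := ⟨l - 1, by omega⟩
        rw [Nat.add_sub_cancel]; ring

/-- A form of `exists_fill` for good boundary sets. -/
theorem exists_fill_of_isGood {H : Finset (Finset V)} {A UA UB : Finset V} {τ β : ZMod 2}
    {k l x a s q : ℕ} {γ : ℝ} (hk : k = l + x) (hl : 1 ≤ l) (hγ : 0 ≤ γ) (hq : 0 < q)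
    (hγq : γ ≤ 1 / q) (hql : 12 * (l + 1) * (40 * k) ^ l ≤ q) (hqn : q ≤ Fintype.card V)
    (hs : s ≤ Fintype.card V) (hns : (Fintype.card V : ℝ) ≤ 20 * k * s)
    (hnl : 40 * k * l ≤ Fintype.card V)
    (ρ ρ' : Fin s → Finset V) (hρ : ∀ j, #(ρ j) = x ∧ par A (ρ j) = β ∧ Disjoint (ρ j) (UA ∪ UB))
    (hρ' : ∀ j, #(ρ' j) = x ∧ par A (ρ' j) = β ∧ Disjoint (ρ' j) (UA ∪ UB))
    (hUAA : UA ⊆ A) (hUBA : Disjoint UB A) (ha : a ≤ l) (hUA : #UA = a * s)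
    (hUB : #UB = (l - a) * s) (hτ : (a : ZMod 2) + β = τ)
    (hg : ∀ j, IsGood (missing H A τ k) k γ (ρ j))
    (hg' : ∀ j, IsGood (missing H A τ k) k γ (ρ' j))
    (hv : ∀ v ∈ UA ∪ UB,
      #{j | ¬ IsGood (missing H A τ k) k γ ({v} ∪ ρ j)} * q ≤ 2 * Fintype.card V)
    (hv' : ∀ v ∈ UA ∪ UB,
      #{j | ¬ IsGood (missing H A τ k) k γ ({v} ∪ ρ' j)} * q ≤ 2 * Fintype.card V) :
    ∃ L : Fin s → Finset V, (∀ j, #(L j) = l) ∧ (∀ i j, i ≠ j → Disjoint (L i) (L j)) ∧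
      (∀ j, L j ⊆ UA ∪ UB) ∧ (∀ v ∈ UA ∪ UB, ∃ j, v ∈ L j) ∧
      ∀ j, ρ j ∪ L j ∈ H ∧ L j ∪ ρ' j ∈ H := by
  set F := missing H A τ k with hFdef
  have hF : ∀ e ∈ F, #e = k := card_of_mem_missing
  set n := Fintype.card V with hn
  have hq' : (0 : ℝ) < q := by exact_mod_cast hq
  have hn0 : (0 : ℝ) < n := by exact_mod_cast hq.trans_le hqn
  -- Each of the two boundary families contributes at most `(2 / q + γ) n ^ l ≤ 3 / q * n ^ l` per
  -- vertex; the bound for slots is smaller.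
  set M := ⌊6 / (q : ℝ) * (n : ℝ) ^ l⌋₊ with hMdef
  have hM0 : 0 ≤ 6 / (q : ℝ) * (n : ℝ) ^ l := by positivity
  refine exists_fill (F := F) (M := M) hk (fun e h1 h2 h3 => ?_) ρ ρ' hρ hρ' hUAA hUBA ha hUA hUB hτ
    (fun j => ?_) (fun v hvU => ?_) ?_
  · by_contra hcon
    exact h3 (mem_missing.2 ⟨h1, h2, hcon⟩)
  · apply Nat.le_floor
    have h1 := hg j
    have h2 := hg' j
    rw [IsGood, (hρ j).1, show k - x = l by omega] at h1
    rw [IsGood, (hρ' j).1, show k - x = l by omega] at h2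
    push_cast
    calc (#(nb F (ρ j)) : ℝ) + #(nb F (ρ' j)) ≤ 1 / q * (n : ℝ) ^ l + 1 / q * (n : ℝ) ^ l := by
          refine add_le_add (h1.trans ?_) (h2.trans ?_) <;> gcongr
      _ = 2 / q * (n : ℝ) ^ l := by ring
      _ ≤ _ := by gcongr; norm_num
  · apply Nat.le_floor
    have h1 := sum_card_nb_le hF hk hl hγ hq hs v ρ
      (fun j => ⟨(hρ j).1, disjoint_right.1 (hρ j).2.2 hvU⟩) (hv v hvU)
    have h2 := sum_card_nb_le hF hk hl hγ hq hs v ρ'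
      (fun j => ⟨(hρ' j).1, disjoint_right.1 (hρ' j).2.2 hvU⟩) (hv' v hvU)
    push_cast
    calc _ ≤ (2 / q + γ) * (n : ℝ) ^ l + (2 / q + γ) * (n : ℝ) ^ l := add_le_add h1 h2
      _ ≤ (2 / q + 1 / q) * (n : ℝ) ^ l + (2 / q + 1 / q) * (n : ℝ) ^ l := by gcongr
      _ = _ := by ring
  · have hk0 : (0 : ℝ) < k := by exact_mod_cast (by omega : 0 < k)
    -- From `n ≤ 20 k s`, half of `s` remains after `l` is removed. The lower bound on `q` is what
    -- makes `(l + 1) * M` smaller than `(n / (40 k)) ^ l`.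
    have hsl : (n : ℝ) / (40 * k) ≤ ((s - l : ℕ) : ℝ) := by
      have h1 : (l : ℝ) ≤ n / (40 * k) := by
        rw [le_div_iff₀ (by positivity)]
        have : ((40 * k * l : ℕ) : ℝ) ≤ n := by exact_mod_cast hnl
        push_cast at this
        linarith
      have h2 : (n : ℝ) / (40 * k) * 2 ≤ s := by
        rw [div_mul_eq_mul_div, div_le_iff₀ (by positivity)]; linarith
      have h3 : ((s : ℕ) : ℝ) ≤ ((s - l : ℕ) : ℝ) + l := by exact_mod_cast (by omega : s ≤ s - l + l)
      linarith
    have h4 : (s - l) ^ l ≤ (s - 1).descFactorial l := by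
      rcases Nat.eq_zero_or_pos s with h0 | h0
      · subst h0
        have : (0 : ℝ) < n / (40 * k) := by positivity
        have h5 : ((0 - l : ℕ) : ℝ) = 0 := by simp
        linarith
      · have := Nat.pow_sub_le_descFactorial (s - 1) l
        rwa [show s - 1 + 1 - l = s - l by omega] at this
    have h5 : ((l + 1 : ℕ) : ℝ) * M < ((s - l : ℕ) : ℝ) ^ l := by
      have h6 : (M : ℝ) ≤ 6 / q * (n : ℝ) ^ l := Nat.floor_le hM0
      have h7 : (12 * (l + 1) * (40 * k) ^ l : ℝ) ≤ q := by exact_mod_cast hql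
      have h8 : (n : ℝ) ^ l = (40 * k) ^ l * (n / (40 * k)) ^ l := by
        rw [← mul_pow]; congr 1; field_simp
      have h9 : (0 : ℝ) < (n / (40 * k)) ^ l := by positivity
      calc ((l + 1 : ℕ) : ℝ) * M ≤ ((l + 1 : ℕ) : ℝ) * (6 / q * (n : ℝ) ^ l) := by gcongr
        _ = (6 * (l + 1) * (40 * k) ^ l) / q * (n / (40 * k)) ^ l := by
            rw [h8]; push_cast; ring
        _ < 1 * (n / (40 * k)) ^ l := by
            apply mul_lt_mul_of_pos_right _ h9
            rw [div_lt_one hq']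
            have : (0 : ℝ) < (l + 1) * (40 * k) ^ l := by positivity
            linarith
        _ ≤ _ := by rw [one_mul]; gcongr
    have h6 : (l + 1) * M < (s - l) ^ l := by exact_mod_cast h5
    exact h6.trans_le h4

end


theorem exists_partition_three {V : Type*} [DecidableEq V] {S : Finset V} {p q r : ℕ}
    (h : #S = p + q + r) : ∃ S₁ S₂ S₃ : Finset V, #S₁ = p ∧ #S₂ = q ∧ #S₃ = r ∧
      Disjoint S₁ S₂ ∧ Disjoint S₁ S₃ ∧ Disjoint S₂ S₃ ∧ S₁ ∪ S₂ ∪ S₃ = S := by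
  obtain ⟨S₁, h1, h1c⟩ := exists_subset_card_eq (show p ≤ #S by omega)
  have hc := card_sdiff_of_subset h1
  obtain ⟨S₂, h2, h2c⟩ := exists_subset_card_eq (show q ≤ #(S \ S₁) by omega)
  have hc2 := card_sdiff_of_subset h2
  have hd1 : Disjoint S₁ S₂ := (disjoint_of_subset_left h2 sdiff_disjoint).symm
  refine ⟨S₁, S₂, (S \ S₁) \ S₂, h1c, h2c, by omega, hd1,
    (disjoint_of_subset_left sdiff_subset sdiff_disjoint).symm, disjoint_sdiff, ?_⟩
  rw [union_assoc, union_sdiff_of_subset h2, union_sdiff_of_subset h1]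

section
variable {V : Type*} [Fintype V] [DecidableEq V]

/-- A path with good ends and further good sets, which together with each remaining vertex are
mostly good, can be completed to a Hamilton cycle if the remaining vertices have suitable numbers. -/
theorem hasHamiltonCycle_of_good_sets {k l x q m N : ℕ} {H : KGraph V k} {A R₀ R Z : Finset V}
    {τ β : ZMod 2} {γ : ℝ} (hk : k = l + x) (hl : 1 ≤ l) (hγ : 0 ≤ γ) (hq : 0 < q)
    (hγq : γ ≤ 1 / q) (hql : 12 * (l + 1) * (40 * k) ^ l ≤ q) (hqn : q ≤ Fintype.card V)
    (hnl : 40 * k * l ≤ Fintype.card V)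
    (h : LRPath H.edges l x R₀ R Z m) (hR₀ : par A R₀ = β) (hR : par A R = β)
    (hgR₀ : IsGood (missing H.edges A τ k) k γ R₀) (hgR : IsGood (missing H.edges A τ k) k γ R)
    (Q : ℕ → Finset V) (hQ : ∀ i < N, #(Q i) = x ∧ par A (Q i) = β ∧ Disjoint (Q i) Z ∧
      IsGood (missing H.edges A τ k) k γ (Q i))
    (hQd : ∀ i < N, ∀ j < N, i ≠ j → Disjoint (Q i) (Q j))
    (hcnt : ∀ v ∉ Z, #{i ∈ range N | v ∉ Q i ∧
      ¬ IsGood (missing H.edges A τ k) k γ ({v} ∪ Q i)} * q < Fintype.card V)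
    {a₁ a₂ a₃ s₁ s₂ s₃ : ℕ} (hs : s₁ + s₂ + s₃ = N + 1)
    (ha₁ : a₁ ≤ l) (ha₂ : a₂ ≤ l) (ha₃ : a₃ ≤ l)
    (hp₁ : (a₁ : ZMod 2) + β = τ) (hp₂ : (a₂ : ZMod 2) + β = τ) (hp₃ : (a₃ : ZMod 2) + β = τ)
    (hs₁ : (Fintype.card V : ℝ) ≤ 20 * k * s₁) (hs₂ : (Fintype.card V : ℝ) ≤ 20 * k * s₂)
    (hs₃ : (Fintype.card V : ℝ) ≤ 20 * k * s₃) (hNn : N + 1 ≤ Fintype.card V)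
    (hUA : #((Z ∪ (range N).biUnion Q)ᶜ ∩ A) = a₁ * s₁ + a₂ * s₂ + a₃ * s₃)
    (hUB : #((Z ∪ (range N).biUnion Q)ᶜ \ A) =
      (l - a₁) * s₁ + (l - a₂) * s₂ + (l - a₃) * s₃) : H.HasHamiltonCycle l := by
  set F := missing H.edges A τ k with hF
  set U := (Z ∪ (range N).biUnion Q)ᶜ with hU
  have hUZ : ∀ v ∈ U, v ∉ Z ∧ ∀ i < N, v ∉ Q i := by
    intro v hv
    rw [hU, mem_compl, mem_union, mem_biUnion] at hv
    push Not at hv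
    exact ⟨hv.1, fun i hi => hv.2 i (mem_range.2 hi)⟩
  -- The cycle runs from the end `R` of the path through `Q 0, …, Q (N - 1)` back to its start `R₀`.
  -- This leaves `N + 1` slots, with `ρ j` before and `ρ' j` after the `j`-th.
  set ρ : ℕ → Finset V := fun j => if j = 0 then R else Q (j - 1) with hρdef
  set ρ' : ℕ → Finset V := fun j => if j = N then R₀ else Q j with hρ'def
  have hRU : Disjoint R U := disjoint_right.2 fun v hv hvR => (hUZ v hv).1 (h.end_subset hvR)
  have hR₀U : Disjoint R₀ U := disjoint_right.2 fun v hv hvR => (hUZ v hv).1 (h.start_subset hvR)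
  have hQU : ∀ i < N, Disjoint (Q i) U := fun i hi => disjoint_right.2 fun v hv hvQ =>
    (hUZ v hv).2 i hi hvQ
  have hρ : ∀ j < N + 1, #(ρ j) = x ∧ par A (ρ j) = β ∧ Disjoint (ρ j) U ∧ IsGood F k γ (ρ j) := by
    intro j hj
    by_cases h0 : j = 0
    · simp only [hρdef, h0, if_true]; exact ⟨h.card_end, hR, hRU, hgR⟩
    · simp only [hρdef, h0, if_false]
      obtain ⟨h1, h2, -, h4⟩ := hQ (j - 1) (by omega)
      exact ⟨h1, h2, hQU _ (by omega), h4⟩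
  have hρ' : ∀ j < N + 1,
      #(ρ' j) = x ∧ par A (ρ' j) = β ∧ Disjoint (ρ' j) U ∧ IsGood F k γ (ρ' j) := by
    intro j hj
    by_cases h0 : j = N
    · simp only [hρ'def, h0, if_true]; exact ⟨h.card_start, hR₀, hR₀U, hgR₀⟩
    · simp only [hρ'def, h0, if_false]
      obtain ⟨h1, h2, -, h4⟩ := hQ j (by omega)
      exact ⟨h1, h2, hQU _ (by omega), h4⟩
  -- The index `N` stands for the one slot bounded by an end of the path, where nothing is assumed
  -- about `v`. This adds one bad slot, which `q ≤ n` accommodates.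
  have hcnt' : ∀ v ∈ U, ∀ f : ℕ → ℕ, ∀ T : Finset ℕ,
      (∀ j ∈ T, f j ∈ insert N {i ∈ range N | v ∉ Q i ∧ ¬ IsGood F k γ ({v} ∪ Q i)}) →
      Set.InjOn f T → #T * q ≤ 2 * Fintype.card V := by
    intro v hv f T hf hinj
    have h1 := card_le_card_of_injOn f hf hinj
    rw [card_insert_of_notMem (fun h => absurd (mem_range.1 (mem_filter.1 h).1) (lt_irrefl _))] at h1
    have h2 := hcnt v (hUZ v hv).1
    nlinarith
  have hbad : ∀ v ∈ U, ∀ o s : ℕ, o + s ≤ N + 1 →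
      #{j : Fin s | ¬ IsGood F k γ ({v} ∪ ρ (o + j))} * q ≤ 2 * Fintype.card V := by
    intro v hv o s hos
    rw [← card_image_of_injective _ Fin.val_injective]
    refine hcnt' v hv (fun j => if o + j = 0 then N else o + j - 1) _ ?_ ?_
    · intro j hj
      obtain ⟨j, hj', rfl⟩ := mem_image.1 hj
      have hjs := j.2
      simp only [mem_filter, mem_univ, true_and, hρdef] at hj'
      by_cases h0 : o + (j : ℕ) = 0
      · simp [h0]
      · simp only [h0, if_false] at hj' ⊢
        exact mem_insert_of_mem (mem_filter.2 ⟨mem_range.2 (by omega),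
          (hUZ v hv).2 _ (by omega), hj'⟩)
    · intro i hi j hj hij
      obtain ⟨i, -, rfl⟩ := mem_image.1 (mem_coe.1 hi)
      obtain ⟨j, -, rfl⟩ := mem_image.1 (mem_coe.1 hj)
      have := i.2
      have := j.2
      simp only at hij
      split_ifs at hij <;> omega
  have hbad' : ∀ v ∈ U, ∀ o s : ℕ, o + s ≤ N + 1 →
      #{j : Fin s | ¬ IsGood F k γ ({v} ∪ ρ' (o + j))} * q ≤ 2 * Fintype.card V := by
    intro v hv o s hos
    rw [← card_image_of_injective _ Fin.val_injective]
    refine hcnt' v hv (fun j => o + j) _ ?_ ?_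
    · intro j hj
      obtain ⟨j, hj', rfl⟩ := mem_image.1 hj
      have hjs := j.2
      simp only [mem_filter, mem_univ, true_and, hρ'def] at hj'
      by_cases h0 : o + (j : ℕ) = N
      · simp [h0]
      · simp only [h0, if_false] at hj'
        exact mem_insert_of_mem (mem_filter.2 ⟨mem_range.2 (by omega),
          (hUZ v hv).2 _ (by omega), hj'⟩)
    · intro i hi j hj hij
      have hij' : o + i = o + j := hij
      omega
  -- The slots are cut into three consecutive blocks, on each of which all `l`-sets have the same
  -- number `a` of vertices in `A`.
  have fill : ∀ (o s a : ℕ) (UA UB : Finset V), o + s ≤ N + 1 → a ≤ l → (a : ZMod 2) + β = τ →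
      (Fintype.card V : ℝ) ≤ 20 * k * s → UA ⊆ U ∩ A → UB ⊆ U \ A → #UA = a * s →
      #UB = (l - a) * s → ∃ L : ℕ → Finset V,
        (∀ j, o ≤ j → j < o + s → #(L j) = l ∧ L j ⊆ UA ∪ UB ∧ ρ j ∪ L j ∈ H.edges ∧
          L j ∪ ρ' j ∈ H.edges) ∧
        (∀ i j, o ≤ i → i < o + s → o ≤ j → j < o + s → i ≠ j → Disjoint (L i) (L j)) ∧
        ∀ v ∈ UA ∪ UB, ∃ j, o ≤ j ∧ j < o + s ∧ v ∈ L j := by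
    intro o s a UA UB hos ha hp hns hUA hUB hUAc hUBc
    have hsub : UA ∪ UB ⊆ U :=
      union_subset (hUA.trans inter_subset_left) (hUB.trans sdiff_subset)
    obtain ⟨L, h1, h2, h3, h4, h5⟩ := exists_fill_of_isGood (H := H.edges) (A := A) (UA := UA)
      (UB := UB) (τ := τ) (β := β) (a := a) hk hl hγ hq hγq hql hqn (by omega) hns hnl
      (fun j : Fin s => ρ (o + j)) (fun j : Fin s => ρ' (o + j))
      (fun j => by
        obtain ⟨e1, e2, e3, -⟩ := hρ (o + j) (by omega)
        exact ⟨e1, e2, e3.mono_right hsub⟩)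
      (fun j => by
        obtain ⟨e1, e2, e3, -⟩ := hρ' (o + j) (by omega)
        exact ⟨e1, e2, e3.mono_right hsub⟩)
      (hUA.trans inter_subset_right) (disjoint_of_subset_left hUB sdiff_disjoint) ha hUAc hUBc hp
      (fun j => (hρ (o + j) (by omega)).2.2.2) (fun j => (hρ' (o + j) (by omega)).2.2.2)
      (fun v hv => hbad v (hsub hv) o s hos) (fun v hv => hbad' v (hsub hv) o s hos)
    refine ⟨fun j => if hj : j - o < s then L ⟨j - o, hj⟩ else ∅, ?_, ?_, ?_⟩
    · intro j hj1 hj2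
      have hj : j - o < s := by omega
      simp only [hj, dif_pos]
      have h6 := h5 ⟨j - o, hj⟩
      simp only [show o + (j - o) = j by omega] at h6
      exact ⟨h1 _, h3 _, h6⟩
    · intro i j hi1 hi2 hj1 hj2 hij
      have hi : i - o < s := by omega
      have hj : j - o < s := by omega
      simp only [hi, hj, dif_pos]
      exact h2 _ _ fun he => hij (by have := Fin.mk.inj_iff.1 he; omega)
    · intro v hv
      obtain ⟨j, hj⟩ := h4 v hv
      refine ⟨o + j, by omega, by omega, ?_⟩
      simpa using hj
  obtain ⟨A₁, A₂, A₃, cA₁, cA₂, cA₃, dA12, dA13, dA23, hA⟩ := exists_partition_three hUA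
  obtain ⟨B₁, B₂, B₃, cB₁, cB₂, cB₃, dB12, dB13, dB23, hB⟩ := exists_partition_three hUB
  have hA1 : A₁ ⊆ U ∩ A := by rw [← hA]; intro v; simp only [mem_union]; tauto
  have hA2 : A₂ ⊆ U ∩ A := by rw [← hA]; intro v; simp only [mem_union]; tauto
  have hA3 : A₃ ⊆ U ∩ A := by rw [← hA]; intro v; simp only [mem_union]; tauto
  have hB1 : B₁ ⊆ U \ A := by rw [← hB]; intro v; simp only [mem_union]; tauto
  have hB2 : B₂ ⊆ U \ A := by rw [← hB]; intro v; simp only [mem_union]; tauto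
  have hB3 : B₃ ⊆ U \ A := by rw [← hB]; intro v; simp only [mem_union]; tauto
  obtain ⟨L₁, f₁, g₁, c₁⟩ := fill 0 s₁ a₁ A₁ B₁ (by omega) ha₁ hp₁ hs₁ hA1 hB1 cA₁ cB₁
  obtain ⟨L₂, f₂, g₂, c₂⟩ := fill s₁ s₂ a₂ A₂ B₂ (by omega) ha₂ hp₂ hs₂ hA2 hB2 cA₂ cB₂
  obtain ⟨L₃, f₃, g₃, c₃⟩ := fill (s₁ + s₂) s₃ a₃ A₃ B₃ (by omega) ha₃ hp₃ hs₃ hA3 hB3 cA₃ cB₃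
  have dAB : ∀ P Q : Finset V, P ⊆ U ∩ A → Q ⊆ U \ A → Disjoint P Q := fun P Q hP hQ =>
    (disjoint_of_subset_left hP (inter_comm U A ▸ disjoint_of_subset_left inter_subset_left
      disjoint_sdiff)).mono_right hQ
  have d12 : Disjoint (A₁ ∪ B₁) (A₂ ∪ B₂) := by
    simp only [disjoint_union_left, disjoint_union_right]
    exact ⟨⟨dA12, (dAB _ _ hA2 hB1).symm⟩, dAB _ _ hA1 hB2, dB12⟩
  have d13 : Disjoint (A₁ ∪ B₁) (A₃ ∪ B₃) := by
    simp only [disjoint_union_left, disjoint_union_right]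
    exact ⟨⟨dA13, (dAB _ _ hA3 hB1).symm⟩, dAB _ _ hA1 hB3, dB13⟩
  have d23 : Disjoint (A₂ ∪ B₂) (A₃ ∪ B₃) := by
    simp only [disjoint_union_left, disjoint_union_right]
    exact ⟨⟨dA23, (dAB _ _ hA3 hB2).symm⟩, dAB _ _ hA2 hB3, dB23⟩
  set L : ℕ → Finset V := fun j => if j < s₁ then L₁ j else if j < s₁ + s₂ then L₂ j else L₃ j
    with hL
  have hcase : ∀ j < N + 1, (j < s₁ ∧ L j = L₁ j ∧ L j ⊆ A₁ ∪ B₁) ∨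
      (s₁ ≤ j ∧ j < s₁ + s₂ ∧ L j = L₂ j ∧ L j ⊆ A₂ ∪ B₂) ∨
      (s₁ + s₂ ≤ j ∧ L j = L₃ j ∧ L j ⊆ A₃ ∪ B₃) := by
    intro j hj
    by_cases h1 : j < s₁
    · have : L j = L₁ j := by simp [hL, h1]
      exact Or.inl ⟨h1, this, this ▸ (f₁ j (by omega) (by omega)).2.1⟩
    · by_cases h2 : j < s₁ + s₂
      · have : L j = L₂ j := by simp [hL, h1, h2]
        exact Or.inr (Or.inl ⟨by omega, h2, this, this ▸ (f₂ j (by omega) (by omega)).2.1⟩)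
      · have : L j = L₃ j := by simp [hL, h1, h2]
        exact Or.inr (Or.inr ⟨by omega, this, this ▸ (f₃ j (by omega) (by omega)).2.1⟩)
  have hLp : ∀ j < N + 1, #(L j) = l ∧ L j ⊆ U ∧ ρ j ∪ L j ∈ H.edges ∧ L j ∪ ρ' j ∈ H.edges := by
    intro j hj
    rcases hcase j hj with ⟨h1, h2, h3⟩ | ⟨h1, h1', h2, h3⟩ | ⟨h1, h2, h3⟩
    · obtain ⟨e1, e2, e3⟩ := f₁ j (by omega) (by omega)
      rw [h2]
      exact ⟨e1, e2.trans (union_subset (hA1.trans inter_subset_left) (hB1.trans sdiff_subset)), e3⟩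
    · obtain ⟨e1, e2, e3⟩ := f₂ j (by omega) (by omega)
      rw [h2]
      exact ⟨e1, e2.trans (union_subset (hA2.trans inter_subset_left) (hB2.trans sdiff_subset)), e3⟩
    · obtain ⟨e1, e2, e3⟩ := f₃ j (by omega) (by omega)
      rw [h2]
      exact ⟨e1, e2.trans (union_subset (hA3.trans inter_subset_left) (hB3.trans sdiff_subset)), e3⟩
  have hLd : ∀ i < N + 1, ∀ j < N + 1, i ≠ j → Disjoint (L i) (L j) := by
    intro i hi j hj hij
    rcases hcase i hi with ⟨a1, a2, a3⟩ | ⟨a1, a1', a2, a3⟩ | ⟨a1, a2, a3⟩ <;>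
      rcases hcase j hj with ⟨b1, b2, b3⟩ | ⟨b1, b1', b2, b3⟩ | ⟨b1, b2, b3⟩
    · rw [a2, b2]; exact g₁ i j (by omega) (by omega) (by omega) (by omega) hij
    · exact d12.mono a3 b3
    · exact d13.mono a3 b3
    · exact d12.symm.mono a3 b3
    · rw [a2, b2]; exact g₂ i j (by omega) (by omega) (by omega) (by omega) hij
    · exact d23.mono a3 b3
    · exact d13.symm.mono a3 b3
    · exact d23.symm.mono a3 b3
    · rw [a2, b2]; exact g₃ i j (by omega) (by omega) (by omega) (by omega) hij
  have hLcov : ∀ v ∈ U, ∃ j < N + 1, v ∈ L j := by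
    intro v hv
    have hv' : v ∈ (A₁ ∪ B₁) ∨ v ∈ (A₂ ∪ B₂) ∨ v ∈ (A₃ ∪ B₃) := by
      have : v ∈ (U ∩ A) ∪ (U \ A) := by
        rw [mem_union, mem_inter, mem_sdiff]; tauto
      rw [← hA, ← hB] at this
      simp only [mem_union] at this ⊢
      tauto
    rcases hv' with hv | hv | hv
    · obtain ⟨j, h1, h2, h3⟩ := c₁ v hv
      exact ⟨j, by omega, by simpa only [hL, if_pos (show j < s₁ by omega)] using h3⟩
    · obtain ⟨j, h1, h2, h3⟩ := c₂ v hv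
      have hj : L j = L₂ j := by
        simp only [hL, if_neg (show ¬ j < s₁ by omega), if_pos (show j < s₁ + s₂ by omega)]
      exact ⟨j, by omega, hj ▸ h3⟩
    · obtain ⟨j, h1, h2, h3⟩ := c₃ v hv
      have hj : L j = L₃ j := by
        simp only [hL, if_neg (show ¬ j < s₁ by omega), if_neg (show ¬ j < s₁ + s₂ by omega)]
      exact ⟨j, by omega, hj ▸ h3⟩
  have hρs : ∀ i, ρ (i + 1) = Q i := fun i => by simp [hρdef]
  have hρ's : ∀ i < N, ρ' i = Q i := fun i hi => by
    simp only [hρ'def, if_neg (show ¬ i = N by omega)]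
  have hLQ : ∀ i < N + 1, ∀ j < N, Disjoint (L i) (Q j) := fun i hi j hj =>
    ((hQU j hj).mono_right (hLp i hi).2.1).symm
  have hLZ : ∀ i < N + 1, Disjoint (L i) Z := fun i hi => disjoint_left.2 fun v hv =>
    (hUZ v ((hLp i hi).2.1 hv)).1
  have hpath := h.extend L ρ N (by simp [hρdef]) (fun i hi => (hLp i (by omega)).1)
    (fun i hi => by rw [hρs]; exact (hQ i hi).1)
    (fun i hi => by rw [hρs]; exact hLQ i (by omega) i hi)
    (fun i hi => by
      rw [hρs]
      exact disjoint_union_left.2 ⟨hLZ i (by omega), (hQ i hi).2.2.1⟩)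
    (fun i hi j hj hij => by
      rw [hρs, hρs]
      simp only [disjoint_union_left, disjoint_union_right]
      exact ⟨⟨hLd i (by omega) j (by omega) hij, (hLQ j (by omega) i hi).symm⟩,
        hLQ i (by omega) j hj, hQd i hi j hj hij⟩)
    (fun i hi => (hLp i (by omega)).2.2.1)
    (fun i hi => by
      rw [hρs, ← hρ's i hi]
      exact (hLp i (by omega)).2.2.2)
  refine hpath.hasHamiltonCycle (by omega) (hLp N (by omega)).1 ?_ ?_ (hLp N (by omega)).2.2.1 ?_
  · rw [disjoint_union_right, disjoint_biUnion_right]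
    refine ⟨hLZ N (by omega), fun i hi => ?_⟩
    have hi' := mem_range.1 hi
    rw [hρs, disjoint_union_right]
    exact ⟨hLd N (by omega) i (by omega) (by omega), hLQ N (by omega) i hi'⟩
  · intro v
    by_cases hv : v ∈ U
    · obtain ⟨j, hj, hvj⟩ := hLcov v hv
      by_cases hjN : j = N
      · exact Or.inl (hjN ▸ hvj)
      · exact Or.inr (mem_union_right _ (mem_biUnion.2 ⟨j, mem_range.2 (by omega),
          mem_union_left _ hvj⟩))
    · rw [hU, mem_compl, not_not, mem_union, mem_biUnion] at hv
      rcases hv with hv | ⟨i, hi, hv⟩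
      · exact Or.inr (mem_union_left _ hv)
      · exact Or.inr (mem_union_right _ (mem_biUnion.2 ⟨i, hi, mem_union_right _ (by
          rw [hρs]; exact hv)⟩))
  · have := (hLp N (by omega)).2.2.2
    simpa only [hρ'def, if_true] using this

end


/-! ### Choice of the types and completion of a short path. -/

theorem zmod_two_cases (β : ZMod 2) : β = 0 ∨ β = 1 := by
  revert β; decide

theorem natCast_zmod_two_eq_zero_iff {a : ℕ} : (a : ZMod 2) = 0 ↔ a % 2 = 0 := by
  rw [ZMod.natCast_eq_zero_iff]; omega

theorem natCast_zmod_two_eq_one_iff {a : ℕ} : (a : ZMod 2) = 1 ↔ a % 2 = 1 := by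
  rw [ZMod.natCast_eq_one_iff_odd, Nat.odd_iff]

/-- Two sizes of a given parity with sum close to `x`. -/
theorem exists_two_types {x : ℕ} (hx : 1 ≤ x) (β : ZMod 2) : ∃ b₀ b₁ : ℕ, b₀ ≤ x ∧ b₁ ≤ x ∧
    (b₀ : ZMod 2) = β ∧ (b₁ : ZMod 2) = β ∧ x ≤ b₀ + b₁ + 1 ∧ b₀ + b₁ ≤ x + 1 := by
  have key : ∀ p < 2, ∃ b₀ b₁ : ℕ, b₀ ≤ x ∧ b₁ ≤ x ∧ b₀ % 2 = p ∧ b₁ % 2 = p ∧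
      x ≤ b₀ + b₁ + 1 ∧ b₀ + b₁ ≤ x + 1 := by
    intro p hp
    by_cases h0 : x / 2 % 2 = p
    · exact ⟨x / 2, x / 2, by omega⟩
    · rcases Nat.mod_two_eq_zero_or_one x with h | h
      · exact ⟨x / 2 - 1, x / 2 + 1, by omega⟩
      · exact ⟨x / 2 + 1, x / 2 + 1, by omega⟩
  rcases zmod_two_cases β with rfl | rfl
  · simpa only [natCast_zmod_two_eq_zero_iff] using key 0 (by omega)
  · simpa only [natCast_zmod_two_eq_one_iff] using key 1 (by omega)

/-- Three sizes of a given parity with prescribed total, each used often. -/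
theorem exists_three_types {l w s M : ℕ} (hl : 4 ≤ l) (hw : l ≤ w + 1) (hw' : w ≤ l + 1)
    (α : ZMod 2) (hpar : (M : ZMod 2) = s * α) (hM : 40 * M ≤ 20 * (w * s) + s)
    (hM' : 20 * (w * s) ≤ 40 * M + s) (hs : 1000 ≤ s) :
    ∃ a₁ a₂ a₃ s₁ s₂ s₃ : ℕ, a₁ ≤ l ∧ a₂ ≤ l ∧ a₃ ≤ l ∧ (a₁ : ZMod 2) = α ∧
      (a₂ : ZMod 2) = α ∧ (a₃ : ZMod 2) = α ∧ s₁ + s₂ + s₃ = s ∧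
      a₁ * s₁ + a₂ * s₂ + a₃ * s₃ = M ∧ s ≤ 10 * s₁ ∧ s ≤ 10 * s₂ ∧ s ≤ 10 * s₃ := by
  have h2 : (2 : ZMod 2) = 0 := by decide
  have h4 : (4 : ZMod 2) = 0 := by decide
  -- One residue modulo 4 determines `w - 2a`, which lies between 1 and 4. In the last case with `a
  -- = 0` the size `a + 4` is allowed because `l ≥ 4`.
  obtain ⟨a, ha, h⟩ : ∃ a : ℕ, (a : ZMod 2) = α ∧
      ((2 * a + 1 ≤ w ∧ w ≤ 2 * a + 3 ∧ a + 2 ≤ l) ∨ (w = 2 * a + 4 ∧ a + 4 ≤ l)) := by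
    have key : ∀ p < 2, ∃ a : ℕ, a % 2 = p ∧
        ((2 * a + 1 ≤ w ∧ w ≤ 2 * a + 3 ∧ a + 2 ≤ l) ∨ (w = 2 * a + 4 ∧ a + 4 ≤ l)) :=
      fun p hp => ⟨(w - 1 - 2 * p) / 4 * 2 + p, by omega, by omega⟩
    rcases zmod_two_cases α with rfl | rfl
    · simpa only [natCast_zmod_two_eq_zero_iff] using key 0 (by omega)
    · simpa only [natCast_zmod_two_eq_one_iff] using key 1 (by omega)
  have hev : (2 : ℤ) ∣ (M : ℤ) - a * s := by
    have : (((M : ℤ) - a * s : ℤ) : ZMod 2) = 0 := by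
      push_cast; rw [hpar, ha]; ring
    exact (ZMod.intCast_zmod_eq_zero_iff_dvd _ 2).1 this
  have hw2 : (w : ℤ) * s = 2 * (a * s) + (w - 2 * a) * s := by ring
  zify at hM hM'
  rcases h with ⟨h1, h2', h3⟩ | ⟨h1, h3⟩
  -- Here the average `w / 2` lies well inside `[a, a + 2]`. The size `a + 2` is used `d` times and
  -- the size `a` otherwise, split in two blocks.
  · obtain ⟨d, hd⟩ := hev
    have hd1 : 0 ≤ d ∧ (s : ℤ) ≤ 5 * d ∧ 10 * d ≤ 8 * s - 10 := by
      obtain h | h | h : (w : ℤ) - 2 * a = 1 ∨ (w : ℤ) - 2 * a = 2 ∨ (w : ℤ) - 2 * a = 3 := by omega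
      all_goals
        rw [h] at hw2
        generalize (w : ℤ) * s = W at *
        generalize (a : ℤ) * s = P at *
        omega
    obtain ⟨d, rfl⟩ := Int.eq_ofNat_of_zero_le hd1.1
    refine ⟨a, a, a + 2, (s - d) / 2, s - d - (s - d) / 2, d, by omega, by omega, by omega, ha, ha,
      by push_cast; rw [ha, h2, add_zero], by omega, ?_, by omega, by omega, by omega⟩
    have e1 : a * ((s - d) / 2) + a * (s - d - (s - d) / 2) = a * (s - d) := by
      rw [← mul_add]; congr 1; omega
    rw [e1]
    have e2 : d ≤ s := by omega
    zify [e2]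
    linarith
  -- Here `w / 2 = a + 2` itself is admissible, and two sizes alone would leave one block too small.
  -- The sizes `a`, `a + 2`, `a + 4` are each used about `s / 3` times, and a small `d` corrects the
  -- total.
  · have hev2 : (2 : ℤ) ∣ (M : ℤ) - (a + 2) * s := by
      have : (M : ℤ) - (a + 2) * s = (M - a * s) - 2 * s := by ring
      rw [this]; exact dvd_sub hev (dvd_mul_right _ _)
    obtain ⟨d, hd⟩ := hev2
    have hd1 : -(s : ℤ) ≤ 60 * d ∧ 60 * d ≤ s := by
      have : (a + 2 : ℤ) * s = a * s + 2 * s := by ring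
      rw [this] at hd
      rw [show (w : ℤ) - 2 * a = 4 by omega] at hw2
      generalize (w : ℤ) * s = W at *
      generalize (a : ℤ) * s = P at *
      omega
    obtain ⟨s₃, hs₃⟩ := Int.eq_ofNat_of_zero_le (show 0 ≤ ((s / 3 : ℕ) : ℤ) + d by omega)
    refine ⟨a, a + 2, a + 4, s / 3, s - s / 3 - s₃, s₃, by omega, by omega, by omega, ha,
      by push_cast; rw [ha, h2, add_zero], by push_cast; rw [ha, h4, add_zero], by omega, ?_,
      by omega, by omega, by omega⟩
    have e2 : s₃ ≤ s - s / 3 := by omega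
    have e3 : s / 3 ≤ s := by omega
    zify [e2, e3]
    zify at hs₃
    rw [← hs₃]
    linarith

theorem sum_range_alternate (b₀ b₁ i : ℕ) :
    ∑ j ∈ range i, (if j % 2 = 0 then b₀ else b₁) = b₀ * ((i + 1) / 2) + b₁ * (i / 2) := by
  induction i with
  | zero => simp
  | succ i ih =>
    rw [sum_range_succ, ih]
    rcases Nat.mod_two_eq_zero_or_one i with h | h
    · rw [if_pos h, show (i + 1 + 1) / 2 = (i + 1) / 2 + 1 by omega,
        show (i + 1) / 2 = i / 2 by omega]
      ring
    · rw [if_neg (by omega), show (i + 1 + 1) / 2 = (i + 1) / 2 by omega,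
        show (i + 1) / 2 = i / 2 + 1 by omega]
      ring

theorem sum_range_alternate_bounds {b₀ b₁ x : ℕ} (h₀ : b₀ ≤ x) (h₁ : b₁ ≤ x) (i : ℕ) :
    2 * ∑ j ∈ range i, (if j % 2 = 0 then b₀ else b₁) ≤ (b₀ + b₁) * i + x ∧
      (b₀ + b₁) * i ≤ 2 * ∑ j ∈ range i, (if j % 2 = 0 then b₀ else b₁) + x := by
  rw [sum_range_alternate]
  rcases Nat.even_or_odd' i with ⟨j, rfl | rfl⟩
  · rw [show (2 * j + 1) / 2 = j by omega, show 2 * j / 2 = j by omega]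
    constructor <;> nlinarith
  · rw [show (2 * j + 1 + 1) / 2 = j + 1 by omega, show (2 * j + 1) / 2 = j by omega]
    constructor <;> nlinarith

theorem card_biUnion_inter {V ι : Type*} [DecidableEq V] {A : Finset V} {s : Finset ι} {f : ι → Finset V}
    (h : ∀ i ∈ s, ∀ j ∈ s, i ≠ j → Disjoint (f i) (f j)) :
    #(s.biUnion f ∩ A) = ∑ i ∈ s, #(f i ∩ A) := by
  rw [biUnion_inter, card_biUnion]
  exact fun i hi j hj hij => (h i hi j hj hij).mono inter_subset_left inter_subset_left

set_option maxHeartbeats 1600000 in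
/-- A short path with good ends, containing all the exceptional vertices and having the right
parity, can be completed to a Hamilton cycle. -/
theorem exists_completion {l x : ℕ} (hl : 4 ≤ l) (hx : 1 ≤ x) :
    ∃ γ₀ : ℝ, 0 < γ₀ ∧ ∀ γ : ℝ, 0 < γ → γ ≤ γ₀ → ∃ N₀ : ℕ, ∀ (V : Type*) [Fintype V]
      [DecidableEq V] (H : KGraph V (l + x)) (A R₀ R Z : Finset V) (τ β : ZMod 2) (m t : ℕ),
      Fintype.card V = t * (l + x) → N₀ ≤ Fintype.card V →
      2 * (#A : ℝ) ≤ (1 + 2 * γ) * Fintype.card V → (1 - 2 * γ) * Fintype.card V ≤ 2 * (#A : ℝ) →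
      2 ^ (l + x) * (#(missing H.edges A τ (l + x)) : ℝ) ≤
        γ ^ 2 * (Fintype.card V : ℝ) ^ (l + x) →
      LRPath H.edges l x R₀ R Z m → (#Z : ℝ) ≤ γ * Fintype.card V →
      par A R₀ = β → par A R = β → IsGood (missing H.edges A τ (l + x)) (l + x) γ R₀ →
      IsGood (missing H.edges A τ (l + x)) (l + x) γ R →
      par A Z = par A univ - t * τ + m * τ + β →
      (∀ v ∉ Z, 2 ^ (l + x) * (#(nb (missing H.edges A τ (l + x)) {v}) : ℝ) ≤
        γ ^ 2 * (Fintype.card V : ℝ) ^ (l + x - 1)) → H.HasHamiltonCycle l := by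
  obtain ⟨k, hk⟩ : ∃ k, k = l + x := ⟨_, rfl⟩
  rw [← hk]
  set q := 12 * (l + 1) * (40 * k) ^ l with hq
  have hk0 : 0 < k := by omega
  have hq0 : 0 < q := by positivity
  obtain ⟨ξ, hξ, hξq⟩ := exists_pos_pow_le q
  obtain ⟨N₁, hN₁⟩ := exists_forall_pow_mul_lt q
  have hkR : (0 : ℝ) < k := by exact_mod_cast hk0
  -- At every stage at least `t = n / k` vertices, with room for one more `x`-set, remain in each
  -- class. So there are at least `t ^ x / x!` sets of the required type.
  set c : ℝ := 1 / (k ^ x * x.factorial) with hc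
  have hc0 : 0 < c := by positivity
  -- The bounds serve in turn the filling, the supply of good candidates, the growth rate `2 * γ / c
  -- ≤ ξ` of the potential, and the size estimates.
  refine ⟨min (min (1 / q) (c / 2)) (min (ξ * c / 2) (1 / (1000 * k))), by positivity,
    fun γ hγ hγ₀ => ⟨N₁ + q + 40 * k * l + 2000 * k ^ 2, ?_⟩⟩
  have hγq : γ ≤ 1 / q := hγ₀.trans ((min_le_left _ _).trans (min_le_left _ _))
  have hγc : γ ≤ c / 2 := hγ₀.trans ((min_le_left _ _).trans (min_le_right _ _))
  have hγξ : γ ≤ ξ * c / 2 := hγ₀.trans ((min_le_right _ _).trans (min_le_left _ _))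
  have hγk : γ ≤ 1 / (1000 * k) := hγ₀.trans ((min_le_right _ _).trans (min_le_right _ _))
  have hγk' : γ * k ≤ 1 / 1000 := by
    rw [le_div_iff₀ (by positivity)] at hγk; linarith
  intro V _ _ H A R₀ R Z τ β m t hn hN hA hA' hF h hZ hR₀ hR hgR₀ hgR hpar hv
  set F := missing H.edges A τ k with hFdef
  set n := Fintype.card V with hndef
  have hnk : 2000 * k ^ 2 ≤ n := by omega
  have hn0 : 0 < n := by
    have : 0 < k ^ 2 := by positivity
    omega
  have hnR : (0 : ℝ) < n := by exact_mod_cast hn0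
  have hnkR : 2000 * (k : ℝ) ^ 2 ≤ n := by exact_mod_cast hnk
  have hntR : (n : ℝ) = t * k := by rw [hn]; push_cast; rfl
  have hZc : #Z = x + m * k := by rw [h.card_eq, hk]
  have hZcR : (#Z : ℝ) = x + m * k := by rw [hZc]; push_cast; rfl
  have hmt : (m : ℝ) ≤ γ * t := by
    have : (m : ℝ) * k ≤ γ * t * k := by
      rw [hntR] at hZ
      have : (0 : ℝ) ≤ x := by positivity
      linarith
    exact le_of_mul_le_mul_right this hkR
  have hk5 : (5 : ℝ) ≤ k := by exact_mod_cast (by omega : 5 ≤ k)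
  have hγ1 : γ ≤ 1 / 5000 := by nlinarith
  have ht : 2000 * (k : ℝ) ≤ t := by
    have : 2000 * (k : ℝ) * k ≤ t * k := by rw [← hntR]; linarith
    exact le_of_mul_le_mul_right this hkR
  have hmt2 : 2 * m ≤ t := by
    have : (2 * m : ℝ) ≤ t := by nlinarith
    exact_mod_cast this
  have ht' : 2000 * k ≤ t := by exact_mod_cast ht
  obtain ⟨s, hs⟩ : ∃ s, s + m = t := ⟨t - m, by omega⟩
  have hs1 : 1000 ≤ s := by omega
  obtain ⟨N, rfl⟩ : ∃ N, s = N + 1 := ⟨s - 1, by omega⟩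
  have hNt : N + 1 ≤ t := by omega
  have htn : t ≤ n := by rw [hn]; exact Nat.le_mul_of_pos_right _ hk0
  obtain ⟨b₀, b₁, hb₀, hb₁, hb₀β, hb₁β, hbx, hbx'⟩ := exists_two_types hx β
  -- Alternating two sizes of parity `β` with sum within one of `x` makes every initial segment of
  -- the chosen sets use both classes almost equally.
  set a : ℕ → ℕ := fun j => if j % 2 = 0 then b₀ else b₁ with ha
  have hax : ∀ i, a i ≤ x := fun i => by simp only [ha]; split_ifs <;> assumption
  have haβ : ∀ i, (a i : ZMod 2) = β := fun i => by simp only [ha]; split_ifs <;> assumption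
  have hsum := fun i => sum_range_alternate_bounds hb₀ hb₁ i
  have hsum' : ∀ i, ∑ j ∈ range i, a j + ∑ j ∈ range i, (x - a j) = i * x := by
    intro i
    rw [← sum_add_distrib, sum_congr rfl fun j _ => Nat.add_sub_of_le (hax j), sum_const,
      card_range, smul_eq_mul]
  have hUA : #(Zᶜ ∩ A) + #(Z ∩ A) = #A := by
    rw [inter_comm, inter_comm Z, ← card_union_of_disjoint, ← inter_union_distrib_left,
      union_comm, union_compl, inter_univ]
    exact (disjoint_of_subset_left inter_subset_right disjoint_compl_left).mono_right
      inter_subset_right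
  have hUB : #(Zᶜ ∩ A) + #(Zᶜ \ A) = #Zᶜ := card_inter_add_card_sdiff _ _
  have hZcompl : #Zᶜ + #Z = n := by rw [card_compl, Nat.sub_add_cancel (card_le_univ Z)]
  have hZA : #(Z ∩ A) ≤ #Z := card_le_card inter_subset_left
  have hUAR : (#(Zᶜ ∩ A) : ℝ) + #(Z ∩ A) = #A := by exact_mod_cast hUA
  have hUBR : (#(Zᶜ ∩ A) : ℝ) + #(Zᶜ \ A) = #Zᶜ := by exact_mod_cast hUB
  have hZcomplR : (#Zᶜ : ℝ) + #Z = n := by exact_mod_cast hZcompl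
  have hZAR : (#(Z ∩ A) : ℝ) ≤ #Z := by exact_mod_cast hZA
  have hγn : γ * n ≤ t / 1000 := by
    have h1 := mul_le_mul_of_nonneg_right hγk' (show (0 : ℝ) ≤ t by positivity)
    rw [hntR]
    linarith
  have hcand : ∀ i < N, ∀ Y ⊆ Zᶜ, #(Y ∩ A) = ∑ j ∈ range i, a j →
      #(Y \ A) = ∑ j ∈ range i, (x - a j) →
      c * (n : ℝ) ^ x ≤ #(typedSets A (Zᶜ \ Y) (a i) (x - a i)) := by
    intro i hi Y hY hYA hYB
    have e1 : #((Zᶜ \ Y) ∩ A) + #(Y ∩ A) = #(Zᶜ ∩ A) := by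
      have : (Zᶜ \ Y) ∩ A = (Zᶜ ∩ A) \ (Y ∩ A) := by ext; simp; tauto
      rw [this]; exact card_sdiff_add_card_eq_card (inter_subset_inter_right hY)
    have e2 : #((Zᶜ \ Y) \ A) + #(Y \ A) = #(Zᶜ \ A) := by
      have : (Zᶜ \ Y) \ A = (Zᶜ \ A) \ (Y \ A) := by ext; simp; tauto
      rw [this]; exact card_sdiff_add_card_eq_card (sdiff_subset_sdiff hY (subset_refl _))
    have e1R : (#((Zᶜ \ Y) ∩ A) : ℝ) + #(Y ∩ A) = #(Zᶜ ∩ A) := by exact_mod_cast e1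
    have e2R : (#((Zᶜ \ Y) \ A) : ℝ) + #(Y \ A) = #(Zᶜ \ A) := by exact_mod_cast e2
    have g1 : 2 * (#(Y ∩ A) : ℝ) ≤ (x + 1) * t + x := by
      have h1 := (hsum i).1
      rw [← hYA] at h1
      have h2 : (b₀ + b₁) * i ≤ (x + 1) * t := Nat.mul_le_mul hbx' (by omega)
      exact_mod_cast h1.trans (by omega)
    have g2 : 2 * (#(Y \ A) : ℝ) ≤ (x + 1) * t + x := by
      have h1 := (hsum i).2
      have h3 := hsum' i
      rw [← hYA, ← hYB] at h3
      rw [← hYA] at h1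
      have h2 : (2 * x - (b₀ + b₁)) * i ≤ (x + 1) * t := Nat.mul_le_mul (by omega) (by omega)
      have h4 : (2 * x - (b₀ + b₁)) * i + (b₀ + b₁) * i = 2 * (i * x) := by
        rw [← add_mul, Nat.sub_add_cancel (by omega)]; ring
      have : 2 * #(Y \ A) ≤ (x + 1) * t + x := by omega
      exact_mod_cast this
    have hkx : (x : ℝ) + 4 ≤ k := by exact_mod_cast (by omega : x + 4 ≤ k)
    have hxt : (x : ℝ) + 1 ≤ t / 100 := by linarith
    have hxkt : (x + 4 : ℝ) * t ≤ n := by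
      have h1 := mul_le_mul_of_nonneg_right hkx (show (0 : ℝ) ≤ t by positivity)
      rw [hntR]
      linarith
    have hai : (a i : ℝ) ≤ x := by exact_mod_cast hax i
    have hai' : ((x - a i : ℕ) : ℝ) ≤ x := by exact_mod_cast Nat.sub_le _ _
    have h3 := le_card_typedSets (A := A) (U := Zᶜ \ Y) (a := a i) (b := x - a i) (y := (t : ℝ))
      (by positivity) (by linarith) (by linarith)
    rw [Nat.add_sub_of_le (hax i)] at h3
    refine le_trans (le_of_eq ?_) h3
    rw [hc, hntR, mul_pow]
    field_simp
  obtain ⟨Q, hQ, hQd, hQs⟩ := exists_disjoint_good_sets (F := F) (k := k) (x := x) (γ := γ) (c := c)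
    card_of_mem_missing hn0 (by omega) hγ hγc hF Zᶜ (fun v hvZ => hv v (mem_compl.1 hvZ)) A Zᶜ a
    hax N hcand
  have hQ' : ∀ i < N, Q i ⊆ Zᶜ ∧ #(Q i ∩ A) = a i ∧ #(Q i) = x ∧ par A (Q i) = β := by
    intro i hi
    have h1 := (hQ i hi).1
    have h2 := card_of_mem_typedSets h1
    rw [mem_typedSets] at h1
    exact ⟨h1.1, h1.2.1, by have := hax i; omega, by rw [par, h1.2.1, haβ]⟩
  have hcnt : ∀ v ∉ Z, #{i ∈ range N | v ∉ Q i ∧ ¬ IsGood F k γ ({v} ∪ Q i)} * q < n := by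
    intro v hvZ
    refine mul_lt_of_two_pow_le hξ.le hξq (show N ≤ n by omega) (hN₁ n (by omega)) ?_
    have h1 := single_le_sum (f := fun v => (2 : ℝ) ^ #{i ∈ range N | v ∉ Q i ∧
      ¬ IsGood F k γ ({v} ∪ Q i)}) (fun _ _ => by positivity) (mem_compl.2 hvZ)
    refine (h1.trans hQs).trans ?_
    gcongr
    rw [div_le_iff₀ hc0]
    linarith
  set W := (range N).biUnion Q with hW
  have hWZ : W ⊆ Zᶜ := biUnion_subset.2 fun i hi => (hQ' i (mem_range.1 hi)).1
  have hWA : #(W ∩ A) = ∑ i ∈ range N, a i := by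
    rw [hW, card_biUnion_inter fun i hi j hj => hQd i (mem_range.1 hi) j (mem_range.1 hj)]
    exact sum_congr rfl fun i hi => (hQ' i (mem_range.1 hi)).2.1
  have hWc : #W = N * x := by
    rw [hW, card_biUnion fun i hi j hj => hQd i (mem_range.1 hi) j (mem_range.1 hj),
      sum_congr rfl fun i hi => (hQ' i (mem_range.1 hi)).2.2.1, sum_const, card_range, smul_eq_mul]
  have hUeq : (Z ∪ W)ᶜ = Zᶜ \ W := by rw [compl_union, sdiff_eq_inter_compl]
  have hMA : #((Z ∪ W)ᶜ ∩ A) + #(W ∩ A) = #(Zᶜ ∩ A) := by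
    have : (Zᶜ \ W) ∩ A = (Zᶜ ∩ A) \ (W ∩ A) := by ext; simp; tauto
    rw [hUeq, this]; exact card_sdiff_add_card_eq_card (inter_subset_inter_right hWZ)
  have hMc : #(Z ∪ W)ᶜ + #W = #Zᶜ := by rw [hUeq]; exact card_sdiff_add_card_eq_card hWZ
  set M := #((Z ∪ W)ᶜ ∩ A) with hM
  have hUc : #(Z ∪ W)ᶜ = l * (N + 1) := by
    have e1 : #Z + (N * x + l * (N + 1)) = n := by
      rw [hZc, hn, ← hs, hk]; ring
    omega
  have hMpar : (M : ZMod 2) = ((N + 1 : ℕ) : ZMod 2) * (τ - β) := by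
    have e1 : (M : ZMod 2) + (#(W ∩ A) : ZMod 2) + (#(Z ∩ A) : ZMod 2) = (#A : ZMod 2) := by
      rw [← hUA, ← hMA]; push_cast; ring
    have e2 : (#(W ∩ A) : ZMod 2) = N * β := by
      rw [hWA, Nat.cast_sum, sum_congr rfl fun i _ => haβ i, sum_const, card_range, nsmul_eq_mul]
    have e3 : (#(Z ∩ A) : ZMod 2) = (#A : ZMod 2) - t * τ + m * τ + β := by
      have := hpar
      rwa [par, par, univ_inter] at this
    have e4 : (t : ZMod 2) = N + 1 + m := by rw [← hs]; push_cast; ring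
    rw [e2, e3, e4] at e1
    push_cast
    linear_combination e1
  have hwx : (k - (b₀ + b₁)) * (N + 1) + (b₀ + b₁) * (N + 1) = k * (N + 1) := by
    rw [← add_mul, Nat.sub_add_cancel (by omega)]
  have hwR : (((k - (b₀ + b₁)) * (N + 1) : ℕ) : ℝ) + (b₀ + b₁) * N + (b₀ + b₁) = k * (N + 1) := by
    have : (((k - (b₀ + b₁)) * (N + 1) : ℕ) : ℝ) + (b₀ + b₁) * (N + 1) = k * (N + 1) := by
      exact_mod_cast hwx
    linarith
  have hnN : (n : ℝ) = k * (N + 1) + k * m := by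
    rw [hntR, ← hs]; push_cast; ring
  have hsumN := hsum N
  rw [← hWA] at hsumN
  have hs3 : 2 * (#(W ∩ A) : ℝ) ≤ (b₀ + b₁) * N + x := by exact_mod_cast hsumN.1
  have hs4 : (b₀ + b₁ : ℝ) * N ≤ 2 * #(W ∩ A) + x := by exact_mod_cast hsumN.2
  have hMR : (M : ℝ) + #(W ∩ A) = #(Zᶜ ∩ A) := by exact_mod_cast hMA
  have hbR : (b₀ + b₁ : ℝ) ≤ x + 1 := by exact_mod_cast hbx'
  have hbR' : (0 : ℝ) ≤ b₀ + b₁ := by positivity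
  have hsR : (N : ℝ) + 1 + m = t := by exact_mod_cast hs
  have hmtR : 2 * (m : ℝ) ≤ t := by exact_mod_cast hmt2
  have hkm : (k : ℝ) * m ≤ γ * n := by
    have : (0 : ℝ) ≤ x := by positivity
    linarith
  have hkx : (x : ℝ) ≤ k := by exact_mod_cast (by omega : x ≤ k)
  have hZA0 : (0 : ℝ) ≤ #(Z ∩ A) := by positivity
  have hkm0 : 0 ≤ (k : ℝ) * m := by positivity
  -- With `w = k - (b₀ + b₁)`, which is within one of `l`, the number `M` is within `(N + 1) / 40`
  -- of `w (N + 1) / 2`.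
  obtain ⟨a₁, a₂, a₃, s₁, s₂, s₃, ha₁, ha₂, ha₃, hα₁, hα₂, hα₃, hss, hMs, hs₁, hs₂, hs₃⟩ :=
    exists_three_types (l := l) (w := k - (b₀ + b₁)) (s := N + 1) (M := M) hl (by omega) (by omega)
      (τ - β) hMpar (by
        have : 40 * (M : ℝ) ≤ 20 * (((k - (b₀ + b₁)) * (N + 1) : ℕ) : ℝ) + (N + 1) := by linarith
        exact_mod_cast this) (by
        have : 20 * (((k - (b₀ + b₁)) * (N + 1) : ℕ) : ℝ) ≤ 40 * (M : ℝ) + (N + 1) := by linarith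
        exact_mod_cast this) (by omega)
  have hbig : ∀ s : ℕ, N + 1 ≤ 10 * s → (n : ℝ) ≤ 20 * k * s := by
    intro s h10
    have : (n : ℝ) ≤ ((20 * k * s : ℕ) : ℝ) := by
      rw [hn]
      have : t ≤ 20 * s := by omega
      exact_mod_cast (Nat.mul_le_mul_right k this).trans (le_of_eq (by ring))
    exact_mod_cast this
  refine hasHamiltonCycle_of_good_sets (q := q) (N := N) (β := β) (τ := τ) (γ := γ) (A := A) hk
    (by omega) hγ.le hq0 hγq le_rfl (by omega) (by omega) h hR₀ hR hgR₀ hgR Q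
    (fun i hi => ⟨(hQ' i hi).2.2.1, (hQ' i hi).2.2.2,
      disjoint_left.2 fun v hv => mem_compl.1 ((hQ' i hi).1 hv), (hQ i hi).2⟩) hQd hcnt hss ha₁ ha₂ ha₃
    (by rw [hα₁]; ring) (by rw [hα₂]; ring) (by rw [hα₃]; ring) (hbig _ hs₁) (hbig _ hs₂)
    (hbig _ hs₃) (by omega) ?_ ?_
  · rw [← hM, hMs]
  · have e1 : M + #((Z ∪ W)ᶜ \ A) = #(Z ∪ W)ᶜ := card_inter_add_card_sdiff _ _
    have e2 : l * (s₁ + s₂ + s₃) = (a₁ * s₁ + a₂ * s₂ + a₃ * s₃) +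
        ((l - a₁) * s₁ + (l - a₂) * s₂ + (l - a₃) * s₃) := by
      zify [ha₁, ha₂, ha₃]; ring
    rw [hss, hMs, ← hUc] at e2
    exact Nat.add_left_cancel (e1.trans e2)


/-! ### Absorbing the exceptional vertices. -/

/-- The possible sizes of an `x`-subset within `A` form an interval. As both classes are met and a
vertex is to spare, it contains two consecutive integers, hence both parities. -/
theorem exists_subset_card_par {V : Type*} [DecidableEq V] {A e : Finset V} {x : ℕ} (hx : 1 ≤ x) (he : x + 1 ≤ #e)
    (hA : 1 ≤ #(e ∩ A)) (hB : 1 ≤ #(e \ A)) (β : ZMod 2) : ∃ R ⊆ e, #R = x ∧ par A R = β := by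
  have hc := card_inter_add_card_sdiff e A
  obtain ⟨a, ha, h1, h2, h3⟩ : ∃ a : ℕ, (a : ZMod 2) = β ∧ a ≤ x ∧ a ≤ #(e ∩ A) ∧ x - a ≤ #(e \ A) := by
    have key : ∀ p < 2, ∃ a : ℕ, a % 2 = p ∧ a ≤ x ∧ a ≤ #(e ∩ A) ∧ x - a ≤ #(e \ A) := by
      intro p hp
      by_cases h : (x - #(e \ A)) % 2 = p
      · exact ⟨x - #(e \ A), by omega⟩
      · exact ⟨x - #(e \ A) + 1, by omega⟩
    rcases zmod_two_cases β with rfl | rfl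
    · simpa only [natCast_zmod_two_eq_zero_iff] using key 0 (by omega)
    · simpa only [natCast_zmod_two_eq_one_iff] using key 1 (by omega)
  obtain ⟨P, hP, hPc⟩ := exists_subset_card_eq h2
  obtain ⟨Q, hQ, hQc⟩ := exists_subset_card_eq h3
  have hQA : Disjoint Q A := disjoint_of_subset_left hQ sdiff_disjoint
  refine ⟨P ∪ Q, union_subset (hP.trans inter_subset_left) (hQ.trans sdiff_subset), ?_, ?_⟩
  · rw [card_union_of_disjoint (hQA.symm.mono_left (hP.trans inter_subset_right))]
    omega
  · rw [par, union_inter_distrib_right, disjoint_iff_inter_eq_empty.1 hQA, union_empty,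
      inter_eq_left.2 (hP.trans inter_subset_right), hPc, ha]

section
variable {V : Type*} [Fintype V] [DecidableEq V]

/-- `H` contains almost all `(l + x)`-sets that meet `A` in `τ` vertices modulo `2`, and there are
many `l`-sets and `x`-sets of both parities. -/
structure IsNearParity (H : Finset (Finset V)) (A : Finset V) (τ : ZMod 2) (l x : ℕ) (γ c : ℝ) :
    Prop where
  uniform : ∀ e ∈ H, #e = l + x
  l_pos : 1 ≤ l
  x_pos : 1 ≤ x
  card_pos : 0 < Fintype.card V
  γ_pos : 0 < γ
  γ_le : γ ≤ c / 6
  missing_le : 2 ^ (l + x) * (#(missing H A τ (l + x)) : ℝ) ≤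
    γ ^ 2 * (Fintype.card V : ℝ) ^ (l + x)
  le_card_l : ∀ α : ZMod 2, c * (Fintype.card V : ℝ) ^ l ≤ #{T : Finset V | #T = l ∧ par A T = α}
  le_card_x : ∀ α : ZMod 2, c * (Fintype.card V : ℝ) ^ x ≤ #{T : Finset V | #T = x ∧ par A T = α}

namespace IsNearParity
variable {H : Finset (Finset V)} {A : Finset V} {τ : ZMod 2} {l x : ℕ} {γ c : ℝ}

theorem c_pos (h : IsNearParity H A τ l x γ c) : 0 < c := by
  have := h.γ_pos
  have := h.γ_le
  linarith

/-- Few `x`-sets fail to be good and few meet a small `Z`, so a family of positive density contains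
a set with neither defect. -/
theorem exists_isGood (h : IsNearParity H A τ l x γ c) {𝒯 : Finset (Finset V)} {c' : ℝ}
    (h𝒯 : ∀ T ∈ 𝒯, #T = x) (hγ : 3 * γ ≤ c') (hc : c' * (Fintype.card V : ℝ) ^ x ≤ #𝒯)
    {Z : Finset V} (hZ : (#Z : ℝ) ≤ c' / 3 * Fintype.card V) :
    ∃ T ∈ 𝒯, Disjoint T Z ∧ IsGood (missing H A τ (l + x)) (l + x) γ T := by
  have hγ0 := h.γ_pos
  have h1 := card_filter_not_isGood_le (F := missing H A τ (l + x)) (k := l + x) (P := ∅) (j := x)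
    card_of_mem_missing h.card_pos hγ0 (by simp) (by
      have : nb (missing H A τ (l + x)) ∅ = missing H A τ (l + x) := by ext; simp [mem_nb]
      rw [this]
      simpa using h.missing_le) 𝒯 h𝒯 (by simp)
  simp only [empty_union] at h1
  obtain ⟨T, hT, hd, hg⟩ := exists_mem_disjoint_not h𝒯 h.x_pos (by linarith) h.card_pos
    (fun T => ¬ IsGood (missing H A τ (l + x)) (l + x) γ T) hc (h1.trans (by
      gcongr
      linarith)) hZ
  exact ⟨T, hT, hd, not_not.1 hg⟩

/-- Among the many `l`-sets of the parity needed for right edges, good ends rule out at most `2γ n ^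
l`. -/
theorem exists_connect (h : IsNearParity H A τ l x γ c) {R R' Z : Finset V} (hR : #R = x)
    (hR' : #R' = x) (hpar : par A R = par A R')
    (hg : IsGood (missing H A τ (l + x)) (l + x) γ R)
    (hg' : IsGood (missing H A τ (l + x)) (l + x) γ R') (hRZ : R ⊆ Z) (hRZ' : R' ⊆ Z)
    (hZ : (#Z : ℝ) ≤ c / 3 * Fintype.card V) :
    ∃ L, #L = l ∧ Disjoint L Z ∧ par A L + par A R' = τ ∧ R ∪ L ∈ H ∧ L ∪ R' ∈ H := by
  set F := missing H A τ (l + x) with hF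
  have key : ∀ R, #R = x → IsGood F (l + x) γ R → (#(nb F R) : ℝ) ≤ γ * (Fintype.card V : ℝ) ^ l := by
    intro R hR hg
    rw [IsGood, hR, Nat.add_sub_cancel] at hg
    exact hg
  have hγ := h.γ_le
  obtain ⟨L, hL, hd, hn⟩ := exists_mem_disjoint_not (j := l) (Z := Z)
    (𝒯 := {T : Finset V | #T = l ∧ par A T = τ - par A R'}) (fun T hT => (mem_filter.1 hT).2.1)
    h.l_pos h.c_pos h.card_pos (fun L => L ∈ nb F R ∪ nb F R') (h.le_card_l _) (by
      have e1 : #{T ∈ ({T : Finset V | #T = l ∧ par A T = τ - par A R'} : Finset _) |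
          T ∈ nb F R ∪ nb F R'} ≤ #(nb F R) + #(nb F R') :=
        (card_le_card fun T hT => (mem_filter.1 hT).2).trans (card_union_le _ _)
      have e2 : (#{T ∈ ({T : Finset V | #T = l ∧ par A T = τ - par A R'} : Finset _) |
          T ∈ nb F R ∪ nb F R'} : ℝ) ≤ #(nb F R) + #(nb F R') := by exact_mod_cast e1
      have e3 := key R hR hg
      have e4 := key R' hR' hg'
      have e5 : 2 * γ * (Fintype.card V : ℝ) ^ l ≤ c / 3 * (Fintype.card V : ℝ) ^ l := by
        gcongr
        linarith
      linarith) hZ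
  obtain ⟨-, hLc, hLp⟩ := mem_filter.1 hL
  have hdR : Disjoint L R := hd.mono_right hRZ
  have hdR' : Disjoint L R' := hd.mono_right hRZ'
  rw [mem_union, mem_nb, mem_nb, hF, mem_missing, mem_missing, card_union_of_disjoint hdR.symm,
    card_union_of_disjoint hdR'.symm, par_union hdR.symm, par_union hdR'.symm, hLc, hLp, hR, hR',
    hpar] at hn
  push Not at hn
  have hp : par A R' + (τ - par A R') = τ := by ring
  refine ⟨L, hLc, hd, by rw [hLp]; ring, hn.1 hdR.symm (add_comm _ _) hp, ?_⟩
  rw [union_comm]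
  exact hn.2 hdR'.symm (add_comm _ _) hp

/-- A path with good end can be extended to contain a vertex that lies in many suitable sets. -/
theorem exists_absorb (h : IsNearParity H A τ l x γ c) (hl : 2 ≤ l) {β : ZMod 2} {c' : ℝ}
    (hc' : 3 * γ ≤ c') (hcc' : c' ≤ c) {v : V}
    (hv : ∃ 𝓛 : Finset (Finset V), c' * (Fintype.card V : ℝ) ^ (l - 1) ≤ #𝓛 ∧ ∀ L ∈ 𝓛, v ∈ L ∧
      #L = l ∧ par A L = τ - β ∧ c' * (Fintype.card V : ℝ) ^ x ≤ #{R ∈ nb H L | par A R = β})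
    {R₀ R Z : Finset V} {m : ℕ} (hp : LRPath H l x R₀ R Z m) (hR : par A R = β)
    (hg : IsGood (missing H A τ (l + x)) (l + x) γ R)
    (hZ : (#Z : ℝ) + 2 * (l + x) ≤ c' / 3 * Fintype.card V) :
    ∃ R' Z' m', LRPath H l x R₀ R' Z' m' ∧ Z ⊆ Z' ∧ v ∈ Z' ∧ #Z' ≤ #Z + 2 * (l + x) ∧
      par A R' = β ∧ IsGood (missing H A τ (l + x)) (l + x) γ R' ∧
      par A Z' - m' * τ = par A Z - m * τ := by
  by_cases hvZ : v ∈ Z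
  · exact ⟨R, Z, m, hp, subset_refl _, hvZ, by omega, hR, hg, rfl⟩
  have hc0 : 0 < c' := by have := h.γ_pos; linarith
  obtain ⟨𝓛, h𝓛c, h𝓛⟩ := hv
  have hinj : Set.InjOn (fun L : Finset V => L.erase v) 𝓛 := by
    intro L hL L' hL' heq
    have heq' : L.erase v = L'.erase v := heq
    rw [← insert_erase (h𝓛 L hL).1, heq', insert_erase (h𝓛 L' hL').1]
  -- With `v` removed, the sets are compared with `n ^ (l - 1)`, so one can be chosen to avoid `Z`.
  -- The path continues by `L₁, R₁, L₂, R₂` with `v ∈ L₂`, where `R₁` and `R₂` are good neighbours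
  -- of `L₂`.
  obtain ⟨Le, hLe, hdLe, -⟩ := exists_mem_disjoint_not (𝒯 := 𝓛.image fun L => L.erase v)
    (j := l - 1) (Z := Z) (c := c') (by
      intro T hT
      obtain ⟨L, hL, rfl⟩ := mem_image.1 hT
      rw [card_erase_of_mem (h𝓛 L hL).1, (h𝓛 L hL).2.1]) (by omega) hc0 h.card_pos
    (fun _ => False) (by rw [card_image_of_injOn hinj]; exact h𝓛c) (by
      simp only [filter_false, card_empty, Nat.cast_zero]; positivity) (by
      have : (0 : ℝ) ≤ 2 * (l + x) := by positivity
      linarith)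
  obtain ⟨L₂, hL₂, rfl⟩ := mem_image.1 hLe
  obtain ⟨hvL, hL₂c, hL₂p, hL₂R⟩ := h𝓛 L₂ hL₂
  have hL₂Z : Disjoint L₂ Z := by
    rw [← insert_erase hvL, disjoint_insert_left]
    exact ⟨hvZ, hdLe⟩
  have hcards : ∀ T ∈ ({R ∈ nb H L₂ | par A R = β} : Finset _), #T = x := by
    intro T hT
    have := card_of_mem_nb h.uniform (mem_filter.1 hT).1
    omega
  have hZ1 : (#(L₂ ∪ Z) : ℝ) ≤ #Z + l := by
    rw [card_union_of_disjoint hL₂Z, hL₂c]; push_cast; linarith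
  obtain ⟨R₂, hR₂, hR₂d, hR₂g⟩ := h.exists_isGood hcards hc' hL₂R (Z := L₂ ∪ Z) (by
    have : (0 : ℝ) ≤ l + 2 * x := by positivity
    linarith)
  have hR₂c := hcards R₂ hR₂
  obtain ⟨hR₂n, hR₂p⟩ := mem_filter.1 hR₂
  have hZ2 : (#(R₂ ∪ (L₂ ∪ Z)) : ℝ) ≤ #Z + l + x := by
    rw [card_union_of_disjoint hR₂d, hR₂c]; push_cast; linarith
  obtain ⟨R₁, hR₁, hR₁d, hR₁g⟩ := h.exists_isGood hcards hc' hL₂R (Z := R₂ ∪ (L₂ ∪ Z)) (by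
    have : (0 : ℝ) ≤ l + x := by positivity
    linarith)
  have hR₁c := hcards R₁ hR₁
  obtain ⟨hR₁n, hR₁p⟩ := mem_filter.1 hR₁
  have hZ3 : (#(R₁ ∪ (R₂ ∪ (L₂ ∪ Z))) : ℝ) ≤ #Z + l + 2 * x := by
    rw [card_union_of_disjoint hR₁d, hR₁c]; push_cast; linarith
  obtain ⟨L₁, hL₁c, hL₁d, hL₁p, hL₁e, hL₁e'⟩ := h.exists_connect hp.card_end hR₁c
    (hR.trans hR₁p.symm) hg hR₁g (Z := R₁ ∪ (R₂ ∪ (L₂ ∪ Z)))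
    (hp.end_subset.trans fun v hv => by simp [hv]) subset_union_left (by
      have : (0 : ℝ) ≤ l := by positivity
      have : c' / 3 * (Fintype.card V : ℝ) ≤ c / 3 * Fintype.card V := by gcongr
      linarith)
  simp only [disjoint_union_right] at hL₁d hR₁d hR₂d
  obtain ⟨d1, d2, d3, d4⟩ := hL₁d
  obtain ⟨d5, d6, d7⟩ := hR₁d
  obtain ⟨d8, d9⟩ := hR₂d
  rw [mem_nb] at hR₁n hR₂n
  have dA : Disjoint (L₁ ∪ R₁) Z := disjoint_union_left.2 ⟨d4, d7⟩
  have dB : Disjoint (L₂ ∪ R₂) (Z ∪ (L₁ ∪ R₁)) := by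
    simp only [disjoint_union_left, disjoint_union_right]
    exact ⟨⟨hL₂Z, d9⟩, ⟨d3.symm, d2.symm⟩, d6.symm, d5.symm⟩
  refine ⟨R₂, _, _, (hp.snoc hL₁c hR₁c d1 dA hL₁e hL₁e').snoc hL₂c hR₂c d8.symm dB
    (by rw [union_comm]; exact hR₁n.2) hR₂n.2, fun v hv => by simp [hv], by simp [hvL], ?_, hR₂p,
    hR₂g, ?_⟩
  · refine (card_union_le _ _).trans ?_
    have e1 := card_union_le Z (L₁ ∪ R₁)
    have e2 := card_union_le L₁ R₁
    have e3 := card_union_le L₂ R₂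
    omega
  · rw [par_union dB.symm, par_union dA.symm, par_union d1, par_union d8.symm, hR₂p, hL₂p, hL₁p]
    push_cast
    ring

/-- Vertices are absorbed one at a time by right edges, which keeps `par A Z - m * τ` invariant.
This is the quantity that decides whether the path can be completed. -/
theorem exists_absorb_set (h : IsNearParity H A τ l x γ c) (hl : 2 ≤ l) {β : ZMod 2} {c' : ℝ}
    (hc' : 3 * γ ≤ c') (hcc' : c' ≤ c) (X : Finset V)
    (hX : ∀ v ∈ X, ∃ 𝓛 : Finset (Finset V), c' * (Fintype.card V : ℝ) ^ (l - 1) ≤ #𝓛 ∧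
      ∀ L ∈ 𝓛, v ∈ L ∧ #L = l ∧ par A L = τ - β ∧
        c' * (Fintype.card V : ℝ) ^ x ≤ #{R ∈ nb H L | par A R = β})
    {R₀ R Z : Finset V} {m : ℕ} (hp : LRPath H l x R₀ R Z m) (hR : par A R = β)
    (hg : IsGood (missing H A τ (l + x)) (l + x) γ R)
    (hZ : (#Z : ℝ) + 2 * (l + x) * #X ≤ c' / 3 * Fintype.card V) :
    ∃ R' Z' m', LRPath H l x R₀ R' Z' m' ∧ Z ⊆ Z' ∧ X ⊆ Z' ∧ #Z' ≤ #Z + 2 * (l + x) * #X ∧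
      par A R' = β ∧ IsGood (missing H A τ (l + x)) (l + x) γ R' ∧
      par A Z' - m' * τ = par A Z - m * τ := by
  induction X using Finset.induction_on with
  | empty => exact ⟨R, Z, m, hp, subset_refl _, empty_subset _, by simp, hR, hg, rfl⟩
  | insert v X hv ih =>
    rw [card_insert_of_notMem hv] at hZ
    push_cast at hZ
    have h0 : (0 : ℝ) ≤ 2 * (l + x) := by positivity
    obtain ⟨R', Z', m', hp', hZZ, hXZ, hZc, hR', hg', hpar⟩ :=
      ih (fun v hv => hX v (mem_insert_of_mem hv)) (by linarith)
    have hZcR : (#Z' : ℝ) ≤ #Z + 2 * (l + x) * #X := by exact_mod_cast hZc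
    obtain ⟨R'', Z'', m'', hp'', hZZ', hvZ, hZc', hR'', hg'', hpar'⟩ :=
      h.exists_absorb hl hc' hcc' (hX v (mem_insert_self _ _)) hp' hR' hg' (by linarith)
    refine ⟨R'', Z'', m'', hp'', hZZ.trans hZZ', insert_subset hvZ (hXZ.trans hZZ'), ?_, hR'', hg'',
      hpar'.trans hpar⟩
    rw [card_insert_of_notMem hv]
    linarith

end IsNearParity

/-- A vertex in many edges of the right parity lies in many `l`-sets with many neighbours of a
given parity. -/
theorem exists_many_sets {H : Finset (Finset V)} {A : Finset V} {τ : ZMod 2} {l x : ℕ} {c : ℝ}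
    (hH : ∀ e ∈ H, #e = l + x) (hl : 2 ≤ l) (hx : 1 ≤ x) (hn : 0 < Fintype.card V) (hc : 0 ≤ c)
    {v : V}
    (hv : 2 * c * (Fintype.card V : ℝ) ^ (l + x - 1) ≤ #{e ∈ H | v ∈ e ∧ par A e = τ ∧
      1 ≤ #(e.erase v ∩ A) ∧ 1 ≤ #(e.erase v \ A)}) (β : ZMod 2) :
    ∃ 𝓛 : Finset (Finset V), c * (Fintype.card V : ℝ) ^ (l - 1) ≤ #𝓛 ∧
      ∀ L ∈ 𝓛, v ∈ L ∧ #L = l ∧ par A L = τ - β ∧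
        c * (Fintype.card V : ℝ) ^ x ≤ #{R ∈ nb H L | par A R = β} := by
  classical
  set n := Fintype.card V
  set E := ({e ∈ H | v ∈ e ∧ par A e = τ ∧
      1 ≤ #(e.erase v ∩ A) ∧ 1 ≤ #(e.erase v \ A)} : Finset _) with hE
  set 𝓐 : Finset (Finset V) := {L | v ∈ L ∧ #L = l ∧ par A L = τ - β} with h𝓐
  set d : Finset V → ℕ := fun L => #{R ∈ nb H L | par A R = β} with hd
  -- Every edge counted by `E` splits into an `l`-set containing `v` and an `x`-set of parity `β`.
  have h1 : #E ≤ ∑ L ∈ 𝓐, d L := by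
    have : E ⊆ 𝓐.biUnion fun L => ({R ∈ nb H L | par A R = β} : Finset _).image fun R => L ∪ R := by
      intro e he
      obtain ⟨heH, hve, hp, hA, hB⟩ := mem_filter.1 he
      have hec := hH e heH
      obtain ⟨R, hRe, hRc, hRp⟩ := exists_subset_card_par hx
        (by rw [card_erase_of_mem hve]; omega) hA hB β
      have hRe' : R ⊆ e := hRe.trans (erase_subset _ _)
      have hun : e \ R ∪ R = e := sdiff_union_of_subset hRe'
      have hpp : par A (e \ R) + par A R = τ := by
        rw [← par_union sdiff_disjoint, hun, hp]
      refine mem_biUnion.2 ⟨e \ R, mem_filter.2 ⟨mem_univ _, ?_, ?_, ?_⟩, mem_image.2 ⟨R, ?_, hun⟩⟩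
      · exact mem_sdiff.2 ⟨hve, fun h => by simpa using hRe h⟩
      · rw [card_sdiff_of_subset hRe']; omega
      · rw [← hRp, ← hpp]; ring
      · exact mem_filter.2 ⟨mem_nb.2 ⟨sdiff_disjoint, by rw [hun]; exact heH⟩, hRp⟩
    exact (card_le_card this).trans (card_biUnion_le.trans (sum_le_sum fun L _ => card_image_le))
  have hAc : (#𝓐 : ℝ) ≤ (n : ℝ) ^ (l - 1) := by
    have := card_filter_mem_le (𝒯 := ({L | #L = l} : Finset (Finset V))) (j := l)
      (fun T hT => (mem_filter.1 hT).2) v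
    have h2 : #𝓐 ≤ #{T ∈ ({L | #L = l} : Finset (Finset V)) | v ∈ T} := by
      refine card_le_card fun L hL => ?_
      obtain ⟨-, e1, e2, -⟩ := mem_filter.1 hL
      exact mem_filter.2 ⟨mem_filter.2 ⟨mem_univ _, e2⟩, e1⟩
    exact_mod_cast h2.trans this
  -- At most `n ^ (l - 1)` sets with fewer than `c n ^ x` neighbours cover at most half of the lower
  -- bound for `E`; the others have at most `n ^ x` neighbours each.
  refine ⟨{L ∈ 𝓐 | c * (n : ℝ) ^ x ≤ d L}, ?_, ?_⟩
  · have h2 : ∀ L ∈ 𝓐, (d L : ℝ) ≤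
        (if c * (n : ℝ) ^ x ≤ d L then (n : ℝ) ^ x else 0) + c * (n : ℝ) ^ x := by
      intro L hL
      obtain ⟨-, -, e2, -⟩ := mem_filter.1 hL
      split_ifs with h
      · have : d L ≤ n ^ x := (card_filter_le _ _).trans
          (card_nb_le hH (by rw [e2]))
        have h' : (d L : ℝ) ≤ (n : ℝ) ^ x := by exact_mod_cast this
        have : 0 ≤ c * (n : ℝ) ^ x := by positivity
        linarith
      · push Not at h
        linarith
    have h3 : (∑ L ∈ 𝓐, (d L : ℝ)) ≤
        #{L ∈ 𝓐 | c * (n : ℝ) ^ x ≤ d L} * (n : ℝ) ^ x + #𝓐 * (c * (n : ℝ) ^ x) := by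
      refine (sum_le_sum h2).trans (le_of_eq ?_)
      rw [sum_add_distrib, ← sum_filter, sum_const, sum_const, nsmul_eq_mul, nsmul_eq_mul]
    have h4 : (#E : ℝ) ≤ ∑ L ∈ 𝓐, (d L : ℝ) := by exact_mod_cast h1
    have h5 : (#𝓐 : ℝ) * (c * (n : ℝ) ^ x) ≤ (n : ℝ) ^ (l - 1) * (c * (n : ℝ) ^ x) := by gcongr
    have h6 : (n : ℝ) ^ (l + x - 1) = (n : ℝ) ^ (l - 1) * (n : ℝ) ^ x := by
      rw [← pow_add]; congr 1; omega
    rw [h6] at hv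
    have h7 : (0 : ℝ) < (n : ℝ) ^ x := by
      have : (0 : ℝ) < n := by exact_mod_cast hn
      positivity
    refine le_of_mul_le_mul_right (a := (n : ℝ) ^ x) ?_ h7
    nlinarith
  · intro L hL
    obtain ⟨hL, hdL⟩ := mem_filter.1 hL
    obtain ⟨-, e1, e2, e3⟩ := mem_filter.1 hL
    exact ⟨e1, e2, e3, hdL⟩

end


/-! ### Short paths that shift the parity. -/

theorem zmod_two_ne_iff {a b : ZMod 2} : a ≠ b ↔ a = b + 1 := by
  revert a b; decide

theorem half_le_card_filter {V : Type*} {𝒯 : Finset (Finset V)} {p : Finset V → Prop} [DecidablePred p] {y : ℝ}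
    (h : 2 * y ≤ #𝒯) (hn : ¬ y ≤ #{T ∈ 𝒯 | ¬ p T}) : y ≤ #{T ∈ 𝒯 | p T} := by
  have : (#{T ∈ 𝒯 | p T} : ℝ) + #{T ∈ 𝒯 | ¬ p T} = #𝒯 := by
    exact_mod_cast card_filter_add_card_filter_not p
  linarith

section
variable {V : Type*} [Fintype V] [DecidableEq V]

/-- There is a short path with good ends whose parity is shifted by one. -/
def HasShiftPath (H : Finset (Finset V)) (A : Finset V) (τ : ZMod 2) (l x : ℕ) (γ : ℝ) : Prop :=
  ∃ R₀ R Z m, m ≤ 5 ∧ LRPath H l x R₀ R Z m ∧ par A R = par A R₀ ∧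
    IsGood (missing H A τ (l + x)) (l + x) γ R₀ ∧ IsGood (missing H A τ (l + x)) (l + x) γ R ∧
    par A Z = 1 + m * τ + par A R₀

/-- Every `l`-set has a good neighbour of the right parity that avoids a given set of at most `z`
vertices. -/
def ExtendsRight (H : Finset (Finset V)) (A : Finset V) (τ : ZMod 2) (l x z : ℕ) (γ : ℝ) : Prop :=
  ∀ S : Finset V, #S = l → ∀ Z : Finset V, #Z ≤ z → ∃ R, #R = x ∧ Disjoint R S ∧ Disjoint R Z ∧
    par A R = τ - par A S ∧ S ∪ R ∈ H ∧ R ∪ S ∈ H ∧ IsGood (missing H A τ (l + x)) (l + x) γ R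

/-- Every `x`-set has a neighbour of the right parity that avoids a given set of at most `z`
vertices. -/
def ExtendsLeft (H : Finset (Finset V)) (A : Finset V) (τ : ZMod 2) (l x z : ℕ) : Prop :=
  ∀ S : Finset V, #S = x → ∀ Z : Finset V, #Z ≤ z → ∃ L, #L = l ∧ Disjoint L S ∧ Disjoint L Z ∧
    par A L = τ - par A S ∧ S ∪ L ∈ H ∧ L ∪ S ∈ H

variable {H : Finset (Finset V)} {A : Finset V} {τ : ZMod 2} {l x z : ℕ} {γ : ℝ}

/-- A path of right edges has `par A Z = m * τ + par A R₀`, so one wrong edge among the `L ∪ R'`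
that follow `R₀` gives the shift. A wrong edge of the other matching is needed to return to the
parity of `R₀`. Here the path is `R, L, R'` with both edges wrong. -/
theorem hasShiftPath_of_pair {L R R' : Finset V} (hL : #L = l) (hR : #R = x) (hR' : #R' = x)
    (h₁ : Disjoint L R) (h₂ : Disjoint L R') (h₃ : Disjoint R R') (e₁ : L ∪ R ∈ H)
    (e₂ : L ∪ R' ∈ H) (p₁ : par A L + par A R = τ + 1) (p₂ : par A L + par A R' = τ + 1)
    (hg : IsGood (missing H A τ (l + x)) (l + x) γ R)
    (hg' : IsGood (missing H A τ (l + x)) (l + x) γ R') : HasShiftPath H A τ l x γ := by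
  have hd : Disjoint (L ∪ R') R := disjoint_union_left.2 ⟨h₁, h₃.symm⟩
  refine ⟨R, R', _, _, by omega, (LRPath.base hR).snoc hL hR' h₂ hd (by rwa [union_comm]) e₂,
    by linear_combination p₂ - p₁, hg, hg', ?_⟩
  rw [par_union hd.symm, par_union h₂]
  push_cast
  linear_combination p₂

/-- The wrong edges `L ∪ R` and `R ∪ L'` are extended by right edges at both sides to the path `R₀,
L, R, L', R₁`, whose ends are good. -/
theorem hasShiftPath_of_left (hr : ExtendsRight H A τ l x (4 * (l + x)) γ) {R L L' : Finset V}
    (hR : #R = x) (hL : #L = l) (hL' : #L' = l) (h₁ : Disjoint L R) (h₂ : Disjoint L' R)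
    (h₃ : Disjoint L L') (e₁ : L ∪ R ∈ H) (e₂ : R ∪ L' ∈ H) (p₁ : par A L + par A R = τ + 1)
    (p₂ : par A L' + par A R = τ + 1) : HasShiftPath H A τ l x γ := by
  have z₀ : #(R ∪ (L ∪ L')) ≤ x + 2 * l := by
    have := card_union_le R (L ∪ L')
    have := card_union_le L L'
    omega
  obtain ⟨R₀, c₀, -, d₀, p₀, -, f₀, g₀⟩ := hr L hL (R ∪ (L ∪ L')) (by omega)
  have z₁ := card_union_le R₀ (R ∪ (L ∪ L'))
  obtain ⟨R₁, c₁, -, d₁, q₁, f₁, -, g₁⟩ := hr L' hL' (R₀ ∪ (R ∪ (L ∪ L'))) (by omega)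
  simp only [disjoint_union_right] at d₀ d₁
  obtain ⟨a1, a2, a3⟩ := d₀
  obtain ⟨b0, b1, b2, b3⟩ := d₁
  have dA : Disjoint (L ∪ R) R₀ := disjoint_union_left.2 ⟨a2.symm, a1.symm⟩
  have dB : Disjoint (L' ∪ R₁) (R₀ ∪ (L ∪ R)) := by
    simp only [disjoint_union_left, disjoint_union_right]
    and_intros <;> first | assumption | (apply Disjoint.symm; assumption)
  refine ⟨R₀, R₁, _, _, by omega, ((LRPath.base c₀).snoc hL hR h₁ dA f₀ e₁).snoc hL' c₁ b3.symm dB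
    e₂ f₁, by linear_combination q₁ - p₀ + p₁ - p₂, g₀, g₁, ?_⟩
  rw [par_union dB.symm, par_union dA.symm, par_union h₁, par_union b3.symm]
  push_cast
  linear_combination q₁ + p₁

/-- The path is `R₃, L₁, R, L, R', L₂, R₄`: two right edges at each side lead from the given sets to
good ends. -/
theorem hasShiftPath_of_inter (hr : ExtendsRight H A τ l x (8 * (l + x)) γ)
    (hl : ExtendsLeft H A τ l x (8 * (l + x))) {L R R' : Finset V} (hL : #L = l) (hR : #R = x)
    (hR' : #R' = x) (h₁ : Disjoint L R) (h₂ : Disjoint L R') (h₃ : Disjoint R R')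
    (e₁ : R ∪ L ∈ H) (e₂ : L ∪ R' ∈ H) (p₁ : par A L + par A R = τ + 1)
    (p₂ : par A L + par A R' = τ + 1) : HasShiftPath H A τ l x γ := by
  have z₀ : #(L ∪ (R ∪ R')) ≤ l + 2 * x := by
    have := card_union_le L (R ∪ R')
    have := card_union_le R R'
    omega
  obtain ⟨L₁, c₁, -, d₁, q₁, -, f₁⟩ := hl R hR (L ∪ (R ∪ R')) (by omega)
  have z₁ := card_union_le L₁ (L ∪ (R ∪ R'))
  obtain ⟨L₂, c₂, -, d₂, q₂, f₂, -⟩ := hl R' hR' (L₁ ∪ (L ∪ (R ∪ R'))) (by omega)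
  have z₂ := card_union_le L₂ (L₁ ∪ (L ∪ (R ∪ R')))
  obtain ⟨R₃, c₃, -, d₃, q₃, -, f₃, g₃⟩ := hr L₁ c₁ (L₂ ∪ (L₁ ∪ (L ∪ (R ∪ R')))) (by omega)
  have z₃ := card_union_le R₃ (L₂ ∪ (L₁ ∪ (L ∪ (R ∪ R'))))
  obtain ⟨R₄, c₄, -, d₄, q₄, f₄, -, g₄⟩ := hr L₂ c₂ (R₃ ∪ (L₂ ∪ (L₁ ∪ (L ∪ (R ∪ R'))))) (by omega)
  simp only [disjoint_union_right] at d₁ d₂ d₃ d₄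
  obtain ⟨d11, d12, d13⟩ := d₁
  obtain ⟨d21, d22, d23, d24⟩ := d₂
  obtain ⟨d31, d32, d33, d34, d35⟩ := d₃
  obtain ⟨d41, d42, d43, d44, d45, d46⟩ := d₄
  have dA : Disjoint (L₁ ∪ R) R₃ := by
    simp only [disjoint_union_left]
    and_intros <;> first | assumption | (apply Disjoint.symm; assumption)
  have dB : Disjoint (L ∪ R') (R₃ ∪ (L₁ ∪ R)) := by
    simp only [disjoint_union_left, disjoint_union_right]
    and_intros <;> first | assumption | (apply Disjoint.symm; assumption)
  have dC : Disjoint (L₂ ∪ R₄) ((R₃ ∪ (L₁ ∪ R)) ∪ (L ∪ R')) := by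
    simp only [disjoint_union_left, disjoint_union_right]
    and_intros <;> first | assumption | (apply Disjoint.symm; assumption)
  refine ⟨R₃, R₄, _, _, by omega, (((LRPath.base c₃).snoc c₁ hR d12 dA f₃ f₁).snoc hL hR' h₂ dB
    e₁ e₂).snoc c₂ c₄ d42.symm dC f₂ f₄, by linear_combination q₄ - q₃ - q₂ + q₁ + p₂ - p₁, g₃, g₄,
    ?_⟩
  rw [par_union dC.symm, par_union dB.symm, par_union dA.symm, par_union h₂, par_union d12,
    par_union d42.symm]
  push_cast
  linear_combination q₁ + p₂ + q₄

/-- The path is `R₃, L₁, R₁, L₃, R₄, L₅, R₆, L₄, R₂, L₂, R₅`. The second wrong edge is traversed in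
the opposite direction, so the two wrong edges belong to different matchings. Equal parity of `L₁`
and `L₂` makes the joint between `R₄` and `R₆` possible and the ends equal in parity. -/
theorem hasShiftPath_of_disjoint (hr : ExtendsRight H A τ l x (8 * (l + x)) γ)
    (hl : ExtendsLeft H A τ l x (8 * (l + x)))
    (hc : ∀ R R' Z : Finset V, #R = x → #R' = x → par A R = par A R' →
      IsGood (missing H A τ (l + x)) (l + x) γ R → IsGood (missing H A τ (l + x)) (l + x) γ R' →
      R ⊆ Z → R' ⊆ Z → #Z ≤ 8 * (l + x) →
      ∃ L, #L = l ∧ Disjoint L Z ∧ par A L + par A R' = τ ∧ R ∪ L ∈ H ∧ L ∪ R' ∈ H)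
    {L₁ R₁ L₂ R₂ : Finset V}
    (a₁ : #L₁ = l) (a₂ : #L₂ = l) (b₁ : #R₁ = x) (b₂ : #R₂ = x)
    (h₁ : Disjoint L₁ R₁) (h₂ : Disjoint L₂ R₂) (k₁ : Disjoint L₁ L₂) (k₂ : Disjoint L₁ R₂)
    (k₃ : Disjoint R₁ L₂) (k₄ : Disjoint R₁ R₂) (e₁ : L₁ ∪ R₁ ∈ H) (e₂ : R₂ ∪ L₂ ∈ H)
    (p₁ : par A L₁ + par A R₁ = τ + 1) (p₂ : par A L₂ + par A R₂ = τ + 1)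
    (p : par A L₁ = par A L₂) : HasShiftPath H A τ l x γ := by
  set Z₀ := L₁ ∪ (R₁ ∪ (L₂ ∪ R₂)) with hZ₀
  have z₀ : #Z₀ ≤ 2 * (l + x) := by
    rw [hZ₀]
    have := card_union_le L₁ (R₁ ∪ (L₂ ∪ R₂))
    have := card_union_le R₁ (L₂ ∪ R₂)
    have := card_union_le L₂ R₂
    omega
  obtain ⟨L₃, c₃, -, d₃, q₃, f₃, f₃'⟩ := hl R₁ b₁ Z₀ (by omega)
  have z₃ := card_union_le L₃ Z₀
  obtain ⟨L₄, c₄, -, d₄, q₄, f₄, f₄'⟩ := hl R₂ b₂ (L₃ ∪ Z₀) (by omega)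
  have z₄ := card_union_le L₄ (L₃ ∪ Z₀)
  obtain ⟨R₃, c₅, -, d₅, q₅, -, f₅, g₅⟩ := hr L₁ a₁ (L₄ ∪ (L₃ ∪ Z₀)) (by omega)
  have z₅ := card_union_le R₃ (L₄ ∪ (L₃ ∪ Z₀))
  obtain ⟨R₅, c₆, -, d₆, q₆, f₆, -, g₆⟩ := hr L₂ a₂ (R₃ ∪ (L₄ ∪ (L₃ ∪ Z₀))) (by omega)
  have z₆ := card_union_le R₅ (R₃ ∪ (L₄ ∪ (L₃ ∪ Z₀)))
  obtain ⟨R₄, c₇, -, d₇, q₇, f₇, -, g₇⟩ := hr L₃ c₃ (R₅ ∪ (R₃ ∪ (L₄ ∪ (L₃ ∪ Z₀)))) (by omega)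
  have z₇ := card_union_le R₄ (R₅ ∪ (R₃ ∪ (L₄ ∪ (L₃ ∪ Z₀))))
  obtain ⟨R₆, c₈, -, d₈, q₈, -, f₈, g₈⟩ := hr L₄ c₄ (R₄ ∪ (R₅ ∪ (R₃ ∪ (L₄ ∪ (L₃ ∪ Z₀))))) (by omega)
  have z₈ := card_union_le R₆ (R₄ ∪ (R₅ ∪ (R₃ ∪ (L₄ ∪ (L₃ ∪ Z₀)))))
  obtain ⟨L₅, c₉, d₉, q₉, f₉, f₉'⟩ := hc R₄ R₆ (R₆ ∪ (R₄ ∪ (R₅ ∪ (R₃ ∪ (L₄ ∪ (L₃ ∪ Z₀))))))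
    c₇ c₈ (by linear_combination q₇ - q₈ - q₃ + q₄ + p₁ - p₂ - p) g₇ g₈
    (subset_union_left.trans subset_union_right) subset_union_left (by omega)
  simp only [hZ₀, disjoint_union_right] at d₃ d₄ d₅ d₆ d₇ d₈ d₉
  obtain ⟨d31, d32, d33, d34⟩ := d₃
  obtain ⟨d40, d41, d42, d43, d44⟩ := d₄
  obtain ⟨d50, d51, d52, d53, d54, d55⟩ := d₅
  obtain ⟨d60, d61, d62, d63, d64, d65, d66⟩ := d₆
  obtain ⟨d70, d71, d72, d73, d74, d75, d76, d77⟩ := d₇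
  obtain ⟨d80, d81, d82, d83, d84, d85, d86, d87, d88⟩ := d₈
  obtain ⟨d90, d91, d92, d93, d94, d95, d96, d97, d98, d99⟩ := d₉
  have dA : Disjoint (L₁ ∪ R₁) R₃ := by
    simp only [disjoint_union_left]
    and_intros <;> first | assumption | (apply Disjoint.symm; assumption)
  have dB : Disjoint (L₃ ∪ R₄) (R₃ ∪ (L₁ ∪ R₁)) := by
    simp only [disjoint_union_left, disjoint_union_right]
    and_intros <;> first | assumption | (apply Disjoint.symm; assumption)
  have dC : Disjoint (L₅ ∪ R₆) ((R₃ ∪ (L₁ ∪ R₁)) ∪ (L₃ ∪ R₄)) := by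
    simp only [disjoint_union_left, disjoint_union_right]
    and_intros <;> assumption
  have dD : Disjoint (L₄ ∪ R₂) (((R₃ ∪ (L₁ ∪ R₁)) ∪ (L₃ ∪ R₄)) ∪ (L₅ ∪ R₆)) := by
    simp only [disjoint_union_left, disjoint_union_right]
    and_intros <;> first | assumption | (apply Disjoint.symm; assumption)
  have dE : Disjoint (L₂ ∪ R₅) ((((R₃ ∪ (L₁ ∪ R₁)) ∪ (L₃ ∪ R₄)) ∪ (L₅ ∪ R₆)) ∪ (L₄ ∪ R₂)) := by
    simp only [disjoint_union_left, disjoint_union_right]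
    and_intros <;> first | assumption | (apply Disjoint.symm; assumption)
  refine ⟨R₃, R₅, _, _, by omega, (((((LRPath.base c₅).snoc a₁ b₁ h₁ dA f₅ e₁).snoc c₃ c₇
    d73.symm dB f₃ f₇).snoc c₉ c₈ d90 dC f₉ f₉').snoc c₄ b₂ d44 dD f₈ f₄').snoc a₂ c₆ d65.symm dE
    e₂ f₆, by linear_combination q₆ - q₅ + p, g₅, g₆, ?_⟩
  rw [par_union dE.symm, par_union dD.symm, par_union dC.symm, par_union dB.symm,
    par_union dA.symm, par_union h₁, par_union d73.symm, par_union d90, par_union d44,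
    par_union d65.symm]
  push_cast
  linear_combination p₁ + q₇ + q₉ + q₄ + q₆


/-- An `l`-set or an `x`-set with many wrong neighbours gives two wrong edges sharing it. Otherwise
every such set has many right neighbours, so any two wrong edges in suitable position can be
extended to a path with good ends. The intersection theorem provides such a pair. -/
theorem exists_hasShiftPath {l x : ℕ} (hx : 1 ≤ x) (hxl : x ≤ l) {c : ℝ} (hc : 0 < c) :
    ∃ N₀ : ℕ, ∀ (V : Type*) [Fintype V] [DecidableEq V] (H : Finset (Finset V)) (A : Finset V)
      (τ : ZMod 2) (γ : ℝ) (i : ℕ), IsNearParity H A τ l x γ c → N₀ ≤ Fintype.card V →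
      (∀ S : Finset V, #S = l → c * (Fintype.card V : ℝ) ^ x ≤ #(nb H S)) →
      (∀ S : Finset V, #S = x → c * (Fintype.card V : ℝ) ^ l ≤ #(nb H S)) →
      c * (Fintype.card V : ℝ) ^ l ≤ #{S : Finset V | #S = l ∧ #(S ∩ A) = i} →
      (∀ S : Finset V, #S = l → #(S ∩ A) = i → ∃ T ∈ nb H S, par A (S ∪ T) = τ + 1) →
      HasShiftPath H A τ l x γ := by
  obtain ⟨N, hN⟩ := exists_disjoint_or_card_inter_eq (k := l + x) (l := l) (by omega) (by omega)
    (by omega) (c := c / 2 ^ (l + x)) (by positivity)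
  obtain ⟨M, hM⟩ := exists_nat_gt (6 * (8 * (l + x)) / c)
  refine ⟨N + M, ?_⟩
  intro V _ _ H A τ γ i h hn hdl hdx hi hS
  set n := Fintype.card V with hndef
  have hγ : 3 * γ ≤ c / 2 := by have := h.γ_le; linarith
  have hnR : 8 * (l + x : ℝ) ≤ c / 2 / 3 * n := by
    have : (M : ℝ) ≤ n := by exact_mod_cast (by omega : M ≤ n)
    rw [div_lt_iff₀ hc] at hM
    nlinarith
  have hz : ∀ Z : Finset V, #Z ≤ 8 * (l + x) → (#Z : ℝ) ≤ c / 2 / 3 * n := by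
    intro Z hZ
    have : (#Z : ℝ) ≤ 8 * (l + x) := by exact_mod_cast hZ
    linarith
  have cl : ∀ S : Finset V, #S = l → ∀ T ∈ nb H S, #T = x := fun S hS T hT => by
    have := card_of_mem_nb h.uniform hT; omega
  have cx : ∀ S : Finset V, #S = x → ∀ T ∈ nb H S, #T = l := fun S hS T hT => by
    have := card_of_mem_nb h.uniform hT; omega
  have wrong : ∀ {S T : Finset V}, ¬ par A T = τ - par A S → par A S + par A T = τ + 1 := by
    intro S T h
    rw [zmod_two_ne_iff.1 h]
    ring
  by_cases h1 : ∃ L : Finset V, #L = l ∧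
      c / 2 * (n : ℝ) ^ x ≤ #{T ∈ nb H L | ¬ par A T = τ - par A L}
  · obtain ⟨L, hL, hLc⟩ := h1
    obtain ⟨R, hR, -, hRg⟩ := h.exists_isGood (fun T hT => cl L hL T (mem_filter.1 hT).1) hγ hLc
      (Z := ∅) (hz _ (by simp))
    obtain ⟨hR, hRp⟩ := mem_filter.1 hR
    obtain ⟨R', hR', hd, hRg'⟩ := h.exists_isGood (fun T hT => cl L hL T (mem_filter.1 hT).1) hγ hLc
      (Z := R) (hz _ (by rw [cl L hL R hR]; omega))
    obtain ⟨hR', hRp'⟩ := mem_filter.1 hR'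
    exact hasShiftPath_of_pair hL (cl L hL R hR) (cl L hL R' hR') (mem_nb.1 hR).1 (mem_nb.1 hR').1
      hd.symm (mem_nb.1 hR).2 (mem_nb.1 hR').2 (wrong hRp) (wrong hRp') hRg hRg'
  have hr : ExtendsRight H A τ l x (8 * (l + x)) γ := by
    intro S hS Z hZ
    have h2 := half_le_card_filter (p := fun T => par A T = τ - par A S)
      (y := c / 2 * (n : ℝ) ^ x) (by have := hdl S hS; linarith) (fun h' => h1 ⟨S, hS, h'⟩)
    obtain ⟨R, hR, hd, hg⟩ := h.exists_isGood (fun T hT => cl S hS T (mem_filter.1 hT).1) hγ h2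
      (hz Z hZ)
    obtain ⟨hR, hRp⟩ := mem_filter.1 hR
    have hR' := mem_nb.1 hR
    exact ⟨R, cl S hS R hR, hR'.1.symm, hd, hRp, hR'.2, by rw [union_comm]; exact hR'.2, hg⟩
  have pick : ∀ {S : Finset V}, #S = x → ∀ {p : Finset V → Prop} [DecidablePred p],
      c / 2 * (n : ℝ) ^ l ≤ #{T ∈ nb H S | p T} → ∀ Z : Finset V, #Z ≤ 8 * (l + x) →
      ∃ L ∈ nb H S, p L ∧ Disjoint L Z := by
    intro S hS p _ hp Z hZ
    obtain ⟨L, hL, hd, -⟩ := exists_mem_disjoint_not (fun T hT => cx S hS T (mem_filter.1 hT).1)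
      h.l_pos (by positivity) h.card_pos (fun _ => False) hp (by
        simp only [filter_false, card_empty, Nat.cast_zero]; positivity) (hz Z hZ)
    exact ⟨L, (mem_filter.1 hL).1, (mem_filter.1 hL).2, hd⟩
  by_cases h2 : ∃ R : Finset V, #R = x ∧
      c / 2 * (n : ℝ) ^ l ≤ #{T ∈ nb H R | ¬ par A T = τ - par A R}
  · obtain ⟨R, hR, hRc⟩ := h2
    obtain ⟨L, hL, hLp, -⟩ := pick hR hRc ∅ (by simp)
    obtain ⟨L', hL', hLp', hd⟩ := pick hR hRc L (by rw [cx R hR L hL]; omega)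
    have hL1 := mem_nb.1 hL
    have hL1' := mem_nb.1 hL'
    refine hasShiftPath_of_left (fun S hS Z hZ => hr S hS Z (by omega)) hR (cx R hR L hL)
      (cx R hR L' hL') hL1.1.symm hL1'.1.symm hd.symm (by rw [union_comm]; exact hL1.2) hL1'.2 ?_ ?_
    · rw [add_comm]; exact wrong hLp
    · rw [add_comm]; exact wrong hLp'
  have hl : ExtendsLeft H A τ l x (8 * (l + x)) := by
    intro S hS Z hZ
    have h3 := half_le_card_filter (p := fun T => par A T = τ - par A S)
      (y := c / 2 * (n : ℝ) ^ l) (by have := hdx S hS; linarith) (fun h' => h2 ⟨S, hS, h'⟩)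
    obtain ⟨L, hL, hLp, hd⟩ := pick hS h3 Z hZ
    have hL1 := mem_nb.1 hL
    exact ⟨L, cx S hS L hL, hL1.1.symm, hd, hLp, hL1.2, by rw [union_comm]; exact hL1.2⟩
  set W : Finset (Finset V) := {e ∈ H | par A e = τ + 1 ∧ ∃ L ⊆ e, #L = l ∧ #(L ∩ A) = i} with hW
  -- Every `l`-set of type `i` lies in a wrong edge, and an edge has at most `2 ^ (l + x)` subsets.
  have hWc : c / 2 ^ (l + x) * (n : ℝ) ^ l ≤ #W := by
    have hsub : ({S : Finset V | #S = l ∧ #(S ∩ A) = i} : Finset _) ⊆ W.biUnion powerset := by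
      intro S hS'
      obtain ⟨-, hSl, hSi⟩ := mem_filter.1 hS'
      obtain ⟨T, hT, hp⟩ := hS S hSl hSi
      exact mem_biUnion.2 ⟨S ∪ T, mem_filter.2 ⟨(mem_nb.1 hT).2, hp, S, subset_union_left, hSl, hSi⟩,
        mem_powerset.2 subset_union_left⟩
    have h3 : #(W.biUnion powerset) ≤ #W * 2 ^ (l + x) := card_biUnion_le_card_mul _ _ _ fun e he => by
      rw [card_powerset, h.uniform e (mem_filter.1 he).1]
    have h4 : (#{S : Finset V | #S = l ∧ #(S ∩ A) = i} : ℝ) ≤ #W * 2 ^ (l + x) := by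
      exact_mod_cast (card_le_card hsub).trans h3
    rw [div_mul_eq_mul_div, div_le_iff₀ (by positivity)]
    linarith
  obtain ⟨f₁, hf₁, f₂, hf₂, hne, hcase⟩ := hN V W (by omega)
    (fun e he => h.uniform e (mem_filter.1 he).1) hWc
  obtain ⟨hH₁, hp₁, L₁, hL₁, hL₁c, hL₁i⟩ := mem_filter.1 hf₁
  obtain ⟨hH₂, hp₂, L₂, hL₂, hL₂c, hL₂i⟩ := mem_filter.1 hf₂
  have hc₁ := h.uniform f₁ hH₁
  have hc₂ := h.uniform f₂ hH₂
  -- If the edges are disjoint, the subsets `L₁` and `L₂` recorded in `W` have equally many vertices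
  -- in `A`, hence equal parity. If they meet in `l` vertices, their intersection is the common
  -- `l`-set.
  rcases hcase with hd | hI
  · have u₁ : L₁ ∪ f₁ \ L₁ = f₁ := union_sdiff_of_subset hL₁
    have u₂ : L₂ ∪ f₂ \ L₂ = f₂ := union_sdiff_of_subset hL₂
    refine hasShiftPath_of_disjoint hr hl (fun R R' Z hR hR' hpar hg hg' hRZ hRZ' hZ =>
      h.exists_connect hR hR' hpar hg hg' hRZ hRZ' ((hz Z hZ).trans ?_)) hL₁c hL₂c
      (R₁ := f₁ \ L₁) (R₂ := f₂ \ L₂) ?_ ?_ disjoint_sdiff disjoint_sdiff (hd.mono hL₁ hL₂)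
      (hd.mono hL₁ sdiff_subset) (hd.mono sdiff_subset hL₂) (hd.mono sdiff_subset sdiff_subset)
      (by rwa [u₁]) (by rwa [union_comm, u₂]) ?_ ?_ ?_
    · gcongr
      linarith
    · rw [card_sdiff_of_subset hL₁]; omega
    · rw [card_sdiff_of_subset hL₂]; omega
    · rw [← par_union disjoint_sdiff, u₁, hp₁]
    · rw [← par_union disjoint_sdiff, u₂, hp₂]
    · rw [par, par, hL₁i, hL₂i]
  · have u₁ : f₁ ∩ f₂ ∪ f₁ \ f₂ = f₁ := by rw [union_comm]; exact sdiff_union_inter _ _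
    have u₂ : f₁ ∩ f₂ ∪ f₂ \ f₁ = f₂ := by rw [union_comm, inter_comm]; exact sdiff_union_inter _ _
    have v₁ : Disjoint (f₁ ∩ f₂) (f₁ \ f₂) := disjoint_sdiff.mono_left inter_subset_right
    have v₂ : Disjoint (f₁ ∩ f₂) (f₂ \ f₁) := disjoint_sdiff.mono_left inter_subset_left
    have w₁ : #(f₁ ∩ f₂) + #(f₁ \ f₂) = #f₁ := card_inter_add_card_sdiff _ _
    have w₂ : #(f₂ ∩ f₁) + #(f₂ \ f₁) = #f₂ := card_inter_add_card_sdiff _ _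
    rw [inter_comm f₂] at w₂
    refine hasShiftPath_of_inter hr hl hI (R := f₁ \ f₂) (R' := f₂ \ f₁) (by omega) (by omega) v₁ v₂
      (disjoint_sdiff.mono_left sdiff_subset).symm (by rwa [union_comm, u₁]) (by rwa [u₂]) ?_ ?_
    · rw [← par_union v₁, u₁, hp₁]
    · rw [← par_union v₂, u₂, hp₂]

end


/-! ### The theorem for a well-prepared partition. -/

section
variable {V : Type*} [Fintype V] [DecidableEq V]

theorem le_card_filter_of_type {A U : Finset V} {j a : ℕ} (ha : a ≤ j) {y : ℝ} (hy : 0 ≤ y)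
    (hA : y + j ≤ #(U ∩ A)) (hB : y + j ≤ #(U \ A)) {p : Finset V → Prop} [DecidablePred p]
    (hp : ∀ T : Finset V, T ⊆ U → #T = j → #(T ∩ A) = a → p T) :
    y ^ j / j.factorial ≤ #{T : Finset V | p T} := by
  have haR : (a : ℝ) ≤ j := by exact_mod_cast ha
  have haR' : ((j - a : ℕ) : ℝ) ≤ j := by exact_mod_cast Nat.sub_le _ _
  have h := le_card_typedSets (A := A) (U := U) (a := a) (b := j - a) hy (by linarith) (by linarith)
  rw [Nat.add_sub_of_le ha] at h
  refine h.trans ?_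
  exact_mod_cast card_le_card fun T hT => mem_filter.2 ⟨mem_univ _, hp T (mem_typedSets.1 hT).1
    (by rw [card_of_mem_typedSets hT]; omega) (mem_typedSets.1 hT).2.1⟩

theorem exists_le_natCast_zmod_two_eq {j : ℕ} (hj : 1 ≤ j) (α : ZMod 2) :
    ∃ a : ℕ, a ≤ j ∧ (a : ZMod 2) = α := by
  rcases zmod_two_cases α with rfl | rfl
  · exact ⟨0, by omega, by simp⟩
  · exact ⟨1, hj, by simp⟩

end

/-- The theorem for `H` that contains almost all sets of the right parity, has few exceptional
vertices, each of them in many edges of the right parity, and has no parity obstruction. -/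
theorem exists_forall_hasHamiltonCycle {l x : ℕ} (hl : 4 ≤ l) (hx : 1 ≤ x) (hxl : x ≤ l) {c : ℝ}
    (hc : 0 < c) : ∃ η : ℝ, 0 < η ∧ ∃ N₀ : ℕ, ∀ (V : Type*) [Fintype V] [DecidableEq V]
      (H : KGraph V (l + x)) (A X : Finset V) (τ : ZMod 2) (t : ℕ),
      Fintype.card V = t * (l + x) → N₀ ≤ Fintype.card V →
      2 * (#A : ℝ) ≤ (1 + η) * Fintype.card V → (1 - η) * Fintype.card V ≤ 2 * (#A : ℝ) →
      (#(missing H.edges A τ (l + x)) : ℝ) ≤ η * (Fintype.card V : ℝ) ^ (l + x) →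
      (#X : ℝ) ≤ η * Fintype.card V →
      (∀ v ∉ X, (#(nb (missing H.edges A τ (l + x)) {v}) : ℝ) ≤
        η * (Fintype.card V : ℝ) ^ (l + x - 1)) →
      (∀ v ∈ X, c * (Fintype.card V : ℝ) ^ (l + x - 1) ≤ #{e ∈ H.edges | v ∈ e ∧ par A e = τ ∧
        1 ≤ #(e.erase v ∩ A) ∧ 1 ≤ #(e.erase v \ A)}) →
      (∀ S : Finset V, #S = l → c * (Fintype.card V : ℝ) ^ x ≤ #(nb H.edges S)) →
      (∀ S : Finset V, #S = x → c * (Fintype.card V : ℝ) ^ l ≤ #(nb H.edges S)) →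
      (par A univ ≠ t * τ → ∃ i ≤ l, ∀ S : Finset V, #S = l → #(S ∩ A) = i →
        ∃ T ∈ nb H.edges S, par A (S ∪ T) = τ + 1) → H.HasHamiltonCycle l := by
  obtain ⟨γ₀, hγ₀, hcomp⟩ := exists_completion hl hx
  set k := l + x with hk
  have hkR : (0 : ℝ) < k := by exact_mod_cast (by omega : 0 < k)
  -- Both classes contain well over `n / 4` vertices, which gives at least this proportion of
  -- `j`-sets of every type for all `j ≤ k`.
  set c₀ : ℝ := min c (1 / (4 ^ k * k.factorial)) with hc₀
  have hc₀0 : 0 < c₀ := by positivity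
  have hc₀c : c₀ ≤ c := min_le_left _ _
  set γ : ℝ := min γ₀ (min (c₀ / 6) (min (1 / (4 * k)) (1 / 100))) with hγ
  have hγ0 : 0 < γ := by positivity
  have h1 : γ ≤ γ₀ := min_le_left _ _
  have h2 : γ ≤ c₀ / 6 := (min_le_right _ _).trans (min_le_left _ _)
  have h3 : γ ≤ 1 / (4 * k) := (min_le_right _ _).trans ((min_le_right _ _).trans (min_le_left _ _))
  have h4 : γ ≤ 1 / 100 := (min_le_right _ _).trans ((min_le_right _ _).trans (min_le_right _ _))
  obtain ⟨N₁, hN₁⟩ := hcomp γ hγ0 h1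
  obtain ⟨N₂, hN₂⟩ := exists_hasShiftPath hx hxl hc₀0
  obtain ⟨N₃, hN₃⟩ := exists_nat_gt (12 * k / γ)
  have h2k : (1 : ℝ) ≤ 2 ^ k := one_le_pow₀ (by norm_num)
  have hη : γ ^ 2 / 2 ^ k ≤ γ ^ 2 := div_le_self (by positivity) h2k
  refine ⟨γ ^ 2 / 2 ^ k, by positivity, N₁ + N₂ + N₃, ?_⟩
  clear_value c₀ γ
  intro V _ _ H A X τ t hn hN hA hA' hF hX hXn hXd hdl hdx hpar
  set n := Fintype.card V with hndef
  have hnR : 12 * k ≤ γ * n := by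
    have : (N₃ : ℝ) ≤ n := by exact_mod_cast (by omega : N₃ ≤ n)
    rw [div_lt_iff₀ hγ0] at hN₃
    nlinarith
  have hn0 : (0 : ℝ) < n := by
    by_contra hcon
    have : γ * n ≤ 0 := mul_nonpos_of_nonneg_of_nonpos hγ0.le (not_lt.1 hcon)
    linarith
  have hγ2 : γ ^ 2 ≤ γ := by nlinarith
  have hηγ : γ ^ 2 / 2 ^ k * n ≤ γ * n := by gcongr; linarith
  have hγn : γ * n ≤ n / 100 := by nlinarith
  have hAn : #A + #(univ \ A) = n := by
    rw [card_sdiff_of_subset (subset_univ _), card_univ]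
    have := card_le_univ A
    omega
  have hAnR : (#A : ℝ) + #(univ \ A) = n := by exact_mod_cast hAn
  have hcount : ∀ j ≤ k, ∀ a ≤ j, ∀ (p : Finset V → Prop) [DecidablePred p],
      (∀ T : Finset V, #T = j → #(T ∩ A) = a → p T) → c₀ * (n : ℝ) ^ j ≤ #{T | p T} := by
    intro j hj a ha p _ hp
    have hjR : (j : ℝ) ≤ k := by exact_mod_cast hj
    have h5 := le_card_filter_of_type (A := A) (U := univ) ha (y := (n : ℝ) / 4) (by positivity)
      (by rw [univ_inter]; linarith) (by linarith) (p := p) fun T _ => hp T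
    refine le_trans ?_ h5
    have h6 : c₀ ≤ 1 / (4 ^ j * j.factorial) := by
      refine (hc₀.le.trans (min_le_right _ _)).trans ?_
      gcongr
      norm_num
    calc c₀ * (n : ℝ) ^ j ≤ 1 / (4 ^ j * j.factorial) * (n : ℝ) ^ j := by gcongr
      _ = _ := by rw [div_pow]; field_simp
  have hnear : IsNearParity H.edges A τ l x γ c₀ :=
    { uniform := H.uniform
      l_pos := by omega
      x_pos := hx
      card_pos := by exact_mod_cast hn0
      γ_pos := hγ0
      γ_le := h2
      missing_le := by
        rw [div_mul_eq_mul_div, le_div_iff₀ (by positivity)] at hF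
        linarith
      le_card_l := fun α => by
        obtain ⟨a, ha, haα⟩ := exists_le_natCast_zmod_two_eq (show 1 ≤ l by omega) α
        exact hcount l (by omega) a ha _ fun T hT hTA => ⟨hT, by rw [par, hTA, haα]⟩
      le_card_x := fun α => by
        obtain ⟨a, ha, haα⟩ := exists_le_natCast_zmod_two_eq hx α
        exact hcount x (by omega) a ha _ fun T hT hTA => ⟨hT, by rw [par, hTA, haα]⟩ }
  have hdl' : ∀ S : Finset V, #S = l → c₀ * (n : ℝ) ^ x ≤ #(nb H.edges S) := fun S hS =>
    le_trans (by gcongr) (hdl S hS)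
  have hdx' : ∀ S : Finset V, #S = x → c₀ * (n : ℝ) ^ l ≤ #(nb H.edges S) := fun S hS =>
    le_trans (by gcongr) (hdx S hS)
  have hγc : 3 * γ ≤ c₀ / 2 := by linarith
  -- The initial path is a single good `x`-set if there is no parity obstruction, and a shift path
  -- otherwise.
  obtain ⟨R₀, R, Z, m, hm, hp, hRR, hg₀, hg, hpZ⟩ : ∃ R₀ R Z m, m ≤ 5 ∧
      LRPath H.edges l x R₀ R Z m ∧ par A R = par A R₀ ∧
      IsGood (missing H.edges A τ (l + x)) (l + x) γ R₀ ∧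
      IsGood (missing H.edges A τ (l + x)) (l + x) γ R ∧
      par A Z - m * τ = par A univ - t * τ + par A R₀ := by
    by_cases h0 : par A univ = t * τ
    · obtain ⟨R, hR, -, hg⟩ := hnear.exists_isGood (c' := c₀)
        (𝒯 := {T : Finset V | #T = x ∧ par A T = 0}) (fun T hT => (mem_filter.1 hT).2.1)
        (by linarith) (hnear.le_card_x 0) (Z := ∅) (by simp; positivity)
      refine ⟨R, R, R, 0, by omega, LRPath.base (mem_filter.1 hR).2.1, rfl, hg, hg, ?_⟩
      rw [h0]
      push_cast
      ring
    · obtain ⟨i, hi, hS⟩ := hpar h0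
      obtain ⟨R₀, R, Z, m, hm, hp, hRR, hg₀, hg, hpZ⟩ := hN₂ V H.edges A τ γ i hnear (by omega) hdl'
        hdx' (hcount l (by omega) i hi _ fun T hT hTA => ⟨hT, hTA⟩) hS
      refine ⟨R₀, R, Z, m, hm, hp, hRR, hg₀, hg, ?_⟩
      rw [zmod_two_ne_iff.1 h0, hpZ]
      ring
  have hZc : (#Z : ℝ) ≤ 6 * k := by
    have h5 := hp.card_eq
    have h6 : m * (l + x) ≤ 5 * (l + x) := Nat.mul_le_mul_right _ hm
    exact_mod_cast (by omega : #Z ≤ 6 * k)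
  -- Absorption adds at most `2 * k` vertices for each exceptional vertex.
  have hkX : 2 * k * (#X : ℝ) ≤ γ / 2 * n := by
    have h5 : γ * (4 * k) ≤ 1 := by rwa [le_div_iff₀ (by positivity)] at h3
    have h6 : (#X : ℝ) ≤ γ ^ 2 * n := hX.trans (by gcongr)
    calc 2 * k * (#X : ℝ) ≤ 2 * k * (γ ^ 2 * n) := by gcongr
      _ = (γ * (4 * k)) * (γ / 2 * n) := by ring
      _ ≤ 1 * (γ / 2 * n) := by gcongr
      _ = _ := one_mul _
  have hkc : ((l + x : ℕ) : ℝ) = k := by rw [hk]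
  push_cast at hkc
  obtain ⟨R', Z', m', hp', hZZ, hXZ, hZ'c, hR', hg', hp''⟩ := hnear.exists_absorb_set (by omega)
    (β := par A R₀) (c' := c₀ / 2) hγc (by linarith) X (fun v hv => by
      refine exists_many_sets H.uniform (by omega) hx hnear.card_pos (by positivity) ?_ (par A R₀)
      rw [mul_div_cancel₀ _ two_ne_zero]
      exact le_trans (by gcongr) (hXd v hv)) hp hRR hg (by
      rw [hkc]
      have : γ * n ≤ c₀ / 2 / 3 * n := by gcongr; linarith
      linarith)
  have hZ'R : (#Z' : ℝ) ≤ #Z + 2 * k * #X := by exact_mod_cast hZ'c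
  refine hN₁ V H A R₀ R' Z' τ (par A R₀) m' t hn (by omega) ?_ ?_ hnear.missing_le hp' (by linarith)
    rfl hR' hg₀ hg' ?_ ?_
  · refine hA.trans ?_
    gcongr
    linarith
  · refine le_trans ?_ hA'
    gcongr
    linarith
  · linear_combination hp'' + hpZ
  · intro v hv
    have := hXn v fun h => hv (hXZ h)
    rw [div_mul_eq_mul_div, le_div_iff₀ (by positivity)] at this
    linarith


/-! ### Repairing the partition. -/

section
variable {V : Type*} [Fintype V] [DecidableEq V]

theorem nb_eq_self_empty {F : Finset (Finset V)} : nb F ∅ = F := by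
  ext
  simp [mem_nb]

/-- Markov's inequality for vertex degrees, the case `P = ∅` of `card_filter_lt_card_nb_le`. -/
theorem card_filter_lt_card_nb_singleton_le {F : Finset (Finset V)} {k : ℕ} (hF : ∀ e ∈ F, #e = k)
    (hk : 1 ≤ k) (hn : 0 < Fintype.card V) {θ : ℝ} (hθ : 0 < θ)
    (h : 2 ^ k * (#F : ℝ) ≤ θ ^ 2 * (Fintype.card V : ℝ) ^ k) :
    (#{v | θ * (Fintype.card V : ℝ) ^ (k - 1) < #(nb F {v})} : ℝ) ≤ θ * Fintype.card V := by
  have hnR : (0 : ℝ) < Fintype.card V := by exact_mod_cast hn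
  have h1 := card_filter_lt_card_nb_le hF (P := ∅)
    ((univ : Finset V).image fun v => ({v} : Finset V)) (by simp)
    (θ * (Fintype.card V : ℝ) ^ (k - 1))
  rw [filter_image, card_image_of_injective _ singleton_injective, nb_eq_self_empty] at h1
  simp only [empty_union] at h1
  have h2 : (Fintype.card V : ℝ) ^ k = Fintype.card V * (Fintype.card V : ℝ) ^ (k - 1) := by
    rw [← pow_succ', Nat.sub_add_cancel hk]
  rw [h2] at h
  refine le_of_mul_le_mul_right (a := θ * (Fintype.card V : ℝ) ^ (k - 1)) ?_ (by positivity)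
  linarith

/-- If all triples have large degree, then every vertex lies in many edges that, apart from the
vertex, meet both classes and avoid a small set. -/
theorem le_card_filter_nb_disjoint {H : Finset (Finset V)} {A X : Finset V} {k : ℕ} {c : ℝ}
    (hH : ∀ e ∈ H, #e = k) (hk : 3 ≤ k) (hc : 0 < c)
    (hdeg : ∀ Q : Finset V, #Q = 3 → c * (Fintype.card V : ℝ) ^ (k - 3) ≤ #(nb H Q))
    (hA : (Fintype.card V : ℝ) / 4 + #X + 2 ≤ #A)
    (hB : (Fintype.card V : ℝ) / 4 + #X + 2 ≤ #(univ \ A))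
    (hX : (#X : ℝ) ≤ c / (64 * 2 ^ k) * Fintype.card V) (v : V) :
    c / (64 * 2 ^ k) * (Fintype.card V : ℝ) ^ (k - 1) ≤
      #{T ∈ nb H {v} | Disjoint T X ∧ 1 ≤ #(T ∩ A) ∧ 1 ≤ #(T \ A)} := by
  set n := Fintype.card V
  set U : Finset V := univ \ (insert v X) with hU
  have hins : (#(insert v X) : ℝ) ≤ #X + 1 := by exact_mod_cast card_insert_le v X
  have hUA : (#A : ℝ) ≤ #(U ∩ A) + (#X + 1) := by
    have : A ⊆ (U ∩ A) ∪ insert v X := by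
      intro w hw
      simp only [hU, mem_union, mem_inter, mem_sdiff, mem_univ, true_and]
      tauto
    have h1 := (card_le_card this).trans (card_union_le _ _)
    have h2 : (#A : ℝ) ≤ #(U ∩ A) + #(insert v X) := by exact_mod_cast h1
    linarith
  have hUB : (#(univ \ A) : ℝ) ≤ #(U \ A) + (#X + 1) := by
    have : univ \ A ⊆ (U \ A) ∪ insert v X := by
      intro w hw
      simp only [hU, mem_union, mem_sdiff, mem_univ, true_and] at hw ⊢
      tauto
    have h1 := (card_le_card this).trans (card_union_le _ _)
    have h2 : (#(univ \ A) : ℝ) ≤ #(U \ A) + #(insert v X) := by exact_mod_cast h1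
    linarith
  have h1 := le_card_typedSets (A := A) (U := U) (a := 1) (b := 1) (y := (n : ℝ) / 4) (by positivity)
    (by push_cast; linarith) (by push_cast; linarith)
  have hvQ : ∀ Q ∈ typedSets A U 1 1, Disjoint {v} Q := by
    intro Q hQ
    rw [disjoint_singleton_left]
    intro hv
    have := (mem_typedSets.1 hQ).1 hv
    simp [hU] at this
  set F : Finset (Finset V) := {e ∈ H | v ∈ e ∧ 1 ≤ #(e.erase v ∩ A) ∧ 1 ≤ #(e.erase v \ A)} with hF
  have hFk : ∀ e ∈ F, #e = k := fun e he => hH e (mem_filter.1 he).1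
  have h2 := sum_card_nb_union_le hFk (P := {v}) (typedSets A U 1 1) hvQ
  have h3 : ∀ Q ∈ typedSets A U 1 1, c * (n : ℝ) ^ (k - 3) ≤ #(nb F ({v} ∪ Q)) := by
    intro Q hQ
    have hQc := card_of_mem_typedSets hQ
    have hQv := hvQ Q hQ
    refine (hdeg ({v} ∪ Q) (by rw [card_union_of_disjoint hQv, hQc, card_singleton])).trans ?_
    refine Nat.cast_le.2 (card_le_card fun T hT => ?_)
    rw [mem_nb] at hT ⊢
    have hsub : Q ⊆ ({v} ∪ Q ∪ T).erase v := by
      intro w hw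
      rw [mem_erase]
      refine ⟨?_, by simp [hw]⟩
      rintro rfl
      exact disjoint_left.1 hQv (mem_singleton_self _) hw
    refine ⟨hT.1, mem_filter.2 ⟨hT.2, by simp, ?_, ?_⟩⟩
    · rw [← (mem_typedSets.1 hQ).2.1]
      exact card_le_card (inter_subset_inter_right hsub)
    · rw [← (mem_typedSets.1 hQ).2.2]
      exact card_le_card (sdiff_subset_sdiff hsub (subset_refl _))
  -- Join `v` to pairs with one vertex in each class: there are at least `n ^ 2 / 32` of them, and
  -- every edge through such a triple is counted by `F`.
  have h4 : (n : ℝ) ^ 2 / 32 * (c * (n : ℝ) ^ (k - 3)) ≤ 2 ^ k * #(nb F {v}) := by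
    calc (n : ℝ) ^ 2 / 32 * (c * (n : ℝ) ^ (k - 3))
        ≤ #(typedSets A U 1 1) * (c * (n : ℝ) ^ (k - 3)) := by
          gcongr
          refine le_trans (le_of_eq ?_) h1
          norm_num [Nat.factorial]
          ring
      _ = ∑ Q ∈ typedSets A U 1 1, c * (n : ℝ) ^ (k - 3) := by rw [sum_const, nsmul_eq_mul]
      _ ≤ ∑ Q ∈ typedSets A U 1 1, (#(nb F ({v} ∪ Q)) : ℝ) := sum_le_sum h3
      _ ≤ _ := by exact_mod_cast h2
  have h5 : (n : ℝ) ^ (k - 1) = (n : ℝ) ^ 2 * (n : ℝ) ^ (k - 3) := by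
    rw [← pow_add]; congr 1; omega
  have hFT : ∀ T ∈ nb F {v}, #T = k - 1 := by
    intro T hT
    have := card_of_mem_nb hFk hT
    rw [card_singleton] at this
    omega
  have h6 := card_filter_not_disjoint_le hFT X
  have h7 : nb F {v} ⊆ {T ∈ nb F {v} | ¬ Disjoint T X} ∪
      {T ∈ nb H {v} | Disjoint T X ∧ 1 ≤ #(T ∩ A) ∧ 1 ≤ #(T \ A)} := by
    intro T hT
    by_cases hd : Disjoint T X
    · refine mem_union_right _ (mem_filter.2 ⟨nb_mono (filter_subset _ _) _ hT, hd, ?_⟩)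
      rw [mem_nb, disjoint_singleton_left] at hT
      have := (mem_filter.1 hT.2).2.2
      rwa [← insert_eq, erase_insert hT.1] at this
    · exact mem_union_left _ (mem_filter.2 ⟨hT, hd⟩)
  have h8 := (card_le_card h7).trans (card_union_le _ _)
  have h9 : (#(nb F {v}) : ℝ) ≤ #X * (n : ℝ) ^ (k - 1 - 1) +
      #{T ∈ nb H {v} | Disjoint T X ∧ 1 ≤ #(T ∩ A) ∧ 1 ≤ #(T \ A)} := by
    exact_mod_cast h8.trans (Nat.add_le_add_right h6 _)
  have h10 : (#X : ℝ) * (n : ℝ) ^ (k - 1 - 1) ≤ c / (64 * 2 ^ k) * (n : ℝ) ^ (k - 1) := by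
    calc (#X : ℝ) * (n : ℝ) ^ (k - 1 - 1) ≤ c / (64 * 2 ^ k) * n * (n : ℝ) ^ (k - 1 - 1) := by gcongr
      _ = c / (64 * 2 ^ k) * (n : ℝ) ^ (k - 1) := by
        rw [mul_assoc, ← pow_succ', Nat.sub_add_cancel (by omega)]
  have h11 : 2 * (c / (64 * 2 ^ k)) * (n : ℝ) ^ (k - 1) ≤ #(nb F {v}) := by
    rw [h5]
    have : (0 : ℝ) < 2 ^ k := by positivity
    refine le_of_mul_le_mul_left (a := 2 ^ k) (le_trans (le_of_eq ?_) h4) this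
    field_simp
    ring
  linarith

/-- The `k`-sets that meet `A` in `τ` vertices modulo `2`. -/
def paritySets (A : Finset V) (τ : ZMod 2) (k : ℕ) : Finset (Finset V) :=
  {e | #e = k ∧ par A e = τ}

theorem mem_paritySets {A e : Finset V} {τ : ZMod 2} {k : ℕ} :
    e ∈ paritySets A τ k ↔ #e = k ∧ par A e = τ := by simp [paritySets]

/-- After moving a few vertices, every vertex is either typical or lies in many edges of the right
parity. -/
theorem exists_adjusted_part {H : Finset (Finset V)} {A₀ : Finset V} {τ : ZMod 2} {k : ℕ} {c θ : ℝ}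
    (hH : ∀ e ∈ H, #e = k) (hk : 3 ≤ k) (hn : 0 < Fintype.card V) (hc : 0 < c) (hθ : 0 < θ)
    (hθ1 : θ ≤ 1) (hθc : θ ≤ c / (64 * 2 ^ k))
    (hdeg : ∀ Q : Finset V, #Q = 3 → c * (Fintype.card V : ℝ) ^ (k - 3) ≤ #(nb H Q))
    (hA : (Fintype.card V : ℝ) / 4 + θ * Fintype.card V + 2 ≤ #A₀)
    (hB : (Fintype.card V : ℝ) / 4 + θ * Fintype.card V + 2 ≤ #(univ \ A₀))
    (hD : 2 ^ k * (#(symmDiff H (paritySets A₀ τ k)) : ℝ) ≤ θ ^ 2 * (Fintype.card V : ℝ) ^ k) :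
    ∃ A X : Finset V, (#A : ℝ) ≤ #A₀ + θ * Fintype.card V ∧ (#A₀ : ℝ) ≤ #A + θ * Fintype.card V ∧
      (#X : ℝ) ≤ θ * Fintype.card V ∧
      (#(missing H A τ k) : ℝ) ≤ 2 * θ * (Fintype.card V : ℝ) ^ k ∧
      (∀ v ∉ X, (#(nb (missing H A τ k) {v}) : ℝ) ≤ 2 * θ * (Fintype.card V : ℝ) ^ (k - 1)) ∧
      ∀ v ∈ X, c / (128 * 2 ^ k) * (Fintype.card V : ℝ) ^ (k - 1) ≤ #{e ∈ H | v ∈ e ∧ par A e = τ ∧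
        1 ≤ #(e.erase v ∩ A) ∧ 1 ≤ #(e.erase v \ A)} := by
  set n := Fintype.card V with hndef
  set D := symmDiff H (paritySets A₀ τ k) with hDdef
  have hDk : ∀ e ∈ D, #e = k := by
    intro e he
    rcases mem_symmDiff.1 he with h | h
    · exact hH e h.1
    · exact (mem_paritySets.1 h.1).1
  -- The vertices in too many defects, that is, in too many edges or non-edges on which `H` differs
  -- from the parity graph.
  set X : Finset V := {v | θ * (n : ℝ) ^ (k - 1) < #(nb D {v})} with hX
  have hXc : (#X : ℝ) ≤ θ * n := card_filter_lt_card_nb_singleton_le hDk (by omega) hn hθ hD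
  set G : V → Finset (Finset V) := fun v =>
    {T ∈ nb H {v} | Disjoint T X ∧ 1 ≤ #(T ∩ A₀) ∧ 1 ≤ #(T \ A₀)} with hG
  have hGc : ∀ v, c / (64 * 2 ^ k) * (n : ℝ) ^ (k - 1) ≤ #(G v) := fun v =>
    le_card_filter_nb_disjoint hH hk hc hdeg (by linarith) (by linarith) (hXc.trans (by gcongr)) v
  -- Majority vote: an exceptional vertex is put in `A` if most of its links in `G v` need it there
  -- to become right edges. Links in `G v` avoid `X`, so their parity is not affected by the moves
  -- and at least half of them give right edges.
  set Y : Finset V := {v ∈ X | #{T ∈ G v | par A₀ T = τ} < #{T ∈ G v | ¬ par A₀ T = τ}} with hY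
  have hYX : Y ⊆ X := filter_subset _ _
  set A := (A₀ \ X) ∪ Y with hAdef
  have hTA : ∀ T : Finset V, Disjoint T X → T ∩ A = T ∩ A₀ := by
    intro T hT
    ext w
    simp only [hAdef, mem_inter, mem_union, mem_sdiff]
    constructor
    · rintro ⟨h1, h2 | h2⟩
      · exact ⟨h1, h2.1⟩
      · exact absurd (hYX h2) (disjoint_left.1 hT h1)
    · rintro ⟨h1, h2⟩
      exact ⟨h1, Or.inl ⟨h2, disjoint_left.1 hT h1⟩⟩
  have hpar : ∀ T : Finset V, Disjoint T X → par A T = par A₀ T := fun T hT => by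
    rw [par, hTA T hT, par]
  have hmis : ∀ e ∈ missing H A τ k, Disjoint e X → e ∈ D := by
    intro e he hd
    obtain ⟨h1, h2, h3⟩ := mem_missing.1 he
    exact mem_symmDiff.2 (Or.inr ⟨mem_paritySets.2 ⟨h1, by rw [← hpar e hd, h2]⟩, h3⟩)
  have hpow : ∀ j, 1 ≤ j → (#X : ℝ) * (n : ℝ) ^ (j - 1) ≤ θ * (n : ℝ) ^ j := by
    intro j hj
    calc (#X : ℝ) * (n : ℝ) ^ (j - 1) ≤ θ * n * (n : ℝ) ^ (j - 1) := by gcongr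
      _ = θ * (n : ℝ) ^ j := by rw [mul_assoc, ← pow_succ', Nat.sub_add_cancel hj]
  refine ⟨A, X, ?_, ?_, hXc, ?_, ?_, ?_⟩
  · have h1 : #A ≤ #A₀ + #X := (card_union_le _ _).trans
      (Nat.add_le_add (card_le_card sdiff_subset) (card_le_card hYX))
    have h2 : (#A : ℝ) ≤ #A₀ + #X := by exact_mod_cast h1
    linarith
  · have h0 : A₀ ⊆ A ∪ X := by
      intro w hw
      simp only [hAdef, mem_union, mem_sdiff]
      tauto
    have h1 : #A₀ ≤ #A + #X := (card_le_card h0).trans (card_union_le _ _)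
    have h2 : (#A₀ : ℝ) ≤ #A + #X := by exact_mod_cast h1
    linarith
  · have h1 := card_filter_not_disjoint_le (card_of_mem_missing (H := H) (A := A) (τ := τ) (k := k)) X
    have h2 : missing H A τ k ⊆ {T ∈ missing H A τ k | ¬ Disjoint T X} ∪ D := by
      intro e he
      by_cases hd : Disjoint e X
      · exact mem_union_right _ (hmis e he hd)
      · exact mem_union_left _ (mem_filter.2 ⟨he, hd⟩)
    have h3 := (card_le_card h2).trans ((card_union_le _ _).trans (Nat.add_le_add_right h1 _))
    have h4 : (#(missing H A τ k) : ℝ) ≤ #X * (n : ℝ) ^ (k - 1) + #D := by exact_mod_cast h3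
    have h5 := hpow k (by omega)
    have h6 : (#D : ℝ) ≤ θ * (n : ℝ) ^ k := by
      calc (#D : ℝ) ≤ 2 ^ k * #D := le_mul_of_one_le_left (by positivity)
            (one_le_pow₀ (by norm_num))
        _ ≤ θ ^ 2 * (n : ℝ) ^ k := hD
        _ ≤ θ * (n : ℝ) ^ k := by gcongr; nlinarith
    linarith
  · intro v hv
    have hTk : ∀ T ∈ nb (missing H A τ k) {v}, #T = k - 1 := by
      intro T hT
      have := card_of_mem_nb card_of_mem_missing hT
      rw [card_singleton] at this
      omega
    have h1 := card_filter_not_disjoint_le hTk X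
    have h2 : nb (missing H A τ k) {v} ⊆
        {T ∈ nb (missing H A τ k) {v} | ¬ Disjoint T X} ∪ nb D {v} := by
      intro T hT
      by_cases hd : Disjoint T X
      · obtain ⟨e1, e2⟩ := mem_nb.1 hT
        exact mem_union_right _ (mem_nb.2 ⟨e1, hmis _ e2 (disjoint_union_left.2
          ⟨disjoint_singleton_left.2 hv, hd⟩)⟩)
      · exact mem_union_left _ (mem_filter.2 ⟨hT, hd⟩)
    have h3 := (card_le_card h2).trans ((card_union_le _ _).trans (Nat.add_le_add_right h1 _))
    have h4 : (#(nb (missing H A τ k) {v}) : ℝ) ≤ #X * (n : ℝ) ^ (k - 1 - 1) + #(nb D {v}) := by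
      exact_mod_cast h3
    have h5 := hpow (k - 1) (by omega)
    have h6 : (#(nb D {v}) : ℝ) ≤ θ * (n : ℝ) ^ (k - 1) := by
      by_contra hcon
      exact hv (mem_filter.2 ⟨mem_univ _, not_le.1 hcon⟩)
    linarith
  · intro v hv
    have key : ∀ p : Finset V → Prop, ∀ [DecidablePred p], (∀ T ∈ G v, p T → par A ({v} ∪ T) = τ) →
        #{T ∈ G v | p T} ≤ #{e ∈ H | v ∈ e ∧ par A e = τ ∧
          1 ≤ #(e.erase v ∩ A) ∧ 1 ≤ #(e.erase v \ A)} := by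
      intro p _ hp
      refine card_le_card_of_injOn (fun T => {v} ∪ T) ?_ ?_
      · intro T hT
        obtain ⟨hT, hpT⟩ := mem_filter.1 (mem_coe.1 hT)
        obtain ⟨hTn, hTX, h1, h2⟩ := mem_filter.1 hT
        obtain ⟨h3, h4⟩ := mem_nb.1 hTn
        have h5 : ({v} ∪ T).erase v = T := by
          rw [← insert_eq, erase_insert (disjoint_singleton_left.1 h3)]
        refine mem_coe.2 (mem_filter.2 ⟨h4, by simp, hp T hT hpT, ?_, ?_⟩)
        · rw [h5, hTA T hTX]; exact h1
        · rw [h5, ← sdiff_inter_self_left T A, hTA T hTX, sdiff_inter_self_left]; exact h2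
      · intro T hT T' hT' heq
        have h3 := (mem_nb.1 (mem_filter.1 (mem_filter.1 (mem_coe.1 hT)).1).1).1
        have h3' := (mem_nb.1 (mem_filter.1 (mem_filter.1 (mem_coe.1 hT')).1).1).1
        have heq' : {v} ∪ T = {v} ∪ T' := heq
        rw [← insert_eq, ← insert_eq] at heq'
        rw [← erase_insert (disjoint_singleton_left.1 h3), heq',
          erase_insert (disjoint_singleton_left.1 h3')]
    have hsplit := card_filter_add_card_filter_not (s := G v) (fun T => par A₀ T = τ)
    have hsplitR : (#{T ∈ G v | par A₀ T = τ} : ℝ) + #{T ∈ G v | ¬ par A₀ T = τ} = #(G v) := by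
      exact_mod_cast hsplit
    have hpu : ∀ T ∈ G v, par A ({v} ∪ T) = par A {v} + par A₀ T := by
      intro T hT
      obtain ⟨hTn, hTX, -⟩ := mem_filter.1 hT
      rw [par_union (mem_nb.1 hTn).1, hpar T hTX]
    have h128 : c / (128 * 2 ^ k) * (n : ℝ) ^ (k - 1) =
        c / (64 * 2 ^ k) * (n : ℝ) ^ (k - 1) / 2 := by field_simp; norm_num
    have hGv := hGc v
    rw [h128]
    by_cases hvY : #{T ∈ G v | par A₀ T = τ} < #{T ∈ G v | ¬ par A₀ T = τ}
    · have hvA : v ∈ A := mem_union_right _ (mem_filter.2 ⟨hv, hvY⟩)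
      have h1 := key (fun T => ¬ par A₀ T = τ) fun T hT hp => by
        rw [hpu T hT, zmod_two_ne_iff.1 hp, par, inter_eq_left.2 (singleton_subset_iff.2 hvA),
          card_singleton, Nat.cast_one, add_left_comm]
        have : (1 : ZMod 2) + 1 = 0 := by decide
        rw [this, add_zero]
      have h2 : (#{T ∈ G v | par A₀ T = τ} : ℝ) ≤ #{T ∈ G v | ¬ par A₀ T = τ} := by
        exact_mod_cast hvY.le
      have h3 := (Nat.cast_le (α := ℝ)).2 h1
      linarith
    · have hvA : v ∉ A := by
        intro h
        rcases mem_union.1 h with h | h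
        · exact (mem_sdiff.1 h).2 hv
        · exact hvY (mem_filter.1 h).2
      have h1 := key (fun T => par A₀ T = τ) fun T hT hp => by
        rw [hpu T hT, hp, par, singleton_inter_of_notMem hvA, card_empty, Nat.cast_zero, zero_add]
      have h2 : (#{T ∈ G v | ¬ par A₀ T = τ} : ℝ) ≤ #{T ∈ G v | par A₀ T = τ} := by
        exact_mod_cast not_lt.1 hvY
      have h3 := (Nat.cast_le (α := ℝ)).2 h1
      linarith

end


/-! ### Degrees, parity graphs and the extremal degree. -/

section
variable {V : Type*} [Fintype V] [DecidableEq V]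

/-- Sum the degrees of the `l`-sets containing `Q`; each edge is counted at most `2 ^ k` times. -/
theorem le_card_nb_of_forall_card_eq {H : Finset (Finset V)} {k l : ℕ} (hH : ∀ e ∈ H, #e = k)
    (hlk : l ≤ k) {c : ℝ} (hc : 0 ≤ c) (hn : 2 * l ≤ Fintype.card V)
    (hdeg : ∀ S : Finset V, #S = l → c * (Fintype.card V : ℝ) ^ (k - l) ≤ #(nb H S))
    {Q : Finset V} (hQ : #Q ≤ l) :
    c / (2 ^ k * 2 ^ l * l.factorial) * (Fintype.card V : ℝ) ^ (k - #Q) ≤ #(nb H Q) := by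
  set n := Fintype.card V
  have hQd : ∀ T ∈ powersetCard (l - #Q) (univ \ Q), Disjoint Q T := fun T hT =>
    (disjoint_of_subset_left (mem_powersetCard.1 hT).1 sdiff_disjoint).symm
  have h1 := sum_card_nb_union_le hH (P := Q) (powersetCard (l - #Q) (univ \ Q)) hQd
  have h2 : (#(powersetCard (l - #Q) (univ \ Q)) : ℝ) * (c * (n : ℝ) ^ (k - l)) ≤
      2 ^ k * #(nb H Q) := by
    calc (#(powersetCard (l - #Q) (univ \ Q)) : ℝ) * (c * (n : ℝ) ^ (k - l))
        = ∑ T ∈ powersetCard (l - #Q) (univ \ Q), c * (n : ℝ) ^ (k - l) := by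
          rw [sum_const, nsmul_eq_mul]
      _ ≤ ∑ T ∈ powersetCard (l - #Q) (univ \ Q), (#(nb H (Q ∪ T)) : ℝ) :=
          sum_le_sum fun T hT => hdeg _ (by
            rw [card_union_of_disjoint (hQd T hT), (mem_powersetCard.1 hT).2]; omega)
      _ ≤ _ := by exact_mod_cast h1
  have hQR : (#Q : ℝ) ≤ l := by exact_mod_cast hQ
  have hnR : 2 * (l : ℝ) ≤ n := by exact_mod_cast hn
  have h3 : #(univ \ Q) + #Q = n := by
    rw [card_sdiff_of_subset (subset_univ _), card_univ, Nat.sub_add_cancel (card_le_univ Q)]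
  have h3R : (#(univ \ Q) : ℝ) + #Q = n := by exact_mod_cast h3
  have h4 := pow_le_factorial_mul_choose (m := #(univ \ Q)) (a := l - #Q) (y := (n : ℝ) / 2)
    (by positivity) (by rw [Nat.cast_sub hQ]; linarith)
  rw [card_powersetCard] at h2
  have h5 : ((l - #Q).factorial : ℝ) ≤ l.factorial := by
    exact_mod_cast Nat.factorial_le (Nat.sub_le _ _)
  have h6 : (2 : ℝ) ^ (l - #Q) ≤ 2 ^ l := pow_le_pow_right₀ (by norm_num) (Nat.sub_le _ _)
  have h7 : (n : ℝ) ^ (k - #Q) = (n : ℝ) ^ (l - #Q) * (n : ℝ) ^ (k - l) := by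
    rw [← pow_add]; congr 1; omega
  have h8 : (n : ℝ) ^ (l - #Q) ≤ 2 ^ l * (l.factorial * ((#(univ \ Q)).choose (l - #Q) : ℝ)) := by
    calc (n : ℝ) ^ (l - #Q) = 2 ^ (l - #Q) * ((n : ℝ) / 2) ^ (l - #Q) := by
          rw [← mul_pow]; congr 1; ring
      _ ≤ 2 ^ l * ((l - #Q).factorial * ((#(univ \ Q)).choose (l - #Q) : ℝ)) := by gcongr
      _ ≤ _ := by gcongr
  rw [h7, div_mul_eq_mul_div, div_le_iff₀ (by positivity)]
  calc c * ((n : ℝ) ^ (l - #Q) * (n : ℝ) ^ (k - l))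
      ≤ c * (2 ^ l * (l.factorial * ((#(univ \ Q)).choose (l - #Q) : ℝ)) * (n : ℝ) ^ (k - l)) := by
        gcongr
    _ = 2 ^ l * l.factorial * (((#(univ \ Q)).choose (l - #Q) : ℝ) * (c * (n : ℝ) ^ (k - l))) := by
        ring
    _ ≤ 2 ^ l * l.factorial * (2 ^ k * #(nb H Q)) := by gcongr
    _ = _ := by ring

/-- Neighbours are sorted by their number `j` of vertices in `A`. The value depends only on `n`,
`|A|` and `i`, which permits comparing parity graphs on `V` and on `Fin n`. -/
theorem card_nb_paritySets {A S : Finset V} {τ : ZMod 2} {l x i : ℕ} (hS : #S = l)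
    (hi : #(S ∩ A) = i) : #(nb (paritySets A τ (l + x)) S) =
      ∑ j ∈ range (x + 1) with ((i + j : ℕ) : ZMod 2) = τ,
        (#A - i).choose j * (Fintype.card V - #A - (l - i)).choose (x - j) := by
  have h1 : nb (paritySets A τ (l + x)) S =
      ({j ∈ range (x + 1) | ((i + j : ℕ) : ZMod 2) = τ}).biUnion
        fun j => typedSets A Sᶜ j (x - j) := by
    ext T
    simp only [mem_nb, mem_paritySets, mem_biUnion, mem_filter, mem_range, mem_typedSets]
    constructor
    · rintro ⟨hd, hc, hp⟩
      rw [card_union_of_disjoint hd, hS] at hc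
      rw [par_union hd, par, par, hi] at hp
      have h2 := card_inter_add_card_sdiff T A
      exact ⟨#(T ∩ A), ⟨by omega, by push_cast; exact hp⟩,
        fun v hv => mem_compl.2 (disjoint_right.1 hd hv), rfl, by omega⟩
    · rintro ⟨j, ⟨hj, hp⟩, hT, hTA, hTB⟩
      have hd : Disjoint S T := disjoint_right.2 fun v hv => mem_compl.1 (hT hv)
      have h2 := card_inter_add_card_sdiff T A
      refine ⟨hd, by rw [card_union_of_disjoint hd]; omega, ?_⟩
      rw [par_union hd, par, par, hi, hTA, ← hp]
      push_cast
      rfl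
  have h2 : #(Sᶜ ∩ A) = #A - i := by
    have : Sᶜ ∩ A = A \ (S ∩ A) := by ext; simp; tauto
    rw [this, card_sdiff_of_subset inter_subset_right, hi]
  have h3 : #(Sᶜ \ A) = Fintype.card V - #A - (l - i) := by
    have : Sᶜ \ A = Aᶜ \ (S \ A) := by ext; simp; tauto
    have h4 := card_inter_add_card_sdiff S A
    rw [this, card_sdiff_of_subset, card_compl]
    · congr 1; omega
    · intro v hv
      rw [mem_compl]
      exact (mem_sdiff.1 hv).2
  rw [h1, card_biUnion]
  · refine sum_congr rfl fun j _ => ?_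
    rw [card_typedSets, h2, h3]
  · intro j _ j' _ hjj
    refine disjoint_left.2 fun T hT hT' => hjj ?_
    rw [← (mem_typedSets.1 hT).2.1, (mem_typedSets.1 hT').2.1]

namespace KGraph

theorem minDegree_le_degree {k l : ℕ} (H : KGraph V k) {S : Finset V} (hS : #S = l) :
    H.minDegree l ≤ H.degree S := Nat.sInf_le ⟨S, hS, rfl⟩

theorem exists_degree_eq_minDegree {k l : ℕ} (H : KGraph V k) (hl : l ≤ Fintype.card V) :
    ∃ S : Finset V, #S = l ∧ H.degree S = H.minDegree l := by
  obtain ⟨S, -, hS⟩ := exists_subset_card_eq (s := (univ : Finset V)) (n := l) (by rwa [card_univ])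
  exact Nat.sInf_mem (s := {d : ℕ | ∃ S : Finset V, S.card = l ∧ H.degree S = d}) ⟨_, S, hS, rfl⟩

theorem degree_eq_card_nb {k : ℕ} (H : KGraph V k) (S : Finset V) : H.degree S = #(nb H.edges S) :=
  rfl

theorem edges_oddGraph (k : ℕ) (A : Finset V) : (oddGraph k A).edges = paritySets A 1 k := by
  ext e
  rw [mem_paritySets, par, ZMod.natCast_eq_one_iff_odd, oddGraph]
  simp

theorem edges_compl_oddGraph (k : ℕ) (A : Finset V) :
    (oddGraph k A).compl.edges = paritySets A 0 k := by
  ext e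
  rw [mem_paritySets, par, ZMod.natCast_eq_zero_iff_even, mem_compl_oddGraph]

theorem edges_map_of_edges_eq {k : ℕ} {G : KGraph V k} {A : Finset V} {τ : ZMod 2} (σ : V ≃ V)
    (hG : G.edges = paritySets A τ k) :
    (G.map σ).edges = paritySets (A.map σ.toEmbedding) τ k := by
  have hmap : ∀ f : Finset V, par (A.map σ.toEmbedding) (f.map σ.toEmbedding) = par A f := by
    intro f
    rw [par, ← map_inter, card_map, par]
  ext e
  simp only [map, mem_map, hG, mem_paritySets]
  constructor
  · rintro ⟨f, ⟨h1, h2⟩, rfl⟩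
    change #(f.map σ.toEmbedding) = k ∧ par _ (f.map σ.toEmbedding) = τ
    rw [card_map, hmap]
    exact ⟨h1, h2⟩
  · rintro ⟨h1, h2⟩
    have he : (e.map σ.symm.toEmbedding).map σ.toEmbedding = e := by
      ext v; simp
    refine ⟨e.map σ.symm.toEmbedding, ⟨by rw [card_map, h1], ?_⟩, he⟩
    rw [← hmap, he, h2]

theorem minDegree_le_extremalDegree {n k l : ℕ} {G : KGraph (Fin n) k}
    (hG : G ∈ extremalFamily n k) : G.minDegree l ≤ extremalDegree n k l := by
  refine le_csSup ⟨Fintype.card (Finset (Fin n)), ?_⟩ ⟨G, hG, rfl⟩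
  rintro d ⟨G, -, rfl⟩
  by_cases h : ∃ S : Finset (Fin n), #S = l
  · obtain ⟨S, hS⟩ := h
    exact (G.minDegree_le_degree hS).trans (card_le_univ _)
  · have : G.minDegree l = 0 := by
      rw [minDegree, Nat.sInf_eq_zero]
      right
      ext d
      simp only [Set.mem_ofPred_eq, Set.mem_empty_iff_false, iff_false]
      rintro ⟨S, hS, -⟩
      exact h ⟨S, hS⟩
    omega

/-- The extremal family always contains a nearly balanced parity graph, whose `l`-degrees all have
the full order `n ^ x`. Hence the degree hypothesis on `H` entails a linear-density lower bound. -/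
theorem le_extremalDegree {l x n : ℕ} (hx : 1 ≤ x) (hn : 8 * (l + x + 1) ≤ n) :
    1 / (4 ^ x * x.factorial) * (n : ℝ) ^ x ≤ extremalDegree n (l + x) l := by
  obtain ⟨A, -, hA⟩ := exists_subset_card_eq (s := (univ : Finset (Fin n)))
    (n := 2 * (n / 4) + 1) (by rw [card_univ, Fintype.card_fin]; omega)
  have hG : (oddGraph (l + x) A).compl ∈ extremalFamily n (l + x) :=
    ⟨A, Or.inr ⟨by rw [hA]; exact ⟨n / 4, rfl⟩, rfl⟩⟩
  refine le_trans ?_ (Nat.cast_le.2 (minDegree_le_extremalDegree hG))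
  obtain ⟨S, hS, hSd⟩ := exists_degree_eq_minDegree (l := l) (oddGraph (l + x) A).compl
    (by rw [Fintype.card_fin]; omega)
  rw [← hSd, degree_eq_card_nb, edges_compl_oddGraph]
  obtain ⟨a, ha, haα⟩ := exists_le_natCast_zmod_two_eq hx (- par A S)
  have h1 : #A ≤ #(Sᶜ ∩ A) + #S := by
    have : A ⊆ (Sᶜ ∩ A) ∪ S := by intro w hw; simp; tauto
    exact (card_le_card this).trans (card_union_le _ _)
  have h2 : n - #A ≤ #(Sᶜ \ A) + #S := by
    have : Aᶜ ⊆ (Sᶜ \ A) ∪ S := by intro w hw; simp at hw ⊢; tauto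
    have h3 := (card_le_card this).trans (card_union_le _ _)
    rwa [card_compl, Fintype.card_fin] at h3
  have h4 : (n : ℝ) ≤ 4 * (n / 4 : ℕ) + 3 := by exact_mod_cast (by omega : n ≤ 4 * (n / 4) + 3)
  have h5 : ((n / 4 : ℕ) : ℝ) + 1 + x ≤ #(Sᶜ ∩ A) := by
    exact_mod_cast (by omega : n / 4 + 1 + x ≤ #(Sᶜ ∩ A))
  have h6 : ((n / 4 : ℕ) : ℝ) + 1 + x ≤ #(Sᶜ \ A) := by
    exact_mod_cast (by omega : n / 4 + 1 + x ≤ #(Sᶜ \ A))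
  have h7 := le_card_filter_of_type (A := A) (U := Sᶜ) ha (y := (n : ℝ) / 4) (by positivity)
    (by linarith) (by linarith) (p := fun T => T ∈ nb (paritySets A 0 (l + x)) S) (by
      intro T hT hTc hTA
      have hd : Disjoint S T := disjoint_right.2 fun v hv => mem_compl.1 (hT hv)
      rw [mem_nb, mem_paritySets, card_union_of_disjoint hd, par_union hd]
      refine ⟨hd, by omega, ?_⟩
      rw [show par A T = - par A S by rw [par, hTA, haα], add_neg_cancel])
  rw [filter_mem_eq_inter, univ_inter] at h7
  refine le_trans (le_of_eq ?_) h7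
  rw [div_pow]
  field_simp

/-- If the minimum degree exceeds the extremal value, then every set of some type lies in an edge of
the wrong parity whenever there is a parity obstruction. -/
theorem exists_forall_exists_par_eq {l x : ℕ} {H : KGraph V (l + x)} {A : Finset V} {τ : ZMod 2}
    (hl : l ≤ Fintype.card V)
    (hA : (τ = 1 ∧ Odd (((Fintype.card V / (l + x) : ℕ) : ℤ) - (#A : ℤ))) ∨ (τ = 0 ∧ Odd #A))
    (hH : extremalDegree (Fintype.card V) (l + x) l < H.minDegree l) :
    ∃ i ≤ l, ∀ S : Finset V, #S = l → #(S ∩ A) = i →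
      ∃ T ∈ nb H.edges S, par A (S ∪ T) = τ + 1 := by
  -- The parity obstruction says that the parity graph with a part of size `|A|` belongs to the
  -- extremal family. The sought `i` is the type of an `l`-set of minimum degree in it.
  obtain ⟨A', -, hA'⟩ := exists_subset_card_eq (s := (univ : Finset (Fin (Fintype.card V))))
    (n := #A) (by rw [card_univ, Fintype.card_fin]; exact card_le_univ A)
  obtain ⟨G, hG, hGe⟩ : ∃ G ∈ extremalFamily (Fintype.card V) (l + x),
      G.edges = paritySets A' τ (l + x) := by
    rcases hA with ⟨rfl, h⟩ | ⟨rfl, h⟩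
    · exact ⟨_, ⟨A', Or.inl ⟨by rw [hA']; exact h, rfl⟩⟩, edges_oddGraph _ _⟩
    · exact ⟨_, ⟨A', Or.inr ⟨by rw [hA']; exact h, rfl⟩⟩, edges_compl_oddGraph _ _⟩
  obtain ⟨S', hS', hd⟩ := G.exists_degree_eq_minDegree (l := l) (by rwa [Fintype.card_fin])
  refine ⟨#(S' ∩ A'), hS' ▸ card_le_card inter_subset_left, fun S hS hSi => ?_⟩
  by_contra hcon
  push Not at hcon
  -- Without wrong edges at `S`, its degree is at most the degree of its type in the parity graph,
  -- which is at most the extremal degree.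
  have h1 : nb H.edges S ⊆ nb (paritySets A τ (l + x)) S := by
    intro T hT
    have hT' := mem_nb.1 hT
    refine mem_nb.2 ⟨hT'.1, mem_paritySets.2 ⟨H.uniform _ hT'.2, ?_⟩⟩
    by_contra h
    exact hcon T hT (zmod_two_ne_iff.1 h)
  have h2 := card_le_card h1
  have h3 := H.minDegree_le_degree hS
  have h4 := minDegree_le_extremalDegree (l := l) hG
  rw [degree_eq_card_nb] at h3 hd
  rw [card_nb_paritySets hS hSi] at h2
  rw [hGe, card_nb_paritySets hS' rfl, Fintype.card_fin, hA'] at hd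
  omega

end KGraph

end


/-! ### Choice of constants and conclusion. -/

/-- The constants `c₁`, `c₂`, `c` bound in turn the degrees of `l`-sets, of all smaller sets, and
the number of right edges at exceptional vertices. Only then are `η`, `θ` and the closeness `θ ^ 2 /
2 ^ k` chosen, small in terms of `c`. -/
theorem exists_forall_isClose_hasHamiltonCycle {l x : ℕ} (hl : 4 ≤ l) (hx : 1 ≤ x) (hxl : x ≤ l) :
    ∃ ε : ℝ, 0 < ε ∧ ∃ N : ℕ, ∀ (V : Type*) [Fintype V] [DecidableEq V] (H : KGraph V (l + x)),
      N ≤ Fintype.card V → l + x ∣ Fintype.card V →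
      (∃ A : Finset V, KGraph.IsBalanced A ∧
        (KGraph.IsClose ε H (KGraph.oddGraph (l + x) A) ∨
          KGraph.IsClose ε H (KGraph.oddGraph (l + x) A).compl)) →
      KGraph.extremalDegree (Fintype.card V) (l + x) l < H.minDegree l → H.HasHamiltonCycle l := by
  set k := l + x with hk
  set c₁ : ℝ := 1 / (4 ^ x * x.factorial) with hc₁
  have hc₁0 : 0 < c₁ := by positivity
  set c₂ : ℝ := c₁ / (2 ^ k * 2 ^ l * l.factorial) with hc₂
  have hc₂0 : 0 < c₂ := by positivity
  have hc₂₁ : c₂ ≤ c₁ := div_le_self hc₁0.le (by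
    have h1 : (1 : ℝ) ≤ 2 ^ k := one_le_pow₀ (by norm_num)
    have h2 : (1 : ℝ) ≤ 2 ^ l := one_le_pow₀ (by norm_num)
    have h3 : (1 : ℝ) ≤ l.factorial := by exact_mod_cast Nat.factorial_pos l
    exact one_le_mul_of_one_le_of_one_le (one_le_mul_of_one_le_of_one_le h1 h2) h3)
  set c : ℝ := c₂ / (128 * 2 ^ k) with hc
  have hc0 : 0 < c := by positivity
  have hcc₂ : c ≤ c₂ := div_le_self hc₂0.le (by
    have h1 : (1 : ℝ) ≤ 2 ^ k := one_le_pow₀ (by norm_num)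
    linarith)
  obtain ⟨η, hη, N₁, hN₁⟩ := exists_forall_hasHamiltonCycle hl hx hxl hc0
  set θ : ℝ := min (η / 4) (min (c₂ / (64 * 2 ^ k)) (1 / 100)) with hθ
  have hθ0 : 0 < θ := by positivity
  have hθ1 : θ ≤ η / 4 := min_le_left _ _
  have hθ2 : θ ≤ c₂ / (64 * 2 ^ k) := (min_le_right _ _).trans (min_le_left _ _)
  have hθ3 : θ ≤ 1 / 100 := (min_le_right _ _).trans (min_le_right _ _)
  clear_value θ
  -- For large `n` this absorbs the difference of at most 1 between the sizes of the two parts.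
  obtain ⟨N₂, hN₂⟩ := exists_nat_gt (2 / η)
  refine ⟨θ ^ 2 / 2 ^ k, by positivity, N₁ + N₂ + 100 * (k + 1), ?_⟩
  rintro V _ _ H hN ⟨t, ht⟩ ⟨A₁, hbal, hclose⟩ hdeg
  set n := Fintype.card V with hndef
  have hn0 : 0 < n := by omega
  have hn100 : (100 : ℝ) ≤ n := by exact_mod_cast (by omega : 100 ≤ n)
  have hnη : 2 ≤ η * n := by
    have : (N₂ : ℝ) ≤ n := by exact_mod_cast (by omega : N₂ ≤ n)
    rw [div_lt_iff₀ hη] at hN₂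
    nlinarith
  obtain ⟨τ, A₀, hA₀, hcl⟩ : ∃ (τ : ZMod 2) (A₀ : Finset V), #A₀ = #A₁ ∧
      (#(symmDiff H.edges (paritySets A₀ τ k)) : ℝ) ≤ θ ^ 2 / 2 ^ k * (n : ℝ) ^ k := by
    rcases hclose with ⟨σ, hσ⟩ | ⟨σ, hσ⟩
    · rw [KGraph.edges_map_of_edges_eq σ (KGraph.edges_oddGraph k A₁)] at hσ
      exact ⟨1, _, card_map _, hσ⟩
    · rw [KGraph.edges_map_of_edges_eq σ (KGraph.edges_compl_oddGraph k A₁)] at hσ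
      exact ⟨0, _, card_map _, hσ⟩
  have hbal' : 2 * #A₀ ≤ n + 1 ∧ n ≤ 2 * #A₀ + 1 := by
    have h1 := hbal.1
    have h2 := hbal.2
    have h3 := card_le_univ A₁
    rw [card_compl] at h1 h2
    omega
  have hb1 : 2 * (#A₀ : ℝ) ≤ n + 1 := by exact_mod_cast hbal'.1
  have hb2 : (n : ℝ) ≤ 2 * #A₀ + 1 := by exact_mod_cast hbal'.2
  have hB : (#(univ \ A₀) : ℝ) + #A₀ = n := by
    have : #(univ \ A₀) + #A₀ = n := by
      rw [card_sdiff_of_subset (subset_univ _), card_univ, Nat.sub_add_cancel (card_le_univ _)]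
    exact_mod_cast this
  have hdl : ∀ S : Finset V, #S = l → c₁ * (n : ℝ) ^ (k - l) ≤ #(nb H.edges S) := by
    intro S hS
    have h1 := KGraph.le_extremalDegree (l := l) (x := x) (n := n) hx (by omega)
    have h2 := hdeg.le.trans (H.minDegree_le_degree hS)
    rw [show k - l = x by omega]
    exact h1.trans (by exact_mod_cast h2)
  have hdQ : ∀ Q : Finset V, #Q ≤ l → c₂ * (n : ℝ) ^ (k - #Q) ≤ #(nb H.edges Q) := fun Q hQ =>
    le_card_nb_of_forall_card_eq H.uniform (by omega) hc₁0.le (by omega) hdl hQ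
  have hθn : θ * n ≤ n / 100 := by
    have := mul_le_mul_of_nonneg_right hθ3 (show (0 : ℝ) ≤ n by positivity)
    linarith
  have hθη : θ * n ≤ η / 4 * n := by gcongr
  obtain ⟨A, X, hA1, hA2, hX, hmis, hXn, hXd⟩ := exists_adjusted_part (H := H.edges) (A₀ := A₀)
    (τ := τ) (k := k) (c := c₂) (θ := θ) H.uniform (by omega) hn0 hc₂0 hθ0 (by linarith) hθ2
    (fun Q hQ => by
      have := hdQ Q (by omega)
      rwa [hQ] at this) (by linarith) (by linarith) (by
      rw [div_mul_eq_mul_div, le_div_iff₀ (by positivity)] at hcl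
      linarith)
  refine hN₁ V H A X τ t (by rw [← hndef, ht, mul_comm]) (by omega) (by linarith) (by linarith)
    (hmis.trans (by gcongr; linarith)) (hX.trans (by gcongr; linarith))
    (fun v hv => (hXn v hv).trans (by gcongr; linarith)) hXd (fun S hS => ?_) (fun S hS => ?_)
    fun hpar => ?_
  · have h1 := hdQ S hS.le
    rw [hS, show k - l = x by omega] at h1
    exact le_trans (by gcongr) h1
  · have h1 := hdQ S (by omega)
    rw [hS, show k - x = l by omega] at h1
    exact le_trans (by gcongr) h1
  · refine KGraph.exists_forall_exists_par_eq (by omega) ?_ hdeg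
    have hpA : par A univ = (#A : ZMod 2) := by rw [par, univ_inter]
    rw [hpA] at hpar
    rcases zmod_two_cases τ with rfl | rfl
    · right
      refine ⟨rfl, ?_⟩
      rw [mul_zero, Ne, ZMod.natCast_eq_zero_iff_even, Nat.not_even_iff_odd] at hpar
      exact hpar
    · left
      refine ⟨rfl, ?_⟩
      rw [mul_one] at hpar
      have h1 : n / (l + x) = t := by
        rw [ht, Nat.mul_div_cancel_left _ (by omega)]
      rw [← hndef, h1, ← Int.not_even_iff_odd, ← ZMod.intCast_eq_zero_iff_even]
      push_cast
      rw [sub_eq_zero]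
      exact fun h => hpar h.symm


theorem theorem1p3 :
    ∃ n₀ : ℕ → ℝ → ℕ, ∀ k l : ℕ, 7 ≤ k → (k : ℝ) / 2 ≤ (l : ℝ) → l ≤ k - 1 →
      ∃ ε : ℝ, 0 < ε ∧
        ∀ (V : Type u) [Fintype V] [DecidableEq V] (H : KGraph V k),
          n₀ k ε ≤ Fintype.card V → k ∣ Fintype.card V →
          (∃ A : Finset V, KGraph.IsBalanced A ∧
            (KGraph.IsClose ε H (KGraph.oddGraph k A) ∨
              KGraph.IsClose ε H (KGraph.oddGraph k A).compl)) →
          KGraph.extremalDegree (Fintype.card V) k l < H.minDegree l →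
          H.HasHamiltonCycle l := by
  have key : ∀ k l : ℕ, (7 ≤ k ∧ k ≤ 2 * l ∧ l + 1 ≤ k) → ∃ ε : ℝ, ∃ N : ℕ, 0 < ε ∧
      ∀ (V : Type u) [Fintype V] [DecidableEq V] (H : KGraph V k),
        N ≤ Fintype.card V → k ∣ Fintype.card V →
        (∃ A : Finset V, KGraph.IsBalanced A ∧
          (KGraph.IsClose ε H (KGraph.oddGraph k A) ∨
            KGraph.IsClose ε H (KGraph.oddGraph k A).compl)) →
        KGraph.extremalDegree (Fintype.card V) k l < H.minDegree l → H.HasHamiltonCycle l := by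
    rintro k l ⟨hk, hkl, hlk⟩
    obtain ⟨x, rfl⟩ : ∃ x, k = l + x := ⟨k - l, by omega⟩
    obtain ⟨ε, hε, N, h⟩ := exists_forall_isClose_hasHamiltonCycle (l := l) (x := x) (by omega)
      (by omega) (by omega)
    exact ⟨ε, N, hε, h⟩
  choose! ε N hε h using key
  -- The threshold is fixed before `l`, so the maximum over all `l < k` is taken.
  refine ⟨fun k _ => (range k).sup (N k), fun k l hk hl hlk => ?_⟩
  have hkl : k ≤ 2 * l := by
    have : (k : ℝ) ≤ 2 * l := by linarith
    exact_mod_cast this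
  have hp : 7 ≤ k ∧ k ≤ 2 * l ∧ l + 1 ≤ k := ⟨hk, hkl, by omega⟩
  exact ⟨ε k l, hε k l hp, fun V _ _ H hn =>
    h k l hp V H ((le_sup (f := N k) (mem_range.2 (by omega))).trans hn)⟩
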